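/- Let $n\ge 1$, let $(V,q)$ be a real quadratic space of dimension $n+2$ and signature $(2,n)$ with bilinear form $b$, extended $\mathbb{C}$-bilinearly to $V_{\mathbb{C}}$, and identify $\mathbb{P}(V_{\mathbb{C}})$ with $\mathbb{P}^{n+1}$ by a choice of basis of $V$. Let $o$ be a point of the symmetric space $\mathcal{D}$ of the orthogonal group of $(V,q)$, realized as (a connected component of) $\{[v]\in\mathbb{P}(V_{\mathbb{C}}) : b(v,v)=0,\ b(v,\overline{v})>0\}$. Let $G=\mathrm{SO}(V)$, let $K$ be the stabilizer of $o$ in $G$, let $\breve{G}$ be the compact real form of $\mathrm{SO}(V_{\mathbb{C}})$ determined by the Cartan involution at $o$, and let $\breve{\mathcal{D}}=\breve{G}\cdot o\subset\mathbb{P}^{n+1}$ be the compact dual of $\mathcal{D}$. Then: 1. The stabilizer of $o$ in $\breve{G}$ is $K$, so that $\breve{\mathcal{D}}\simeq\breve{G}/K$; and $\breve{\mathcal{D}}$ is the quadric hypersurface $\{[v] : q(v)=0\}$ in $\mathbb{P}^{n+1}$, the zero locus of an irreducible homogeneous polynomial of degree $2$. 2. The canonical bundle of $\breve{\mathcal{D}}$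 is $\Omega^n_{\breve{\mathcal{D}}}\cong\mathcal{O}_{\breve{\mathcal{D}}}(-n)$. 3. For all $k\in\mathbb{Z}$ and $p\ge 0$ the spaces $H^p(\breve{\mathcal{D}},\mathcal{O}_{\breve{\mathcal{D}}}(k))$ and $H^p(\mathbb{P}^{n+1},\mathcal{O}_{\mathbb{P}^{n+1}}(k))$ are finite dimensional, and for every $\ell\in\mathbb{Z}$, with $\mathcal{O}_{\breve{\mathcal{D}}}(-n)^{\ell}=\mathcal{O}_{\breve{\mathcal{D}}}(-n\ell)$, $$\chi\bigl(\mathcal{O}_{\breve{\mathcal{D}}}(-n)^{\ell}\bigr)=\chi\bigl(\mathcal{O}_{\mathbb{P}^{n+1}}(-n\ell)\bigr)-\chi\bigl(\mathcal{O}_{\mathbb{P}^{n+1}}(-n\ell-2)\bigr)=\binom{n+1-n\ell}{n+1}-\binom{n-1-n\ell}{n+1},$$ where $\binom{x}{m}=x(x-1)\cdots(x-m+1)/m!$ for every integer $x$. -/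

import Mathlib

open scoped LinearAlgebra.Projectivization

noncomputable section

namespace OrthogonalDual

/-! ## Projective varieties over the complex numbers, in homogeneous coordinates

A projective variety in `ℙ^(N-1)` is given by its set of points `X`.  A subset `U` of projective
space is used below only when it is the intersection of `X` with a Zariski open set. -/

/-- Complex projective space of dimension `N - 1`, with homogeneous coordinates `x_i`, `i : Fin N`. -/
abbrev PSpace (N : ℕ) : Type := ℙ ℂ (Fin N → ℂ)

variable {N : ℕ}

/-- The punctured affine cone over a set of points of projective space. -/
def cone (U : Set (PSpace N)) : Set (Fin N → ℂ) :=
  {v | ∃ h : v ≠ 0, Projectivization.mk ℂ v h ∈ U}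

/-- The points of `X` where the homogeneous polynomial `F` does not vanish. -/
def basicOpen (X : Set (PSpace N)) (F : MvPolynomial (Fin N) ℂ) : Set (PSpace N) :=
  {x ∈ X | MvPolynomial.eval x.rep F ≠ 0}

/-- The points where the homogeneous polynomial `F` vanishes. -/
def zeroLocus (F : MvPolynomial (Fin N) ℂ) : Set (PSpace N) :=
  {x | MvPolynomial.eval x.rep F = 0}

/-- `s` is, near every point of the cone over `U`, a quotient `P / R` of homogeneous polynomials
with `deg P - deg R = k`.  (The basic open sets `R ≠ 0` form a basis of the Zariski topology, so
that it is enough to use neighbourhoods of this form.) -/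
def IsLocallyFraction (U : Set (PSpace N)) (k : ℤ) (s : cone U → ℂ) : Prop :=
  ∀ v : cone U, ∃ (a b : ℕ) (P R : MvPolynomial (Fin N) ℂ),
    P.IsHomogeneous a ∧ R.IsHomogeneous b ∧ (a : ℤ) = b + k ∧
    MvPolynomial.eval v.1 R ≠ 0 ∧
    ∀ w : cone U, MvPolynomial.eval w.1 R ≠ 0 →
      s w = MvPolynomial.eval w.1 P / MvPolynomial.eval w.1 R

lemma IsLocallyFraction.mul {U : Set (PSpace N)} {j k : ℤ} {s t : cone U → ℂ}
    (hs : IsLocallyFraction U j s) (ht : IsLocallyFraction U k t) :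
    IsLocallyFraction U (j + k) (s * t) := by
  intro v
  obtain ⟨a, b, P, R, hP, hR, hab, hv, h⟩ := hs v
  obtain ⟨a', b', P', R', hP', hR', hab', hv', h'⟩ := ht v
  refine ⟨a + a', b + b', P * P', R * R', hP.mul hP', hR.mul hR', by push_cast; omega, ?_, ?_⟩
  · simpa using ⟨hv, hv'⟩
  · intro w hw
    rw [map_mul] at hw
    rw [Pi.mul_apply, h w (left_ne_zero_of_mul hw), h' w (right_ne_zero_of_mul hw), map_mul,
      map_mul, div_mul_div_comm]

lemma IsLocallyFraction.add {U : Set (PSpace N)} {k : ℤ} {s t : cone U → ℂ}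
    (hs : IsLocallyFraction U k s) (ht : IsLocallyFraction U k t) :
    IsLocallyFraction U k (s + t) := by
  intro v
  obtain ⟨a, b, P, R, hP, hR, hab, hv, h⟩ := hs v
  obtain ⟨a', b', P', R', hP', hR', hab', hv', h'⟩ := ht v
  refine ⟨a + b', b + b', P * R' + P' * R, R * R', ?_, hR.mul hR', by push_cast; omega, ?_, ?_⟩
  · refine (hP.mul hR').add ?_
    have e : a + b' = a' + b := by omega
    rw [e]
    exact hP'.mul hR
  · simpa using ⟨hv, hv'⟩
  · intro w hw
    rw [map_mul] at hw
    have h1 := left_ne_zero_of_mul hw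
    have h2 := right_ne_zero_of_mul hw
    rw [Pi.add_apply, h w h1, h' w h2, map_mul, map_add, map_mul, map_mul, div_add_div _ _ h1 h2]
    ring

lemma isLocallyFraction_const (U : Set (PSpace N)) (c : ℂ) :
    IsLocallyFraction U 0 (fun _ => c) := by
  intro v
  refine ⟨0, 0, MvPolynomial.C c, 1, MvPolynomial.isHomogeneous_C _ _,
    MvPolynomial.isHomogeneous_one _ _, by simp, by simp, ?_⟩
  intro w _
  simp

lemma isLocallyFraction_zero (U : Set (PSpace N)) (k : ℤ) :
    IsLocallyFraction U k (0 : cone U → ℂ) := by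
  intro v
  obtain ⟨h0, -⟩ := v.2
  obtain ⟨i, hi⟩ := Function.ne_iff.mp h0
  refine ⟨k.toNat, (-k).toNat, 0, MvPolynomial.X i ^ (-k).toNat,
    MvPolynomial.isHomogeneous_zero _ _ _, ?_, by omega, ?_, ?_⟩
  · simpa using (MvPolynomial.isHomogeneous_X ℂ i).pow (-k).toNat
  · have hi' : v.1 i ≠ 0 := hi
    simp [hi']
  · intro w _
    simp

/-- The sections over `U` of the twisting sheaf `𝒪(k)`: functions on the punctured cone over `U`
that are locally quotients of homogeneous polynomials, homogeneous of degree `k`. -/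
def twistedSections (U : Set (PSpace N)) (k : ℤ) : Submodule ℂ (cone U → ℂ) where
  carrier := {s | IsLocallyFraction U k s}
  add_mem' := IsLocallyFraction.add
  zero_mem' := isLocallyFraction_zero U k
  smul_mem' := fun c s hs => by
    have h := (isLocallyFraction_const U c).mul hs
    rw [zero_add] at h
    exact h

/-- The ring of regular functions `𝒪(U)`, the sections of `𝒪(0)`. -/
def regularFunctions (U : Set (PSpace N)) : Subalgebra ℂ (cone U → ℂ) where
  carrier := {s | IsLocallyFraction U 0 s}
  mul_mem' := fun hs ht => by
    have h := IsLocallyFraction.mul hs ht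
    rw [add_zero] at h
    exact h
  add_mem' := IsLocallyFraction.add
  algebraMap_mem' := isLocallyFraction_const U

/-- `𝒪(k)` is a module over the ring of regular functions, by multiplication of functions. -/
instance (U : Set (PSpace N)) (k : ℤ) : Module (regularFunctions U) (twistedSections U k) where
  smul f s := ⟨f.1 * s.1, by
    have h := IsLocallyFraction.mul f.2 s.2
    rw [zero_add] at h
    exact h⟩
  one_smul s := Subtype.ext (one_mul s.1)
  mul_smul f g s := Subtype.ext (mul_assoc f.1 g.1 s.1)
  smul_zero f := Subtype.ext (mul_zero f.1)
  smul_add f s t := Subtype.ext (mul_add f.1 s.1 t.1)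
  add_smul f g s := Subtype.ext (add_mul f.1 g.1 s.1)
  zero_smul s := Subtype.ext (zero_mul s.1)

lemma cone_mono {U U' : Set (PSpace N)} (h : U ⊆ U') : cone U ⊆ cone U' :=
  fun _ hv => ⟨hv.1, h hv.2⟩

lemma IsLocallyFraction.restrict {U U' : Set (PSpace N)} (h : U ⊆ U') {k : ℤ} {s : cone U' → ℂ}
    (hs : IsLocallyFraction U' k s) :
    IsLocallyFraction U k (s ∘ Set.inclusion (cone_mono h)) := by
  intro v
  obtain ⟨a, b, P, R, hP, hR, hab, hv, H⟩ := hs (Set.inclusion (cone_mono h) v)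
  exact ⟨a, b, P, R, hP, hR, hab, hv, fun w hw => H (Set.inclusion (cone_mono h) w) hw⟩

/-- Restriction of sections of `𝒪(k)`. -/
def resTwisted {U U' : Set (PSpace N)} (h : U ⊆ U') (k : ℤ) :
    twistedSections U' k →ₗ[ℂ] twistedSections U k where
  toFun s := ⟨s.1 ∘ Set.inclusion (cone_mono h), IsLocallyFraction.restrict h s.2⟩
  map_add' _ _ := rfl
  map_smul' _ _ := rfl

/-- Restriction of regular functions. -/
def resRegular {U U' : Set (PSpace N)} (h : U ⊆ U') (s : regularFunctions U') :
    regularFunctions U :=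
  ⟨s.1 ∘ Set.inclusion (cone_mono h), IsLocallyFraction.restrict h s.2⟩

/-! ## Cohomology and Euler characteristic of `𝒪(k)`

Coherent cohomology is computed by the alternating Čech complex of the finite affine open cover of
`X` by the sets `x_i ≠ 0`. -/

/-- The part of `X` where all the coordinates `x_(σ 0), …, x_(σ p)` are nonzero. -/
def chart (X : Set (PSpace N)) {p : ℕ} (σ : Fin (p + 1) ↪o Fin N) : Set (PSpace N) :=
  {x ∈ X | ∀ a, x.rep (σ a) ≠ 0}

/-- Omit the `j`-th index of a strictly increasing sequence of indices. -/
def face {p : ℕ} (σ : Fin (p + 2) ↪o Fin N) (j : Fin (p + 2)) : Fin (p + 1) ↪o Fin N :=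
  (Fin.succAboveOrderEmb j).trans σ

lemma chart_subset_face (X : Set (PSpace N)) {p : ℕ} (σ : Fin (p + 2) ↪o Fin N)
    (j : Fin (p + 2)) : chart X σ ⊆ chart X (face σ j) :=
  fun _ hx => ⟨hx.1, fun a => hx.2 (j.succAbove a)⟩

/-- Čech cochains of degree `p` of `𝒪_X(k)`. -/
abbrev Cochain (X : Set (PSpace N)) (k : ℤ) (p : ℕ) : Type :=
  (σ : Fin (p + 1) ↪o Fin N) → twistedSections (chart X σ) k

instance (X : Set (PSpace N)) (k : ℤ) (p : ℕ) : AddCommGroup (Cochain X k p) :=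
  Pi.addCommGroup

/-- The Čech differential. -/
def cechD (X : Set (PSpace N)) (k : ℤ) (p : ℕ) : Cochain X k p →ₗ[ℂ] Cochain X k (p + 1) :=
  LinearMap.pi fun σ => ∑ j : Fin (p + 2), (-1 : ℂ) ^ (j : ℕ) •
    (resTwisted (chart_subset_face X σ j) k ∘ₗ LinearMap.proj (face σ j))

/-- The Čech coboundaries. -/
def coboundaries (X : Set (PSpace N)) (k : ℤ) : (p : ℕ) → Submodule ℂ (Cochain X k p)
  | 0 => ⊥
  | p + 1 => LinearMap.range (cechD X k p)

/-- The cohomology `H^p(X, 𝒪_X(k))`. -/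
abbrev Cohomology (X : Set (PSpace N)) (k : ℤ) (p : ℕ) : Type :=
  LinearMap.ker (cechD X k p) ⧸ (coboundaries X k p).submoduleOf (LinearMap.ker (cechD X k p))

/-- The Euler characteristic `χ(X, 𝒪_X(k))`.  There are no nonzero cochains in degrees `≥ N`. -/
def eulerChar (X : Set (PSpace N)) (k : ℤ) : ℤ :=
  ∑ p ∈ Finset.range N, (-1) ^ p * (Module.finrank ℂ (Cohomology X k p) : ℤ)

/-! ## The canonical bundle -/

/-- Homogeneous polynomials of positive degree; the sets `basicOpen X F` of such polynomials `F`
are affine and form a basis of the Zariski topology of a closed set `X`. -/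
def PosHomogeneous (N : ℕ) : Type :=
  {F : MvPolynomial (Fin N) ℂ // ∃ d : ℕ, 0 < d ∧ F.IsHomogeneous d}

/-- The top differential forms `⋀ⁿ Ω_(A/ℂ)`, where `A = 𝒪(U)`; for an affine open `U` of a smooth
variety of dimension `n` these are the sections over `U` of the canonical bundle. -/
abbrev TopForms (n : ℕ) (U : Set (PSpace N)) : Type :=
  ⋀[regularFunctions U]^n (Ω[regularFunctions U⁄ℂ])

/-- The form `da_1 ∧ ⋯ ∧ da_n`. -/
def wedgeD {n : ℕ} {U : Set (PSpace N)} (a : Fin n → regularFunctions U) : TopForms n U :=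
  exteriorPower.ιMulti (regularFunctions U) n
    fun i => KaehlerDifferential.D ℂ (regularFunctions U) (a i)

/-- The sheaf `⋀ⁿ Ω_X` is isomorphic to `𝒪_X(m)`: there are isomorphisms of `𝒪(U)`-modules between
their sections over all basic affine opens `U` that commute with restriction.  (The forms
`da_1 ∧ ⋯ ∧ da_n` generate, so that the compatibility need only be stated for them.) -/
def CanonicalBundleIs (n : ℕ) (X : Set (PSpace N)) (m : ℤ) : Prop :=
  ∃ e : (F : PosHomogeneous N) →
      TopForms n (basicOpen X F.1) ≃ₗ[regularFunctions (basicOpen X F.1)]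
        twistedSections (basicOpen X F.1) m,
    ∀ (F G : PosHomogeneous N) (h : basicOpen X G.1 ⊆ basicOpen X F.1)
      (a : Fin n → regularFunctions (basicOpen X F.1)),
      resTwisted h m (e F (wedgeD a)) = e G (wedgeD fun i => resRegular h (a i))

/-! ## The symmetric space of an orthogonal group and its compact dual

`S` is the Gram matrix of a real quadratic space `V` in some basis, so that `Fin N → ℂ` is the
complexification of `V`, with complex conjugation `star`. -/

/-- The Gram matrix of the bilinear form `b(x, y) = (q(x + y) - q(x) - q(y)) / 2`. -/
def gram {V : Type*} [AddCommGroup V] [Module ℝ V] (q : QuadraticForm ℝ V)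
    (e : Module.Basis (Fin N) ℝ V) : Matrix (Fin N) (Fin N) ℝ :=
  Matrix.of fun i j => QuadraticMap.polar q (e i) (e j) / 2

/-- The complex bilinear extension of the bilinear form. -/
def bilC (S : Matrix (Fin N) (Fin N) ℝ) (v w : Fin N → ℂ) : ℂ :=
  ∑ i, ∑ j, (S i j : ℂ) * v i * w j

/-- The quadratic form as a polynomial in the homogeneous coordinates. -/
def quadricPoly (S : Matrix (Fin N) (Fin N) ℝ) : MvPolynomial (Fin N) ℂ :=
  ∑ i, ∑ j, MvPolynomial.C (S i j : ℂ) * MvPolynomial.X i * MvPolynomial.X j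

/-- The projective model `κ = {[v] | b(v, v) = 0, b(v, v̄) > 0}`.  In signature `(2, n)`, `n ≥ 1`,
each of its two connected components is a model of the Hermitian symmetric space `𝒟`; the point
`[x + i y]` corresponds to the positive definite plane with oriented basis `x, y`. -/
def symmetricSpace (S : Matrix (Fin N) (Fin N) ℝ) : Set (PSpace N) :=
  {o | bilC S o.rep o.rep = 0 ∧ 0 < (bilC S o.rep (star o.rep)).re}

/-- The Cartan involution of the complexification of `V` at a point `o = [x + i y]` of the symmetric
space: the identity on the span of `x, y`, minus the identity on its orthogonal complement. -/
def cartanInvolution (S : Matrix (Fin N) (Fin N) ℝ) (o : PSpace N) (v : Fin N → ℂ) : Fin N → ℂ :=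
  (2 * bilC S v (star o.rep) / bilC S o.rep (star o.rep)) • o.rep +
    (2 * bilC S v o.rep / bilC S o.rep (star o.rep)) • star o.rep - v

/-- The elements of the complex group `G_ℂ = SO(V_ℂ)` that commute with a map `τ` (below, the
conjugation with respect to a real structure of `V_ℂ`). -/
def formOf (S : Matrix (Fin N) (Fin N) ℝ) (τ : (Fin N → ℂ) → (Fin N → ℂ)) :
    Subgroup (Matrix.SpecialLinearGroup (Fin N) ℂ) where
  carrier := {g | (∀ v w, bilC S (g.1.mulVec v) (g.1.mulVec w) = bilC S v w) ∧
    ∀ v, g.1.mulVec (τ v) = τ (g.1.mulVec v)}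
  one_mem' := by simp
  mul_mem' := by
    rintro g h ⟨hg, hg'⟩ ⟨hh, hh'⟩
    refine ⟨fun v w => ?_, fun v => ?_⟩
    · simp only [Matrix.SpecialLinearGroup.coe_mul, ← Matrix.mulVec_mulVec, hg, hh]
    · simp only [Matrix.SpecialLinearGroup.coe_mul, ← Matrix.mulVec_mulVec, hg', hh']
  inv_mem' := by
    rintro g ⟨hg, hg'⟩
    have e1 : ∀ v, g.1.mulVec ((g⁻¹).1.mulVec v) = v := fun v => by
      rw [Matrix.mulVec_mulVec, ← Matrix.SpecialLinearGroup.coe_mul, mul_inv_cancel,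
        Matrix.SpecialLinearGroup.coe_one, Matrix.one_mulVec]
    have e2 : ∀ v, (g⁻¹).1.mulVec (g.1.mulVec v) = v := fun v => by
      rw [Matrix.mulVec_mulVec, ← Matrix.SpecialLinearGroup.coe_mul, inv_mul_cancel,
        Matrix.SpecialLinearGroup.coe_one, Matrix.one_mulVec]
    refine ⟨fun v w => ?_, fun v => ?_⟩
    · rw [← hg, e1, e1]
    · rw [← e2 (τ ((g⁻¹).1.mulVec v)), hg', e1]

/-- The real group `G = SO(V)`. -/
def realGroup (S : Matrix (Fin N) (Fin N) ℝ) : Subgroup (Matrix.SpecialLinearGroup (Fin N) ℂ) :=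
  formOf S star

/-- The compact real form `Ğ` of `G_ℂ` attached to the Cartan involution `θ` at `o`: the elements
commuting with `v ↦ θ (v̄)`, whose fixed points form a real structure of `V_ℂ` on which the quadratic
form is positive definite. -/
def compactForm (S : Matrix (Fin N) (Fin N) ℝ) (o : PSpace N) :
    Subgroup (Matrix.SpecialLinearGroup (Fin N) ℂ) :=
  formOf S fun v => cartanInvolution S o (star v)

/-- The isotropy group `K` of the point `o` in the real group `G`. -/
def isotropyGroup (S : Matrix (Fin N) (Fin N) ℝ) (o : PSpace N) :
    Subgroup (Matrix.SpecialLinearGroup (Fin N) ℂ) :=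
  realGroup S ⊓ MulAction.stabilizer (Matrix.SpecialLinearGroup (Fin N) ℂ) o

/-- The compact dual `Ğ / K` of the symmetric space, as the orbit of the base point `o` under the
compact real form in the projective space of `V_ℂ`. -/
def compactDual (S : Matrix (Fin N) (Fin N) ℝ) (o : PSpace N) : Set (PSpace N) :=
  MulAction.orbit (compactForm S o) o

end OrthogonalDual

end

/-!
Write `S` for the Gram matrix, `b` for the complex bilinear form, `Q` for the quadratic form as a
polynomial, `X` for its zero locus in `ℙ^(n + 1)` and `ω = x + i y` for a vector that represents the
base point `o`.

**The compact dual.** By Sylvester's law of inertia `b` is negative definite on the real orthogonal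
complement of the positive definite plane of `x` and `y` (`isBaseVector_rep`).  Hence, for the Cartan
involution `θ`, the form `b(v, θ v̄)` is a positive definite Hermitian form
(`bilC_compactConj_pos`).  This makes `b` nondegenerate, so the gradient of `Q` vanishes only at the
origin, `Q` is irreducible and `X` is smooth (`isSmoothHypersurface_quadricPoly`).  An isotropic
vector is `x' + i y'` with `x'` and `y'` orthogonal, of equal length and fixed by the conjugation
`τ v = θ v̄`; after scaling by a real number, one reflection takes `x'` to `x`, a second one, fixing
`x`, takes the image of `y'` to `y`, and a third one, in a vector orthogonal to `x` and `y`, corrects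
the determinant if necessary.  So the orbit of `o` is all of `X` (`compactDual_eq_zeroLocus`).  An
isometry that fixes `o` and commutes with `τ` or with complex conjugation preserves both lines `ℂ ω`
and `ℂ ω̄`, hence commutes with `θ`; so it commutes with both conjugations
(`compactForm_inf_stabilizer`).

**Cohomology.** By the Nullstellensatz, sections of `𝒪(k)` over a basic open set `F ≠ 0` of a
hypersurface are global fractions `P / F ^ m` (`exists_eq_div_pow`).  On projective space the Čech
complex of the coordinate charts consists therefore of Laurent polynomials, and the part of a given
exponent is the cochain complex of a simplex relative to a subcomplex, which is contractible unless
all exponents are nonnegative or all are negative.  Counting monomials gives `finite_cohomology_univ`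
and `eulerChar_univ`.  The sequence `0 → 𝒪(k - 2) → 𝒪(k) → 𝒪_X(k) → 0` is exact on every chart, and
its long exact cohomology sequence gives `eulerChar_hypersurface`.

**The canonical bundle.** A regular function `a` of degree zero on the cone over an open subset of
`X` has a gradient that is well defined up to multiples of `∇Q`.  The residue `s` of
`da_1 ∧ ⋯ ∧ da_n` at a point `v` of the cone is given by
`y(v) s = det (∇Q(v), y, ∇a_1(v), …, ∇a_n(v))`, for any covector `y`; it is a section of
`𝒪(deg Q - n - 2)` (`residue_wedgeD`, `residueSection`).  Locally on an affine open set there are `n`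
functions whose differentials generate all differentials (`exists_localCoordinates`), and the residue
of their wedge product has no zeros (`residue_wedgeD_ne_zero`).  So the residue map is an isomorphism
after inverting functions that generate the unit ideal, hence an isomorphism
(`canonicalBundleIs_hypersurface`).
-/


noncomputable section

namespace OrthogonalDual

section

open MvPolynomial

variable {N : ℕ}

/-! ### Sections over basic open sets are global fractions -/

lemma eval_smul_of_isHomogeneous {P : MvPolynomial (Fin N) ℂ} {d : ℕ} (hP : P.IsHomogeneous d)
    (c : ℂ) (v : Fin N → ℂ) : eval (c • v) P = c ^ d * eval v P := by
  rw [eval_eq', eval_eq', Finset.mul_sum]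
  refine Finset.sum_congr rfl fun m hm => ?_
  rw [hP.degree_eq_sum_deg_support hm]
  simp only [Pi.smul_apply, smul_eq_mul, mul_pow, Finset.prod_mul_distrib, Finset.prod_pow_eq_pow_sum]
  rw [Finset.sum_subset (Finset.subset_univ m.support) fun i _ hi => by simpa using hi]
  ring

lemma eval_rep_mk_eq_zero_iff {P : MvPolynomial (Fin N) ℂ} {d : ℕ} (hP : P.IsHomogeneous d)
    {v : Fin N → ℂ} (hv : v ≠ 0) :
    eval (Projectivization.mk ℂ v hv).rep P = 0 ↔ eval v P = 0 := by
  obtain ⟨a, ha⟩ := Projectivization.exists_smul_eq_mk_rep ℂ v hv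
  rw [← ha, Units.smul_def, eval_smul_of_isHomogeneous hP]
  simp

lemma mem_cone_basicOpen {Q F : MvPolynomial (Fin N) ℂ} {e d : ℕ} (hQ : Q.IsHomogeneous e)
    (hF : F.IsHomogeneous d) {v : Fin N → ℂ} :
    v ∈ cone (basicOpen (zeroLocus Q) F) ↔ v ≠ 0 ∧ eval v Q = 0 ∧ eval v F ≠ 0 := by
  constructor
  · rintro ⟨h, h1, h2⟩
    exact ⟨h, (eval_rep_mk_eq_zero_iff hQ h).1 h1, fun h0 => h2 ((eval_rep_mk_eq_zero_iff hF h).2 h0)⟩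
  · rintro ⟨h, h1, h2⟩
    exact ⟨h, (eval_rep_mk_eq_zero_iff hQ h).2 h1, fun h0 => h2 ((eval_rep_mk_eq_zero_iff hF h).1 h0)⟩

lemma zeroLocus_zero : zeroLocus (0 : MvPolynomial (Fin N) ℂ) = Set.univ := by
  ext; simp [zeroLocus]

lemma eval_zero_of_isHomogeneous {F : MvPolynomial (Fin N) ℂ} {d : ℕ}
    (hF : F.IsHomogeneous d) (hd : 0 < d) : eval 0 F = 0 := by
  have := eval_smul_of_isHomogeneous hF 0 0
  rw [zero_smul, zero_pow hd.ne', zero_mul] at this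
  exact this

lemma eval_homogeneousComponent_of_forall_smul {P : MvPolynomial (Fin N) ℂ} {a : ℕ}
    {w : Fin N → ℂ} (h : ∀ c : ℂ, c ≠ 0 → eval (c • w) P = c ^ a * eval w P) :
    eval w (homogeneousComponent a P) = eval w P := by
  set f : Polynomial ℂ := ∑ i ∈ Finset.range (P.totalDegree + 1),
    Polynomial.C (eval w (homogeneousComponent i P)) * Polynomial.X ^ i with hf
  have key : f = Polynomial.C (eval w P) * Polynomial.X ^ a := by
    refine Polynomial.eq_of_infinite_eval_eq _ _ (Set.Infinite.mono ?_
      (Set.infinite_of_finite_compl (s := {c : ℂ | c ≠ 0}) (by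
        convert Set.finite_singleton (0 : ℂ) using 1; ext; simp)))
    intro c hc
    have h1 := h c hc
    rw [← sum_homogeneousComponent P, map_sum] at h1
    simp only [eval_smul_of_isHomogeneous (homogeneousComponent_isHomogeneous _ P)] at h1
    rw [sum_homogeneousComponent P] at h1
    simp only [Set.mem_ofPred_eq, hf, Polynomial.eval_finsetSum, Polynomial.eval_mul,
      Polynomial.eval_C, Polynomial.eval_pow, Polynomial.eval_X]
    rw [mul_comm (eval w P), ← h1]
    exact Finset.sum_congr rfl fun i _ => mul_comm _ _
  have h2 := congrArg (fun g => Polynomial.coeff g a) key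
  simp only [hf, Polynomial.finsetSum_coeff, Polynomial.coeff_C_mul, Polynomial.coeff_X_pow] at h2
  simp only [mul_ite, mul_one, mul_zero, Finset.sum_ite_eq, Finset.mem_range, if_true] at h2
  split_ifs at h2 with h3
  · exact h2
  · rw [homogeneousComponent_eq_zero _ _ (by omega), map_zero, h2]

lemma IsLocallyFraction.apply_smul {U : Set (PSpace N)} {k : ℤ} {s : cone U → ℂ}
    (hs : IsLocallyFraction U k s) {c : ℂ} (hc : c ≠ 0) (v w : cone U) (h : w.1 = c • v.1) :
    s w = c ^ k * s v := by
  obtain ⟨a, b, P, R, hP, hR, hab, hv, H⟩ := hs v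
  have hw : eval w.1 R ≠ 0 := by
    rw [h, eval_smul_of_isHomogeneous hR]
    exact mul_ne_zero (pow_ne_zero _ hc) hv
  rw [H w hw, H v hv, h, eval_smul_of_isHomogeneous hR, eval_smul_of_isHomogeneous hP]
  obtain rfl : k = a - b := by omega
  rw [zpow_sub₀ hc]
  simp only [zpow_natCast]
  field_simp

lemma smul_mem_cone {U : Set (PSpace N)} {v : Fin N → ℂ} (hv : v ∈ cone U) {c : ℂ} (hc : c ≠ 0) :
    c • v ∈ cone U := by
  obtain ⟨h, hv⟩ := hv
  refine ⟨smul_ne_zero hc h, ?_⟩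
  convert hv using 1
  rw [Projectivization.mk_eq_mk_iff']
  exact ⟨c, rfl⟩

/-- Sections of `𝒪(k)` over the basic open set `F ≠ 0` of a hypersurface are globally of the form
`P / F ^ m`, with arbitrarily large `m`.  The polynomials `R` for which `s R` is a polynomial
function form an ideal; by the Nullstellensatz it contains a power of `F`. -/
theorem exists_eq_div_pow {Q F : MvPolynomial (Fin N) ℂ} {e d : ℕ} (hQ : Q.IsHomogeneous e)
    (hF : F.IsHomogeneous d) (hd : 0 < d) {k : ℤ}
    {s : cone (basicOpen (zeroLocus Q) F) → ℂ} (hs : IsLocallyFraction _ k s) :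
    ∃ m₀ : ℕ, ∀ m, m₀ ≤ m → ∃ (a : ℕ) (P : MvPolynomial (Fin N) ℂ), P.IsHomogeneous a ∧
      (a : ℤ) = m * d + k ∧ ∀ w, s w = eval w.1 P / eval w.1 F ^ m := by
  let J : Ideal (MvPolynomial (Fin N) ℂ) :=
    { carrier := {R | ∃ P, ∀ w, s w * eval w.1 R = eval w.1 P}
      add_mem' := by
        rintro R R' ⟨P, hP⟩ ⟨P', hP'⟩
        exact ⟨P + P', fun w => by rw [map_add, map_add, mul_add, hP, hP']⟩
      zero_mem' := ⟨0, fun w => by simp⟩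
      smul_mem' := by
        rintro H R ⟨P, hP⟩
        exact ⟨H * P, fun w => by rw [smul_eq_mul, map_mul, map_mul, ← hP]; ring⟩ }
  have hQJ : Q ∈ J := ⟨0, fun w => by
    rw [((mem_cone_basicOpen hQ hF).1 w.2).2.1]; simp⟩
  have hrad : F ∈ J.radical := by
    rw [← vanishingIdeal_zeroLocus_eq_radical (K := ℂ), mem_vanishingIdeal_iff]
    intro x hx
    rw [mem_zeroLocus_iff] at hx
    rw [aeval_eq_eval]
    by_contra hFx
    have hx0 : x ≠ 0 := by
      rintro rfl
      exact hFx (eval_zero_of_isHomogeneous hF hd)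
    have hQx : eval x Q = 0 := by simpa [aeval_eq_eval] using hx Q hQJ
    obtain ⟨a, b, P, R, hP, hR, hab, hv, H⟩ := hs ⟨x, (mem_cone_basicOpen hQ hF).2 ⟨hx0, hQx, hFx⟩⟩
    have : R * R ∈ J := ⟨P * R, fun w => by
      rw [map_mul, map_mul]
      by_cases hw : eval w.1 R = 0
      · rw [hw]; simp
      · rw [H w hw]; field_simp⟩
    have h2 := hx _ this
    rw [aeval_eq_eval, map_mul] at h2
    exact hv (mul_self_eq_zero.1 h2)
  obtain ⟨m₁, P₁, hP₁⟩ := hrad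
  refine ⟨m₁ + k.natAbs, fun m hm => ?_⟩
  have hma : (0 : ℤ) ≤ m * d + k := by
    have : (m : ℤ) ≤ m * d := by exact_mod_cast Nat.le_mul_of_pos_right m hd
    omega
  obtain ⟨a, ha⟩ := Int.eq_ofNat_of_zero_le hma
  set P₂ := P₁ * F ^ (m - m₁) with hP₂
  have hs2 : ∀ w : cone (basicOpen (zeroLocus Q) F), s w * eval w.1 F ^ m = eval w.1 P₂ := by
    intro w
    rw [hP₂, map_mul, ← hP₁, map_pow, map_pow, mul_assoc, ← pow_add]
    congr 3
    omega
  refine ⟨a, homogeneousComponent a P₂, homogeneousComponent_isHomogeneous _ _, ha.symm, fun w => ?_⟩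
  have hFw : eval w.1 F ≠ 0 := ((mem_cone_basicOpen hQ hF).1 w.2).2.2
  rw [eval_homogeneousComponent_of_forall_smul, ← hs2 w, mul_div_assoc, div_self (pow_ne_zero _ hFw),
    mul_one]
  intro c hc
  rw [← hs2 w, ← hs2 ⟨c • w.1, smul_mem_cone w.2 hc⟩, hs.apply_smul hc w _ rfl,
    eval_smul_of_isHomogeneous hF, ← zpow_natCast c a, show (a : ℤ) = k + (d * m : ℕ) by
      push_cast; rw [mul_comm (d : ℤ)]; omega,
    zpow_add₀ hc, zpow_natCast, pow_mul]
  ring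

/-- A converse to `exists_eq_div_pow`. -/
lemma isLocallyFraction_div_pow {Q F : MvPolynomial (Fin N) ℂ} {e d : ℕ} (hQ : Q.IsHomogeneous e)
    (hF : F.IsHomogeneous d) {k : ℤ} {P : MvPolynomial (Fin N) ℂ} {a m : ℕ}
    (hP : P.IsHomogeneous a) (ha : (a : ℤ) = m * d + k) :
    IsLocallyFraction (basicOpen (zeroLocus Q) F) k
      (fun w => eval w.1 P / eval w.1 F ^ m) := by
  intro v
  refine ⟨a, d * m, P, F ^ m, hP, hF.pow m, by push_cast; rw [ha]; ring, ?_, fun w _ => by simp⟩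
  rw [map_pow]
  exact pow_ne_zero _ ((mem_cone_basicOpen hQ hF).1 v.2).2.2

/-- The Nullstellensatz for an irreducible hypersurface. -/
lemma dvd_of_forall_eval_eq_zero {Q P : MvPolynomial (Fin N) ℂ} (hQ : Irreducible Q)
    (h : ∀ w, eval w Q = 0 → eval w P = 0) : Q ∣ P := by
  have hp : (Ideal.span {Q}).IsPrime := (Ideal.span_singleton_prime hQ.ne_zero).2 hQ.prime
  rw [← Ideal.mem_span_singleton, ← IsPrime.vanishingIdeal_zeroLocus (K := ℂ) (Ideal.span {Q}),
    mem_vanishingIdeal_iff]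
  intro x hx
  rw [aeval_eq_eval]
  refine h x ?_
  have := (mem_zeroLocus_iff.1 hx) Q (Ideal.mem_span_singleton_self Q)
  rwa [aeval_eq_eval] at this

/-- A polynomial that vanishes on the basic open set `F ≠ 0` of the irreducible hypersurface
`Q = 0` becomes divisible by `Q` after multiplication by `F`. -/
lemma dvd_mul_of_forall_cone {Q F P : MvPolynomial (Fin N) ℂ} {e d : ℕ} (hQ : Q.IsHomogeneous e)
    (hirr : Irreducible Q) (hF : F.IsHomogeneous d) (hd : 0 < d)
    (h : ∀ w ∈ cone (basicOpen (zeroLocus Q) F), eval w P = 0) : Q ∣ F * P := by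
  refine dvd_of_forall_eval_eq_zero hirr fun w hw => ?_
  rw [map_mul]
  by_cases hFw : eval w F = 0
  · rw [hFw, zero_mul]
  · rw [h w ((mem_cone_basicOpen hQ hF).2 ⟨?_, hw, hFw⟩), mul_zero]
    rintro rfl
    exact hFw (eval_zero_of_isHomogeneous hF hd)

end

section

open MvPolynomial

variable {N : ℕ}

/-! ### The augmented cochain complex of a simplex -/

/-- The sign `(-1) ^ #{j ∈ T | j < i}`. -/
def insertionSign (i : Fin N) (T : Finset (Fin N)) : ℂ := (-1) ^ (T.filter (· < i)).card

lemma insertionSign_mul_self (i : Fin N) (T : Finset (Fin N)) :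
    insertionSign i T * insertionSign i T = 1 := by
  rw [insertionSign, ← mul_pow]; simp

lemma insertionSign_erase_self (i : Fin N) (T : Finset (Fin N)) :
    insertionSign i (T.erase i) = insertionSign i T := by
  rw [insertionSign, insertionSign, Finset.filter_erase, Finset.erase_eq_of_notMem (by simp)]

lemma insertionSign_insert_self (i : Fin N) (T : Finset (Fin N)) :
    insertionSign i (insert i T) = insertionSign i T := by
  rw [insertionSign, insertionSign, Finset.filter_insert, if_neg (lt_irrefl i)]

lemma insertionSign_erase_of_lt {i j : Fin N} {T : Finset (Fin N)} (h : j < i) (hj : j ∈ T) :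
    insertionSign i (T.erase j) = - insertionSign i T := by
  have hj' : j ∈ T.filter (· < i) := Finset.mem_filter.2 ⟨hj, h⟩
  rw [insertionSign, insertionSign, Finset.filter_erase, ← Finset.card_erase_add_one hj', pow_succ]
  simp

lemma insertionSign_erase_of_gt {i j : Fin N} {T : Finset (Fin N)} (h : i < j) :
    insertionSign i (T.erase j) = insertionSign i T := by
  rw [insertionSign, insertionSign, Finset.filter_erase,
    Finset.erase_eq_of_notMem (by simp [h.le])]

lemma insertionSign_erase_mul {i j : Fin N} {T : Finset (Fin N)} (h : i ≠ j) (hi : i ∈ T)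
    (hj : j ∈ T) : insertionSign i T * insertionSign j (T.erase i) =
      - (insertionSign j T * insertionSign i (T.erase j)) := by
  rcases lt_or_gt_of_ne h with h | h
  · rw [insertionSign_erase_of_lt h hi, insertionSign_erase_of_gt h]; ring
  · rw [insertionSign_erase_of_lt h hj, insertionSign_erase_of_gt h]; ring

variable {M : Type*} [AddCommGroup M] [Module ℂ M]

/-- The differential of the augmented cochain complex of the simplex with vertices `Fin N`, all
degrees taken together: a cochain is a function of the faces `T`, including the empty face. -/
def simplexD : (Finset (Fin N) → M) →ₗ[ℂ] (Finset (Fin N) → M) :=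
  LinearMap.pi fun T => ∑ i ∈ T, insertionSign i T • LinearMap.proj (T.erase i)

lemma simplexD_apply (c : Finset (Fin N) → M) (T : Finset (Fin N)) :
    simplexD c T = ∑ i ∈ T, insertionSign i T • c (T.erase i) := by
  simp [simplexD]

lemma simplexD_simplexD (c : Finset (Fin N) → M) : simplexD (simplexD c) = 0 := by
  funext T
  set f : Fin N → Fin N → M := fun i j => if i = j then 0 else
    (insertionSign i T * insertionSign j (T.erase i)) • c ((T.erase i).erase j) with hf
  have h1 : simplexD (simplexD c) T = ∑ i ∈ T, ∑ j ∈ T, f i j := by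
    rw [simplexD_apply]
    refine Finset.sum_congr rfl fun i hi => ?_
    rw [simplexD_apply, Finset.smul_sum, ← Finset.add_sum_erase _ _ hi]
    simp only [hf, if_true, zero_add]
    refine Finset.sum_congr rfl fun j hj => ?_
    rw [if_neg (Finset.ne_of_mem_erase hj).symm, mul_smul]
  have h2 : ∀ i ∈ T, ∀ j ∈ T, f i j = - f j i := by
    intro i hi j hj
    by_cases h : i = j
    · simp [hf, h]
    · simp only [hf, if_neg h, if_neg (Ne.symm h)]
      rw [insertionSign_erase_mul h hi hj, neg_smul, Finset.erase_right_comm]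
  have h3 : ∑ i ∈ T, ∑ j ∈ T, f i j = - ∑ i ∈ T, ∑ j ∈ T, f i j := by
    conv_lhs => rw [Finset.sum_comm]
    rw [← Finset.sum_neg_distrib]
    refine Finset.sum_congr rfl fun i hi => ?_
    rw [← Finset.sum_neg_distrib]
    exact Finset.sum_congr rfl fun j hj => h2 j hj i hi
  rw [h1, Pi.zero_apply]
  have h4 : (2 : ℂ) • ∑ i ∈ T, ∑ j ∈ T, f i j = 0 := by
    rw [two_smul]; nth_rewrite 2 [h3]; exact add_neg_cancel _
  exact (smul_eq_zero.1 h4).resolve_left two_ne_zero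

/-- The cone construction with apex `i`, a contracting homotopy of the augmented complex. -/
def simplexHomotopy (i : Fin N) (c : Finset (Fin N) → M) (T : Finset (Fin N)) : M :=
  if i ∈ T then 0 else insertionSign i T • c (insert i T)

lemma simplexD_simplexHomotopy_add (i : Fin N) (c : Finset (Fin N) → M) :
    simplexD (simplexHomotopy i c) + simplexHomotopy i (simplexD c) = c := by
  funext T
  rw [Pi.add_apply, simplexD_apply, simplexHomotopy]
  by_cases hi : i ∈ T
  · rw [if_pos hi, add_zero, ← Finset.add_sum_erase _ _ hi, Finset.sum_eq_zero, add_zero,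
      simplexHomotopy, if_neg (Finset.notMem_erase i T), Finset.insert_erase hi,
      insertionSign_erase_self, smul_smul, insertionSign_mul_self, one_smul]
    intro j hj
    rw [simplexHomotopy, if_pos (Finset.mem_erase.2 ⟨(Finset.ne_of_mem_erase hj).symm, hi⟩),
      smul_zero]
  · rw [if_neg hi, simplexD_apply, Finset.sum_insert hi, smul_add, smul_smul,
      insertionSign_insert_self, insertionSign_mul_self, one_smul, Finset.erase_insert hi,
      add_left_comm, Finset.smul_sum, ← Finset.sum_add_distrib, Finset.sum_eq_zero, add_zero]
    intro j hj
    have hij : i ≠ j := fun h => hi (h ▸ hj)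
    rw [simplexHomotopy, if_neg (fun h => hi (Finset.mem_of_mem_erase h)), smul_smul, smul_smul]
    have h1 := insertionSign_erase_mul hij (Finset.mem_insert_self i T)
      (Finset.mem_insert_of_mem hj)
    rw [insertionSign_insert_self, Finset.erase_insert hi,
      Finset.erase_insert_of_ne hij] at h1
    rw [Finset.erase_insert_of_ne hij, insertionSign_insert_self] at *
    have e : insertionSign i T * insertionSign j (insert i T) =
        - (insertionSign j T * insertionSign i (T.erase j)) := by
      have a1 := insertionSign_mul_self i T
      have a2 := insertionSign_mul_self i (T.erase j)
      have a3 := insertionSign_mul_self j T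
      have a4 := insertionSign_mul_self j (insert i T)
      generalize insertionSign i T = a at *
      generalize insertionSign j T = b at *
      generalize insertionSign i (T.erase j) = c at *
      generalize insertionSign j (insert i T) = d at *
      -- all four signs square to one, so `a b = - d c` gives `a d = - b c`
      linear_combination (b * d) * h1 + (-(a * d)) * a3 + (- b * c) * a4
    rw [e, neg_smul, add_neg_cancel]

end

section

open MvPolynomial

variable {N : ℕ}

/-! ### Sections over coordinate charts of projective space are Laurent polynomials -/

/-- The Laurent monomial `∏ x_i ^ α_i` as a function. -/
def laurentMonomial (α : Fin N → ℤ) (w : Fin N → ℂ) : ℂ := ∏ i, w i ^ α i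

/-- Laurent polynomials as functions on `ℂ^N`. -/
def laurentEval : ((Fin N → ℤ) →₀ ℂ) →ₗ[ℂ] ((Fin N → ℂ) → ℂ) :=
  Finsupp.linearCombination ℂ laurentMonomial

lemma laurentMonomial_linearIndependent :
    LinearIndependent ℂ fun (α : Fin N → ℤ) (u : Fin N → ℂˣ) =>
      laurentMonomial α (fun i => (u i : ℂ)) := by
  let χ : (Fin N → ℤ) → ((Fin N → ℂˣ) →* ℂ) := fun α =>
    { toFun := fun u => laurentMonomial α (fun i => (u i : ℂ))
      map_one' := by simp [laurentMonomial]
      map_mul' := fun u v => by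
        simp [laurentMonomial, mul_zpow, Finset.prod_mul_distrib] }
  refine (linearIndependent_monoidHom (Fin N → ℂˣ) ℂ).comp χ ?_
  intro α β h
  funext i
  have h1 := DFunLike.congr_fun h (Pi.mulSingle i (Units.mk0 (2 : ℂ) two_ne_zero))
  have h2 : ∀ γ : Fin N → ℤ, χ γ (Pi.mulSingle i (Units.mk0 (2 : ℂ) two_ne_zero)) = 2 ^ γ i := by
    intro γ
    change ∏ j : Fin N, _ = _
    rw [Finset.prod_eq_single i]
    · simp
    · intro j _ hj
      simp [Pi.mulSingle_eq_of_ne hj]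
    · simp
  rw [h2, h2] at h1
  have h3 : ((2 : ℝ) ^ α i) = 2 ^ β i := by simpa using congrArg (fun z : ℂ => ‖z‖) h1
  exact zpow_right_injective₀ (by norm_num) (by norm_num) h3

/-- A Laurent polynomial that vanishes on the torus is zero. -/
lemma eq_zero_of_laurentEval_eq_zero {f : (Fin N → ℤ) →₀ ℂ}
    (h : ∀ w : Fin N → ℂ, (∀ i, w i ≠ 0) → laurentEval f w = 0) : f = 0 := by
  have := linearIndependent_iff.1 (laurentMonomial_linearIndependent (N := N)) f
  apply this
  funext u
  rw [Finsupp.linearCombination_apply, Finsupp.sum, Finset.sum_apply]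
  have h1 := h (fun i => (u i : ℂ)) fun i => (u i).ne_zero
  rw [laurentEval, Finsupp.linearCombination_apply, Finsupp.sum, Finset.sum_apply] at h1
  exact h1

/-- Exponents of total degree `k` that are negative only at indices in `T`. -/
def laurentExponents (T : Finset (Fin N)) (k : ℤ) : Set (Fin N → ℤ) :=
  {α | ∑ i, α i = k ∧ ∀ i, α i < 0 → i ∈ T}

/-- The set of indices of a chart. -/
def indexSet {p : ℕ} (σ : Fin (p + 1) ↪o Fin N) : Finset (Fin N) :=
  Finset.univ.map σ.toEmbedding

lemma mem_indexSet {p : ℕ} {σ : Fin (p + 1) ↪o Fin N} {i : Fin N} :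
    i ∈ indexSet σ ↔ ∃ a, σ a = i := by simp [indexSet]

/-- The product of the coordinates that are inverted on a chart. -/
def chartPoly {p : ℕ} (σ : Fin (p + 1) ↪o Fin N) : MvPolynomial (Fin N) ℂ := ∏ a, X (σ a)

lemma chartPoly_isHomogeneous {p : ℕ} (σ : Fin (p + 1) ↪o Fin N) :
    (chartPoly σ).IsHomogeneous (p + 1) := by
  have := IsHomogeneous.prod Finset.univ (fun a => (X (σ a) : MvPolynomial (Fin N) ℂ))
    (fun _ => 1) (fun a _ => isHomogeneous_X ℂ (σ a))
  simpa [chartPoly] using this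

lemma eval_chartPoly {p : ℕ} (σ : Fin (p + 1) ↪o Fin N) (w : Fin N → ℂ) :
    eval w (chartPoly σ) = ∏ i ∈ indexSet σ, w i := by
  simp [chartPoly, indexSet]

lemma chart_eq_basicOpen (X : Set (PSpace N)) {p : ℕ} (σ : Fin (p + 1) ↪o Fin N) :
    chart X σ = basicOpen X (chartPoly σ) := by
  ext x
  simp [chart, basicOpen, chartPoly, Finset.prod_eq_zero_iff]

lemma mem_cone_chart {Q : MvPolynomial (Fin N) ℂ} {e : ℕ} (hQ : Q.IsHomogeneous e) {p : ℕ}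
    {σ : Fin (p + 1) ↪o Fin N} {w : Fin N → ℂ} :
    w ∈ cone (chart (zeroLocus Q) σ) ↔ eval w Q = 0 ∧ ∀ i ∈ indexSet σ, w i ≠ 0 := by
  rw [chart_eq_basicOpen, mem_cone_basicOpen hQ (chartPoly_isHomogeneous σ), eval_chartPoly,
    Finset.prod_ne_zero_iff, and_iff_right_iff_imp]
  rintro ⟨_, h⟩ rfl
  exact h (σ 0) (mem_indexSet.2 ⟨0, rfl⟩) rfl

lemma mem_cone_chart_univ {p : ℕ} {σ : Fin (p + 1) ↪o Fin N} {w : Fin N → ℂ} :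
    w ∈ cone (chart Set.univ σ) ↔ ∀ i ∈ indexSet σ, w i ≠ 0 := by
  rw [← zeroLocus_zero, mem_cone_chart (isHomogeneous_zero _ _ 0)]
  simp

lemma isLocallyFraction_laurentMonomial {p : ℕ} (σ : Fin (p + 1) ↪o Fin N) {k : ℤ}
    {α : Fin N → ℤ} (hα : α ∈ laurentExponents (indexSet σ) k) :
    IsLocallyFraction (chart Set.univ σ) k (fun w => laurentMonomial α w.1) := by
  have key : ∀ w : cone (chart Set.univ σ), ∀ i, w.1 i ^ (-α i).toNat ≠ 0 := by
    intro w i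
    by_cases hi : α i < 0
    · exact pow_ne_zero _ (mem_cone_chart_univ.1 w.2 i (hα.2 i hi))
    · rw [Int.toNat_of_nonpos (by omega), pow_zero]; exact one_ne_zero
  have hom : ∀ b : Fin N → ℕ, (∏ i, (X i : MvPolynomial (Fin N) ℂ) ^ b i).IsHomogeneous
      (∑ i, b i) := fun b =>
    IsHomogeneous.prod _ _ _ fun i _ => by simpa using (isHomogeneous_X ℂ i).pow (b i)
  intro v
  refine ⟨∑ i, (α i).toNat, ∑ i, (-α i).toNat, ∏ i, X i ^ (α i).toNat, ∏ i, X i ^ (-α i).toNat,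
    hom _, hom _, ?_, ?_, ?_⟩
  · rw [← hα.1]
    push_cast
    rw [← Finset.sum_add_distrib]
    exact Finset.sum_congr rfl fun i _ => by omega
  · simp only [map_prod, map_pow, eval_X]
    exact Finset.prod_ne_zero_iff.2 fun i _ => key v i
  · intro w _
    simp only [map_prod, map_pow, eval_X]
    rw [laurentMonomial, ← Finset.prod_div_distrib]
    refine Finset.prod_congr rfl fun i _ => ?_
    rw [eq_div_iff (key w i)]
    rcases lt_or_ge (α i) 0 with hi | hi
    · have h0 : w.1 i ≠ 0 := mem_cone_chart_univ.1 w.2 i (hα.2 i hi)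
      rw [← zpow_natCast, ← zpow_natCast, ← zpow_add₀ h0]
      congr 1; omega
    · rw [Int.toNat_of_nonpos (by omega : -α i ≤ 0), pow_zero, mul_one, ← zpow_natCast,
        Int.toNat_of_nonneg hi]

/-- Laurent polynomials as sections of `𝒪(k)` over a chart of projective space. -/
def laurentSection {p : ℕ} (σ : Fin (p + 1) ↪o Fin N) (k : ℤ) :
    Finsupp.supported ℂ ℂ (laurentExponents (indexSet σ) k) →ₗ[ℂ]
      twistedSections (chart (Set.univ : Set (PSpace N)) σ) k where
  toFun f := ⟨fun w => laurentEval f.1 w.1, by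
    have h : (fun w : cone (chart (Set.univ : Set (PSpace N)) σ) => laurentEval f.1 w.1) =
        ∑ α ∈ f.1.support, f.1 α • fun w => laurentMonomial α w.1 := by
      funext w
      simp [laurentEval, Finsupp.linearCombination_apply, Finsupp.sum, Finset.sum_apply]
    rw [h]
    exact Submodule.sum_mem (twistedSections (chart (Set.univ : Set (PSpace N)) σ) k)
      fun α hα => Submodule.smul_mem _ _
      (isLocallyFraction_laurentMonomial σ ((Finsupp.mem_supported _ _).1 f.2 hα))⟩
  map_add' f g := by ext w; simp
  map_smul' c f := by ext w; simp

lemma laurentSection_injective {p : ℕ} (σ : Fin (p + 1) ↪o Fin N) (k : ℤ) :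
    Function.Injective (laurentSection σ k) := by
  rw [injective_iff_map_eq_zero]
  intro f hf
  refine Subtype.ext (eq_zero_of_laurentEval_eq_zero fun w hw => ?_)
  exact congrFun (congrArg Subtype.val hf) ⟨w, mem_cone_chart_univ.2 fun i _ => hw i⟩

lemma laurentSection_surjective {p : ℕ} (σ : Fin (p + 1) ↪o Fin N) (k : ℤ) :
    Function.Surjective (laurentSection σ k) := by
  classical
  rintro ⟨s, hs⟩
  have hex : ∃ (m a : ℕ) (P : MvPolynomial (Fin N) ℂ), P.IsHomogeneous a ∧
      (a : ℤ) = m * (p + 1 : ℕ) + k ∧ ∀ w, s w = eval w.1 P / eval w.1 (chartPoly σ) ^ m := by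
    have e := chart_eq_basicOpen (Set.univ : Set (PSpace N)) σ
    rw [← zeroLocus_zero] at e
    have := @exists_eq_div_pow N 0 (chartPoly σ) 0 (p + 1) (isHomogeneous_zero _ _ 0)
      (chartPoly_isHomogeneous σ) p.succ_pos k
    rw [← e, zeroLocus_zero] at this
    obtain ⟨m, hm⟩ := this hs
    exact ⟨m, hm m le_rfl⟩
  obtain ⟨m, a, P, hP, ha, hsw⟩ := hex
  let shift : (Fin N →₀ ℕ) → (Fin N → ℤ) := fun β i => β i - if i ∈ indexSet σ then (m : ℤ) else 0
  let f : (Fin N → ℤ) →₀ ℂ := ∑ β ∈ P.support, Finsupp.single (shift β) (coeff β P)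
  have hcard : (indexSet σ).card = p + 1 := by simp [indexSet]
  have hf : f ∈ Finsupp.supported ℂ ℂ (laurentExponents (indexSet σ) k) := by
    refine Submodule.sum_mem _ fun β hβ => Finsupp.single_mem_supported _ _ ⟨?_, fun i hi => ?_⟩
    · have h1 := hP.degree_eq_sum_deg_support hβ
      rw [Finset.sum_subset (Finset.subset_univ β.support)
        fun i _ hi => by simpa using hi] at h1
      simp only [shift]
      rw [Finset.sum_sub_distrib, Finset.sum_ite_mem, Finset.univ_inter, Finset.sum_const, hcard]
      have h2 : (∑ i, (β i : ℤ)) = a := by rw [h1]; push_cast; rfl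
      rw [h2, ha]; push_cast; simp; ring
    · by_contra h
      simp only [shift, if_neg h] at hi
      omega
  refine ⟨⟨f, hf⟩, Subtype.ext (funext fun w => ?_)⟩
  change laurentEval f w.1 = s w
  have hne := mem_cone_chart_univ.1 w.2
  rw [hsw w, eval_chartPoly, eval_eq', Finset.sum_div, laurentEval, map_sum, Finset.sum_apply]
  refine Finset.sum_congr rfl fun β _ => ?_
  rw [Finsupp.linearCombination_single, Pi.smul_apply, smul_eq_mul, mul_div_assoc]
  congr 1
  rw [eq_div_iff (pow_ne_zero _ (Finset.prod_ne_zero_iff.2 hne)), laurentMonomial,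
    ← Finset.prod_pow, ← Finset.univ_inter (indexSet σ), ← Finset.prod_ite_mem,
    ← Finset.prod_mul_distrib]
  refine Finset.prod_congr rfl fun i _ => ?_
  simp only [shift]
  split_ifs with hi
  · rw [← zpow_natCast (w.1 i) m, ← zpow_add₀ (hne i hi), sub_add_cancel, zpow_natCast]
  · rw [sub_zero, mul_one, zpow_natCast]

end

section

open MvPolynomial

variable {N : ℕ}

/-! ### The Čech complex of projective space in terms of Laurent polynomials -/

/-- Sections of `𝒪(k)` over a chart of projective space are the Laurent polynomials of degree `k`
with denominators supported on that chart. -/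
def laurentEquiv {p : ℕ} (σ : Fin (p + 1) ↪o Fin N) (k : ℤ) :
    Finsupp.supported ℂ ℂ (laurentExponents (indexSet σ) k) ≃ₗ[ℂ]
      twistedSections (chart (Set.univ : Set (PSpace N)) σ) k :=
  LinearEquiv.ofBijective _ ⟨laurentSection_injective σ k, laurentSection_surjective σ k⟩

lemma laurentEquiv_apply_val {p : ℕ} (σ : Fin (p + 1) ↪o Fin N) (k : ℤ)
    (f : Finsupp.supported ℂ ℂ (laurentExponents (indexSet σ) k))
    (w : cone (chart (Set.univ : Set (PSpace N)) σ)) :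
    (laurentEquiv σ k f).1 w = laurentEval f.1 w.1 := rfl

lemma laurentEval_laurentEquiv_symm {p : ℕ} (σ : Fin (p + 1) ↪o Fin N) (k : ℤ)
    (s : twistedSections (chart (Set.univ : Set (PSpace N)) σ) k)
    (w : cone (chart (Set.univ : Set (PSpace N)) σ)) :
    laurentEval ((laurentEquiv σ k).symm s).1 w.1 = s.1 w := by
  rw [← laurentEquiv_apply_val, LinearEquiv.apply_symm_apply]

lemma card_indexSet {p : ℕ} (σ : Fin (p + 1) ↪o Fin N) : (indexSet σ).card = p + 1 := by
  simp [indexSet]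

lemma indexSet_orderEmbOfFin {p : ℕ} {T : Finset (Fin N)} (h : T.card = p + 1) :
    indexSet (T.orderEmbOfFin h) = T := by
  ext i
  rw [mem_indexSet, ← Set.mem_range, Finset.range_orderEmbOfFin, Finset.mem_coe]

lemma orderEmbOfFin_indexSet {p : ℕ} (σ : Fin (p + 1) ↪o Fin N) :
    (indexSet σ).orderEmbOfFin (card_indexSet σ) = σ :=
  (Finset.orderEmbOfFin_unique' _ fun a => mem_indexSet.2 ⟨a, rfl⟩).symm

lemma indexSet_face {p : ℕ} (σ : Fin (p + 2) ↪o Fin N) (j : Fin (p + 2)) :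
    indexSet (face σ j) = (indexSet σ).erase (σ j) := by
  ext i
  rw [Finset.mem_erase, mem_indexSet, mem_indexSet]
  constructor
  · rintro ⟨a, rfl⟩
    exact ⟨fun h => Fin.succAbove_ne j a (σ.injective h), j.succAbove a, rfl⟩
  · rintro ⟨h, a, rfl⟩
    obtain ⟨b, rfl⟩ := Fin.exists_succAbove_eq (fun e : a = j => h (by rw [e]))
    exact ⟨b, rfl⟩

lemma insertionSign_indexSet {p : ℕ} (σ : Fin (p + 1) ↪o Fin N) (j : Fin (p + 1)) :
    insertionSign (σ j) (indexSet σ) = (-1) ^ (j : ℕ) := by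
  rw [insertionSign, indexSet, Finset.filter_map, Finset.card_map]
  congr 1
  rw [← Fin.card_Iio j]
  congr 1
  ext a
  simp

/-- The Laurent polynomials of the components of a Čech cochain, as a cochain of the simplex. -/
def toLaurent (k : ℤ) (p : ℕ) : Cochain (Set.univ : Set (PSpace N)) k p →ₗ[ℂ]
    (Finset (Fin N) → ((Fin N → ℤ) →₀ ℂ)) :=
  LinearMap.pi fun T => if h : T.card = p + 1 then
    Submodule.subtype _ ∘ₗ (laurentEquiv (T.orderEmbOfFin h) k).symm.toLinearMap ∘ₗ
      LinearMap.proj (T.orderEmbOfFin h) else 0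

lemma toLaurent_indexSet {k : ℤ} {p : ℕ} (c : Cochain (Set.univ : Set (PSpace N)) k p)
    (σ : Fin (p + 1) ↪o Fin N) :
    toLaurent k p c (indexSet σ) = ((laurentEquiv σ k).symm (c σ)).1 := by
  have key : ∀ τ : Fin (p + 1) ↪o Fin N, τ = σ →
      ((laurentEquiv τ k).symm (c τ)).1 = ((laurentEquiv σ k).symm (c σ)).1 := by
    rintro τ rfl; rfl
  rw [toLaurent, LinearMap.pi_apply, dif_pos (card_indexSet σ)]
  exact key _ (orderEmbOfFin_indexSet σ)

lemma toLaurent_of_card_ne {k : ℤ} {p : ℕ} (c : Cochain (Set.univ : Set (PSpace N)) k p)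
    {T : Finset (Fin N)} (h : T.card ≠ p + 1) : toLaurent k p c T = 0 := by
  rw [toLaurent, LinearMap.pi_apply, dif_neg h, LinearMap.zero_apply]

lemma toLaurent_injective (k : ℤ) (p : ℕ) :
    Function.Injective (toLaurent (N := N) k p) := by
  rw [injective_iff_map_eq_zero]
  intro c hc
  funext σ
  have h := congrFun hc (indexSet σ)
  rw [toLaurent_indexSet, Pi.zero_apply] at h
  exact (laurentEquiv σ k).symm.map_eq_zero_iff.1 (Subtype.ext h)

/-- The cochains of the simplex that come from Čech cochains of `𝒪(k)` in degree `r - 1`: they live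
on faces with `r` vertices, and only the coordinates of these vertices are inverted. -/
def IsLaurentCochain (k : ℤ) (r : ℕ) (c : Finset (Fin N) → ((Fin N → ℤ) →₀ ℂ)) : Prop :=
  (∀ T, T.card ≠ r → c T = 0) ∧ ∀ T, c T ∈ Finsupp.supported ℂ ℂ (laurentExponents T k)

lemma isLaurentCochain_toLaurent {k : ℤ} {p : ℕ}
    (c : Cochain (Set.univ : Set (PSpace N)) k p) : IsLaurentCochain k (p + 1) (toLaurent k p c) := by
  refine ⟨fun T hT => toLaurent_of_card_ne c hT, fun T => ?_⟩
  by_cases h : T.card = p + 1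
  · rw [← indexSet_orderEmbOfFin h, toLaurent_indexSet]
    exact ((laurentEquiv (T.orderEmbOfFin h) k).symm _).2
  · rw [toLaurent_of_card_ne c h]
    exact Submodule.zero_mem _

lemma IsLaurentCochain.exists_toLaurent_eq {k : ℤ} {p : ℕ}
    {c : Finset (Fin N) → ((Fin N → ℤ) →₀ ℂ)} (hc : IsLaurentCochain k (p + 1) c) :
    ∃ b, toLaurent k p b = c := by
  refine ⟨fun σ => laurentEquiv σ k ⟨c (indexSet σ), hc.2 _⟩, ?_⟩
  funext T
  by_cases h : T.card = p + 1
  · rw [← indexSet_orderEmbOfFin h, toLaurent_indexSet, LinearEquiv.symm_apply_apply]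
  · rw [toLaurent_of_card_ne _ h, hc.1 T h]

lemma laurentExponents_mono {S T : Finset (Fin N)} (h : S ⊆ T) (k : ℤ) :
    laurentExponents S k ⊆ laurentExponents T k :=
  fun _ hα => ⟨hα.1, fun i hi => h (hα.2 i hi)⟩

lemma IsLaurentCochain.simplexD {k : ℤ} {r : ℕ} {c : Finset (Fin N) → ((Fin N → ℤ) →₀ ℂ)}
    (hc : IsLaurentCochain k r c) : IsLaurentCochain k (r + 1) (simplexD c) := by
  refine ⟨fun T hT => ?_, fun T => ?_⟩
  · rw [simplexD_apply]
    refine Finset.sum_eq_zero fun i hi => ?_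
    rw [hc.1 _ (fun h => hT (by rw [← h, Finset.card_erase_add_one hi])), smul_zero]
  · rw [simplexD_apply]
    exact Submodule.sum_mem _ fun i _ => Submodule.smul_mem _ _
      (Finsupp.supported_mono (laurentExponents_mono (Finset.erase_subset i T) k) (hc.2 _))

lemma cechD_apply (X : Set (PSpace N)) (k : ℤ) (p : ℕ) (c : Cochain X k p)
    (σ : Fin (p + 2) ↪o Fin N) : cechD X k p c σ =
      ∑ j : Fin (p + 2), (-1 : ℂ) ^ (j : ℕ) • resTwisted (chart_subset_face X σ j) k (c (face σ j)) := by
  simp [cechD]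

lemma toLaurent_cechD {k : ℤ} {p : ℕ} (c : Cochain (Set.univ : Set (PSpace N)) k p) :
    toLaurent k (p + 1) (cechD Set.univ k p c) = simplexD (toLaurent k p c) := by
  have hD := (isLaurentCochain_toLaurent c).simplexD
  funext T
  by_cases h : T.card = p + 1 + 1
  swap
  · rw [toLaurent_of_card_ne _ h, hD.1 T h]
  rw [← indexSet_orderEmbOfFin h, toLaurent_indexSet]
  set σ := T.orderEmbOfFin h
  have e : (laurentEquiv σ k).symm (cechD Set.univ k p c σ) =
      ⟨OrthogonalDual.simplexD (toLaurent k p c) (indexSet σ), hD.2 _⟩ := by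
    rw [LinearEquiv.symm_apply_eq]
    refine Subtype.ext (funext fun w => ?_)
    rw [laurentEquiv_apply_val, cechD_apply]
    change _ = laurentEval (OrthogonalDual.simplexD (toLaurent k p c) (indexSet σ)) w.1
    rw [simplexD_apply]
    rw [show (∑ i ∈ indexSet σ, insertionSign i (indexSet σ) •
        toLaurent k p c ((indexSet σ).erase i)) = ∑ j : Fin (p + 2), (-1 : ℂ) ^ (j : ℕ) •
          ((laurentEquiv (face σ j) k).symm (c (face σ j))).1 from ?_]
    · rw [map_sum, Finset.sum_apply, AddSubmonoidClass.coe_finsetSum, Finset.sum_apply]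
      refine Finset.sum_congr rfl fun j _ => ?_
      rw [map_smul, Pi.smul_apply]
      refine congrArg (fun z : ℂ => (-1 : ℂ) ^ (j : ℕ) • z) ?_
      exact (laurentEval_laurentEquiv_symm (face σ j) k (c (face σ j))
        (Set.inclusion (cone_mono (chart_subset_face _ σ j)) w)).symm
    · conv_lhs => rw [indexSet]
      rw [Finset.sum_map]
      refine Finset.sum_congr rfl fun j _ => ?_
      rw [← toLaurent_indexSet, indexSet_face]
      change insertionSign (σ j) (indexSet σ) • _ = _
      rw [insertionSign_indexSet]
      rfl
  rw [e]

lemma cechD_univ_cechD_univ {k : ℤ} {p : ℕ} (c : Cochain (Set.univ : Set (PSpace N)) k p) :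
    cechD Set.univ k (p + 1) (cechD Set.univ k p c) = 0 := by
  apply toLaurent_injective
  rw [toLaurent_cechD, toLaurent_cechD, simplexD_simplexD, map_zero]

/-- Some index at which an exponent is not negative, if there is one. -/
def nonnegIndex [NeZero N] (α : Fin N → ℤ) : Fin N :=
  open Classical in if h : ∃ i, 0 ≤ α i then h.choose else 0

lemma nonnegIndex_spec [NeZero N] {α : Fin N → ℤ} (h : ∃ i, 0 ≤ α i) : 0 ≤ α (nonnegIndex α) := by
  rw [nonnegIndex, dif_pos h]
  exact h.choose_spec

/-- The complex of Laurent cochains is exact, except for the monomials with all exponents negative: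
the monomials with exponent `α` form the cochain complex of a simplex relative to a subcomplex, which
is a cone with apex any index `i` such that `0 ≤ α i`. -/
lemma IsLaurentCochain.exists_simplexD_eq [NeZero N] {k : ℤ} {r : ℕ}
    {c : Finset (Fin N) → ((Fin N → ℤ) →₀ ℂ)} (hc : IsLaurentCochain k (r + 1) c)
    (hD : OrthogonalDual.simplexD c = 0)
    (hneg : ∀ T α, (∀ i, α i < 0) → c T α = 0) :
    ∃ b, IsLaurentCochain k r b ∧ OrthogonalDual.simplexD b = c := by
  classical
  let part : Fin N → ((Fin N → ℤ) →₀ ℂ) →ₗ[ℂ] ((Fin N → ℤ) →₀ ℂ) := fun i =>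
    { toFun := fun f => f.filter (fun α => nonnegIndex α = i)
      map_add' := fun f g => Finsupp.filter_add
      map_smul' := fun a f => Finsupp.filter_smul }
  let ci : Fin N → Finset (Fin N) → ((Fin N → ℤ) →₀ ℂ) := fun i T => part i (c T)
  have hsum : ∑ i, ci i = c := by
    funext T
    ext α
    rw [Finset.sum_apply, Finsupp.finsetSum_apply, Finset.sum_eq_single (nonnegIndex α)]
    · exact Finsupp.filter_apply_pos (fun β => nonnegIndex β = nonnegIndex α) (c T) rfl
    · intro i _ hi
      exact Finsupp.filter_apply_neg (fun β => nonnegIndex β = i) (c T) (Ne.symm hi)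
    · simp
  have hDi : ∀ i, OrthogonalDual.simplexD (ci i) = 0 := by
    intro i
    funext T
    have := congrArg (part i) (congrFun hD T)
    rw [simplexD_apply, map_sum] at this
    simp only [map_smul] at this
    rw [simplexD_apply, this]
    simp
  refine ⟨∑ i, simplexHomotopy i (ci i), ⟨fun T hT => ?_, fun T => ?_⟩, ?_⟩
  · rw [Finset.sum_apply]
    refine Finset.sum_eq_zero fun i _ => ?_
    rw [simplexHomotopy]
    split_ifs with hi
    · rfl
    · simp only [ci]
      rw [hc.1 _ (fun h => hT (by rw [Finset.card_insert_of_notMem hi] at h; omega)), map_zero,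
        smul_zero]
  · rw [Finset.sum_apply]
    refine Submodule.sum_mem _ fun i _ => ?_
    rw [simplexHomotopy]
    split_ifs with hi
    · exact Submodule.zero_mem _
    · refine Submodule.smul_mem _ _ ((Finsupp.mem_supported' _ _).2 fun α hα => ?_)
      by_contra hne
      have h1 : nonnegIndex α = i := by
        by_contra h
        exact hne (Finsupp.filter_apply_neg (fun β => nonnegIndex β = i) _ h)
      have h2 : c (insert i T) α ≠ 0 := by
        rwa [show ci i (insert i T) α = c (insert i T) α from
          Finsupp.filter_apply_pos (fun β => nonnegIndex β = i) _ h1] at hne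
      have h3 : 0 ≤ α i := by
        rw [← h1]
        refine nonnegIndex_spec ?_
        by_contra! h
        exact h2 (hneg _ α h)
      have h4 : α ∈ laurentExponents (insert i T) k := by
        by_contra h
        exact h2 ((Finsupp.mem_supported' _ _).1 (hc.2 (insert i T)) α h)
      refine hα ⟨h4.1, fun j hj => ?_⟩
      rcases Finset.mem_insert.1 (h4.2 j hj) with rfl | h
      · omega
      · exact h
  · rw [map_sum]
    conv_rhs => rw [← hsum]
    refine Finset.sum_congr rfl fun i _ => ?_
    have h := simplexD_simplexHomotopy_add i (ci i)
    rwa [hDi i, show simplexHomotopy i (0 : Finset (Fin N) → ((Fin N → ℤ) →₀ ℂ)) = 0 from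
      funext fun T => by simp [simplexHomotopy], add_zero] at h

end

section

open MvPolynomial

/-! ### The cohomology of projective space -/

variable {n : ℕ}

/-- Exponents of the monomials of degree `k`. -/
abbrev posExponents (N : ℕ) (k : ℤ) : Set (Fin N → ℤ) := {α | ∑ i, α i = k ∧ ∀ i, 0 ≤ α i}

/-- Exponents of the Laurent monomials of degree `k` in which every coordinate is inverted. -/
abbrev negExponents (N : ℕ) (k : ℤ) : Set (Fin N → ℤ) := {α | ∑ i, α i = k ∧ ∀ i, α i < 0}

lemma laurentExponents_empty (N : ℕ) (k : ℤ) : laurentExponents (∅ : Finset (Fin N)) k =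
    posExponents N k := by
  ext α; simp [laurentExponents]

lemma negExponents_subset (N : ℕ) (k : ℤ) :
    negExponents N k ⊆ laurentExponents Finset.univ k := fun α hα => ⟨hα.1, by simp⟩

/-- `posExponents` as a type of finitely supported functions of given sum. -/
def posExponentsEquiv (N m : ℕ) :
    posExponents N m ≃ (Finset.univ : Finset (Fin N)).finsuppAntidiag m where
  toFun α := ⟨Finsupp.equivFunOnFinite.symm fun i => (α.1 i).toNat, by
    rw [Finset.mem_finsuppAntidiag]
    refine ⟨?_, by simp⟩
    have h := α.2.1
    zify
    exact (Finset.sum_congr rfl fun i _ => by simpa using α.2.2 i).trans h⟩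
  invFun β := ⟨fun i => β.1 i, by
    have h := (Finset.mem_finsuppAntidiag.1 β.2).1
    exact ⟨by beta_reduce; exact_mod_cast h, fun i => by positivity⟩⟩
  left_inv α := by
    ext i
    simpa using α.2.2 i
  right_inv β := by
    ext i
    simp

/-- The symmetry of Serre duality. -/
def negExponentsEquiv (N : ℕ) (k : ℤ) : negExponents N k ≃ posExponents N (-k - N) where
  toFun α := ⟨fun i => -1 - α.1 i, by
    have h := α.2.1
    refine ⟨?_, fun i => by have := α.2.2 i; dsimp only; omega⟩
    rw [Finset.sum_sub_distrib, h]; simp; ring⟩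
  invFun α := ⟨fun i => -1 - α.1 i, by
    have h := α.2.1
    refine ⟨?_, fun i => by have := α.2.2 i; dsimp only; omega⟩
    rw [Finset.sum_sub_distrib, h]; simp; ring⟩
  left_inv α := by ext i; simp
  right_inv α := by ext i; simp

lemma posExponents_isEmpty {N : ℕ} {k : ℤ} (hk : k < 0) : IsEmpty (posExponents N k) := by
  refine ⟨fun α => ?_⟩
  have := Finset.sum_nonneg fun i (_ : i ∈ Finset.univ) => α.2.2 i
  rw [α.2.1] at this
  omega

instance (N : ℕ) (k : ℤ) : Finite (posExponents N k) := by
  rcases lt_or_ge k 0 with hk | hk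
  · have := posExponents_isEmpty (N := N) hk
    infer_instance
  · lift k to ℕ using hk
    exact Finite.of_equiv _ (posExponentsEquiv N k).symm

instance (N : ℕ) (k : ℤ) : Finite (negExponents N k) :=
  Finite.of_equiv _ (negExponentsEquiv N k).symm

lemma card_posExponents (N m : ℕ) : Nat.card (posExponents N m) = (N + m - 1).choose m := by
  rw [Nat.card_congr (posExponentsEquiv N m), Nat.card_eq_fintype_card, Fintype.card_coe]
  simp [Finset.card_finsuppAntidiag_nat_eq_choose]

lemma card_posExponents_add (n : ℕ) (k : ℤ) :
    (Nat.card (posExponents (n + 2) k) : ℤ) +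
      (-1) ^ (n + 1) * Nat.card (negExponents (n + 2) k) = Ring.choose (k + n + 1) (n + 1) := by
  rw [Nat.card_congr (negExponentsEquiv (n + 2) k)]
  rcases lt_or_ge k 0 with hk | hk
  · have := posExponents_isEmpty (N := n + 2) hk
    rw [Nat.card_of_isEmpty]
    rcases lt_or_ge (-k - (n + 2 : ℕ)) 0 with hk' | hk'
    · have := posExponents_isEmpty (N := n + 2) hk'
      rw [Nat.card_of_isEmpty]
      obtain ⟨a, ha⟩ := Int.eq_ofNat_of_zero_le (show 0 ≤ k + n + 1 by push_cast at hk'; omega)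
      rw [ha, Ring.choose_natCast, Nat.choose_eq_zero_of_lt (by omega)]
      simp
    · obtain ⟨m, hm⟩ := Int.eq_ofNat_of_zero_le hk'
      rw [hm, card_posExponents, show k + n + 1 = -((m + 1 : ℕ) : ℤ) by
        push_cast at hm ⊢; omega, Ring.choose_neg, show ((m + 1 : ℕ) : ℤ) + (n + 1 : ℕ) - 1 =
          ((m + n + 1 : ℕ) : ℤ) by push_cast; ring, Ring.choose_natCast,
        show n + 2 + m - 1 = m + n + 1 by omega, Nat.choose_symm_of_eq_add (show m + n + 1 = m + (n + 1) by omega)]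
      rw [Int.negOnePow_def, zpow_natCast]
      simp [Units.smul_def]
  · lift k to ℕ using hk
    have := posExponents_isEmpty (N := n + 2) (k := -(k : ℤ) - (n + 2 : ℕ)) (by push_cast; omega)
    rw [Nat.card_of_isEmpty (α := posExponents (n + 2) (-(k : ℤ) - (n + 2 : ℕ))), card_posExponents,
      show (k : ℤ) + n + 1 = ((k + n + 1 : ℕ) : ℤ) by
      push_cast; ring, Ring.choose_natCast, show n + 2 + k - 1 = k + n + 1 by omega,
      Nat.choose_symm_of_eq_add (show k + n + 1 = k + (n + 1) by omega)]
    simp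

lemma finrank_finsupp_eq_card (ι : Type*) [Finite ι] :
    Module.finrank ℂ (ι →₀ ℂ) = Nat.card ι := by
  have := Fintype.ofFinite ι
  rw [Module.finrank_finsupp_self, Nat.card_eq_fintype_card]

/-- The cochains in degree zero that come from global polynomials. -/
def globalSection (k : ℤ) :
    Finsupp.supported ℂ ℂ (laurentExponents (∅ : Finset (Fin (n + 2))) k) →ₗ[ℂ]
      Cochain (Set.univ : Set (PSpace (n + 2))) k 0 :=
  LinearMap.pi fun σ => (laurentEquiv σ k).toLinearMap ∘ₗ
    Submodule.inclusion (Finsupp.supported_mono (laurentExponents_mono (Finset.empty_subset _) k))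

lemma toLaurent_globalSection {k : ℤ}
    (f : Finsupp.supported ℂ ℂ (laurentExponents (∅ : Finset (Fin (n + 2))) k)) :
    toLaurent k 0 (globalSection k f) = simplexD (Pi.single ∅ f.1) := by
  have hL : IsLaurentCochain k 0 (Pi.single (∅ : Finset (Fin (n + 2))) f.1) := by
    refine ⟨fun T hT => Pi.single_eq_of_ne (by rintro rfl; simp at hT) _, fun T => ?_⟩
    by_cases h : T = ∅
    · subst h; rw [Pi.single_eq_same]; exact f.2
    · rw [Pi.single_eq_of_ne h]; exact Submodule.zero_mem _
  funext T
  by_cases h : T.card = 0 + 1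
  · obtain ⟨i, rfl⟩ := Finset.card_eq_one.1 h
    have e := indexSet_orderEmbOfFin h
    have h1 : simplexD (Pi.single (∅ : Finset (Fin (n + 2))) f.1) {i} = f.1 := by
      rw [simplexD_apply, Finset.sum_singleton]
      simp [insertionSign, Finset.filter_singleton]
    rw [h1, ← e, toLaurent_indexSet]
    simp [globalSection]
  · rw [toLaurent_of_card_ne _ h, hL.simplexD.1 T h]

lemma globalSection_injective (k : ℤ) : Function.Injective (globalSection (n := n) k) := by
  rw [injective_iff_map_eq_zero]
  intro f hf
  have h := congrFun (toLaurent_globalSection f) {0}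
  rw [hf, map_zero, simplexD_apply] at h
  simp [insertionSign, Finset.filter_singleton] at h
  exact Subtype.ext h.symm

lemma range_globalSection (k : ℤ) :
    LinearMap.range (globalSection (n := n) k) = LinearMap.ker (cechD Set.univ k 0) := by
  ext c
  rw [LinearMap.mem_range, LinearMap.mem_ker]
  constructor
  · rintro ⟨f, rfl⟩
    apply toLaurent_injective
    rw [toLaurent_cechD, toLaurent_globalSection, simplexD_simplexD, map_zero]
  · intro hc
    have hL := isLaurentCochain_toLaurent c
    obtain ⟨b, hb, hbc⟩ := hL.exists_simplexD_eq (by rw [← toLaurent_cechD, hc, map_zero]) (by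
      intro T α hα
      by_cases hT : T.card = 0 + 1
      · obtain ⟨i, rfl⟩ := Finset.card_eq_one.1 hT
        refine (Finsupp.mem_supported' _ _).1 (hL.2 {i}) α fun h => ?_
        obtain ⟨j, hj⟩ := exists_ne i
        exact hj (Finset.mem_singleton.1 (h.2 j (hα j)))
      · rw [hL.1 T hT]; rfl)
    refine ⟨⟨b ∅, hb.2 ∅⟩, ?_⟩
    apply toLaurent_injective
    rw [toLaurent_globalSection, ← hbc]
    congr 1
    funext T
    by_cases h : T = ∅
    · subst h; rw [Pi.single_eq_same]
    · rw [Pi.single_eq_of_ne h, hb.1 T (by simpa using h)]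

/-- `H⁰(ℙ, 𝒪(k))` consists of the homogeneous polynomials of degree `k`. -/
def cohomologyZeroEquiv (k : ℤ) :
    (posExponents (n + 2) k →₀ ℂ) ≃ₗ[ℂ] Cohomology (Set.univ : Set (PSpace (n + 2))) k 0 :=
  (Finsupp.supportedEquivFinsupp (M := ℂ) (R := ℂ) (posExponents (n + 2) k)).symm ≪≫ₗ
    LinearEquiv.ofEq _ _ (by rw [laurentExponents_empty]) ≪≫ₗ
    LinearEquiv.ofInjective _ (globalSection_injective k) ≪≫ₗ
    LinearEquiv.ofEq _ _ (range_globalSection k) ≪≫ₗ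
    (Submodule.quotEquivOfEqBot _ (by
      rw [coboundaries, Submodule.submoduleOf, Submodule.comap_bot, Submodule.ker_subtype])).symm

/-- The components at the monomials with all exponents negative. -/
def negPart (k : ℤ) : LinearMap.ker (cechD (Set.univ : Set (PSpace (n + 2))) k (n + 1)) →ₗ[ℂ]
    (negExponents (n + 2) k →₀ ℂ) :=
  Finsupp.lcomapDomain Subtype.val Subtype.val_injective ∘ₗ LinearMap.proj Finset.univ ∘ₗ
    toLaurent k (n + 1) ∘ₗ Submodule.subtype _

lemma negPart_apply {k : ℤ} (c : LinearMap.ker (cechD (Set.univ : Set (PSpace (n + 2))) k (n + 1)))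
    (α : negExponents (n + 2) k) : negPart k c α = toLaurent k (n + 1) c.1 Finset.univ α.1 := rfl

lemma negPart_surjective (k : ℤ) : Function.Surjective (negPart (n := n) k) := by
  intro f
  set g := ((Finsupp.supportedEquivFinsupp (M := ℂ) (R := ℂ) (negExponents (n + 2) k)).symm f)
  have hL : IsLaurentCochain k (n + 1 + 1) (Pi.single (Finset.univ : Finset (Fin (n + 2))) g.1) := by
    refine ⟨fun T hT => Pi.single_eq_of_ne (by rintro rfl; simp at hT) _, fun T => ?_⟩
    by_cases h : T = Finset.univ
    · subst h; rw [Pi.single_eq_same]; exact Finsupp.supported_mono (negExponents_subset _ k) g.2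
    · rw [Pi.single_eq_of_ne h]; exact Submodule.zero_mem _
  obtain ⟨c, hc⟩ := hL.exists_toLaurent_eq
  refine ⟨⟨c, ?_⟩, ?_⟩
  · rw [LinearMap.mem_ker]
    funext σ
    exact absurd (Fintype.card_le_of_injective σ σ.injective) (by simp)
  · ext α
    rw [negPart_apply, hc, Pi.single_eq_same]
    have : f = Finsupp.supportedEquivFinsupp (negExponents (n + 2) k) g := by simp [g]
    rw [this]; rfl

lemma exists_cechD_eq {k : ℤ} {p : ℕ} {c : Cochain (Set.univ : Set (PSpace (n + 2))) k (p + 1)}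
    (hc : cechD Set.univ k (p + 1) c = 0)
    (h : ∀ T α, (∀ i, α i < 0) → toLaurent k (p + 1) c T α = 0) :
    ∃ b, cechD Set.univ k p b = c := by
  obtain ⟨b, hb, hbc⟩ := (isLaurentCochain_toLaurent c).exists_simplexD_eq
    (by rw [← toLaurent_cechD, hc, map_zero]) h
  obtain ⟨b', rfl⟩ := hb.exists_toLaurent_eq
  refine ⟨b', toLaurent_injective _ _ ?_⟩
  rw [toLaurent_cechD, hbc]

lemma toLaurent_eq_zero_of_neg {k : ℤ} {p : ℕ}
    (c : Cochain (Set.univ : Set (PSpace (n + 2))) k p)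
    {T : Finset (Fin (n + 2))} {α : Fin (n + 2) → ℤ} (hα : ∀ i, α i < 0) (hT : T ≠ Finset.univ) :
    toLaurent k p c T α = 0 := by
  refine (Finsupp.mem_supported' _ _).1 ((isLaurentCochain_toLaurent c).2 T) α fun h => hT ?_
  exact Finset.eq_univ_of_forall fun i => h.2 i (hα i)

lemma ker_negPart (k : ℤ) : LinearMap.ker (negPart (n := n) k) =
    (coboundaries (Set.univ : Set (PSpace (n + 2))) k (n + 1)).submoduleOf
      (LinearMap.ker (cechD Set.univ k (n + 1))) := by
  ext ⟨c, hc⟩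
  rw [LinearMap.mem_ker, Submodule.submoduleOf, Submodule.mem_comap]
  change _ ↔ c ∈ LinearMap.range (cechD Set.univ k n)
  rw [LinearMap.mem_range]
  constructor
  · intro h
    refine exists_cechD_eq hc fun T α hα => ?_
    by_cases hT : T = Finset.univ
    swap
    · exact toLaurent_eq_zero_of_neg c hα hT
    subst hT
    by_cases hk : ∑ i, α i = k
    · exact DFunLike.congr_fun h (⟨α, hk, hα⟩ : negExponents (n + 2) k)
    · exact (Finsupp.mem_supported' _ _).1 ((isLaurentCochain_toLaurent c).2 Finset.univ) α
        fun h => hk h.1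
  · rintro ⟨b, rfl⟩
    ext α
    rw [negPart_apply, toLaurent_cechD, simplexD_apply, Finsupp.finsetSum_apply]
    refine Finset.sum_eq_zero fun i _ => ?_
    rw [Finsupp.smul_apply, toLaurent_eq_zero_of_neg b α.2.2 (Finset.erase_ne_self.2 (Finset.mem_univ i)),
      smul_zero]

/-- The top cohomology of `𝒪(k)` on projective space has a basis of the monomials with all exponents
negative. -/
def cohomologyTopEquiv (k : ℤ) :
    Cohomology (Set.univ : Set (PSpace (n + 2))) k (n + 1) ≃ₗ[ℂ] (negExponents (n + 2) k →₀ ℂ) :=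
  Submodule.quotEquivOfEq _ _ (ker_negPart k).symm ≪≫ₗ
    LinearMap.quotKerEquivOfSurjective _ (negPart_surjective k)

lemma cohomology_univ_subsingleton {k : ℤ} {p : ℕ} (hp : p ≠ n) :
    Subsingleton (Cohomology (Set.univ : Set (PSpace (n + 2))) k (p + 1)) := by
  rw [Submodule.Quotient.subsingleton_iff, Submodule.submoduleOf_eq_top]
  intro c hc
  refine exists_cechD_eq hc fun T α hα => ?_
  by_cases hT : T = Finset.univ
  · rw [toLaurent_of_card_ne c (by subst hT; simpa using Ne.symm hp)]; rfl
  · exact toLaurent_eq_zero_of_neg c hα hT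

theorem finite_cohomology_univ (k : ℤ) (p : ℕ) :
    Module.Finite ℂ (Cohomology (Set.univ : Set (PSpace (n + 2))) k p) := by
  rcases p with _ | p
  · exact Module.Finite.equiv (cohomologyZeroEquiv k)
  · by_cases hp : p = n
    · subst hp
      exact Module.Finite.equiv (cohomologyTopEquiv k).symm
    · have := cohomology_univ_subsingleton (k := k) hp
      infer_instance

theorem eulerChar_univ (k : ℤ) :
    eulerChar (Set.univ : Set (PSpace (n + 2))) k = Ring.choose (k + n + 1) (n + 1) := by
  rw [← card_posExponents_add, eulerChar, Finset.sum_range_succ', Finset.sum_eq_single n,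
    ← (cohomologyZeroEquiv k).finrank_eq, (cohomologyTopEquiv k).finrank_eq,
    finrank_finsupp_eq_card, finrank_finsupp_eq_card]
  · ring
  · intro p _ hp
    have := cohomology_univ_subsingleton (k := k) hp
    rw [Module.finrank_zero_of_subsingleton]; simp
  · simp

end

section

/-! ### The long exact sequence of cohomology -/

section LongExactSequence

variable {K : Type*} [Field K] {A B C : ℕ → Type*}
  [∀ p, AddCommGroup (A p)] [∀ p, Module K (A p)]
  [∀ p, AddCommGroup (B p)] [∀ p, Module K (B p)]
  [∀ p, AddCommGroup (C p)] [∀ p, Module K (C p)]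

/-- The coboundaries of a sequence of maps starting in degree zero. -/
def cobdry (d : ∀ p, A p →ₗ[K] A (p + 1)) : ∀ p, Submodule K (A p)
  | 0 => ⊥
  | p + 1 => LinearMap.range (d p)

/-- The cohomology of a sequence of maps starting in degree zero. -/
abbrev Coh (d : ∀ p, A p →ₗ[K] A (p + 1)) (p : ℕ) : Type _ :=
  LinearMap.ker (d p) ⧸ (cobdry d p).submoduleOf (LinearMap.ker (d p))

lemma Coh.mk_eq_zero {d : ∀ p, A p →ₗ[K] A (p + 1)} {p : ℕ} (a : LinearMap.ker (d p)) :
    (Submodule.Quotient.mk a : Coh d p) = 0 ↔ a.1 ∈ cobdry d p :=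
  Submodule.Quotient.mk_eq_zero _

variable {dA : ∀ p, A p →ₗ[K] A (p + 1)} {dB : ∀ p, B p →ₗ[K] B (p + 1)}
  {dC : ∀ p, C p →ₗ[K] C (p + 1)}

/-- The map induced on cohomology by a map of complexes. -/
def cohMap (f : ∀ p, A p →ₗ[K] B p) (hf : ∀ p a, f (p + 1) (dA p a) = dB p (f p a)) (p : ℕ) :
    Coh dA p →ₗ[K] Coh dB p :=
  Submodule.mapQ _ _ ((f p).restrict (p := LinearMap.ker (dA p)) (q := LinearMap.ker (dB p))
    fun a ha => by rw [LinearMap.mem_ker] at ha ⊢; rw [← hf, ha, map_zero]) (by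
      rintro ⟨a, ha⟩ h
      change f p a ∈ cobdry dB p
      change a ∈ cobdry dA p at h
      cases p with
      | zero => rw [cobdry, Submodule.mem_bot] at h ⊢; rw [h, map_zero]
      | succ p =>
        obtain ⟨a', rfl⟩ := h
        exact ⟨f p a', (hf p a').symm⟩)

lemma cohMap_mk (f : ∀ p, A p →ₗ[K] B p) (hf : ∀ p a, f (p + 1) (dA p a) = dB p (f p a)) (p : ℕ)
    (a : LinearMap.ker (dA p)) (h : dB p (f p a.1) = 0) :
    cohMap f hf p (Submodule.Quotient.mk a) = Submodule.Quotient.mk ⟨f p a.1, h⟩ := rfl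

/-- The dimension count in the long exact sequence of a short exact sequence of complexes: `r p` is
the rank of the map `H^p(A) → H^p(B)`. -/
theorem finrank_coh_of_shortExact {f : ∀ p, A p →ₗ[K] B p} {g : ∀ p, B p →ₗ[K] C p}
    (hf : ∀ p a, f (p + 1) (dA p a) = dB p (f p a))
    (hg : ∀ p b, g (p + 1) (dB p b) = dC p (g p b))
    (hinj : ∀ p, Function.Injective (f p)) (hsurj : ∀ p, Function.Surjective (g p))
    (hex : ∀ p b, g p b = 0 ↔ ∃ a, f p a = b)
    (hdB : ∀ p b, dB (p + 1) (dB p b) = 0)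
    (hA : ∀ p, Module.Finite K (Coh dA p)) (hB : ∀ p, Module.Finite K (Coh dB p)) :
    (∀ p, Module.Finite K (Coh dC p)) ∧ ∃ r : ℕ → ℕ, r 0 = Module.finrank K (Coh dA 0) ∧
      (∀ p, r p ≤ Module.finrank K (Coh dA p)) ∧
      ∀ p, Module.finrank K (Coh dC p) + r p + r (p + 1) =
        Module.finrank K (Coh dB p) + Module.finrank K (Coh dA (p + 1)) := by
  have hs : ∀ p, ∃ s : C p →ₗ[K] B p, g p ∘ₗ s = LinearMap.id := fun p =>
    (g p).exists_rightInverse_of_surjective (LinearMap.range_eq_top.2 (hsurj p))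
  have hr : ∀ p, ∃ r : B p →ₗ[K] A p, r ∘ₗ f p = LinearMap.id := fun p =>
    (f p).exists_leftInverse_of_injective (LinearMap.ker_eq_bot.2 (hinj p))
  choose s hs using hs
  choose r hr using hr
  have hs' : ∀ p c, g p (s p c) = c := fun p c => LinearMap.congr_fun (hs p) c
  have hr' : ∀ p a, r p (f p a) = a := fun p a => LinearMap.congr_fun (hr p) a
  have hgf : ∀ p a, g p (f p a) = 0 := fun p a => (hex p _).2 ⟨a, rfl⟩
  have hfr : ∀ p b, g p b = 0 → f p (r p b) = b := by
    intro p b hb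
    obtain ⟨a, rfl⟩ := (hex p b).1 hb
    rw [hr']
  -- the connecting map, computed with the linear sections `s` and `r`
  have hfδ : ∀ p c, dC p c = 0 → f (p + 1) (r (p + 1) (dB p (s p c))) = dB p (s p c) := by
    intro p c hc
    exact hfr _ _ (by rw [hg, hs', hc])
  have hdelta : ∀ p c, dC p c = 0 → dA (p + 1) (r (p + 1) (dB p (s p c))) = 0 := by
    intro p c hc
    apply hinj
    rw [hf, hfδ p c hc, hdB, map_zero]
  let δ₀ : ∀ p, LinearMap.ker (dC p) →ₗ[K] LinearMap.ker (dA (p + 1)) := fun p =>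
    (r (p + 1) ∘ₗ dB p ∘ₗ s p).restrict fun c hc => hdelta p c hc
  let δ : ∀ p, Coh dC p →ₗ[K] Coh dA (p + 1) := fun p => Submodule.mapQ _ _ (δ₀ p) (by
    rintro ⟨c, hc⟩ h
    change r (p + 1) (dB p (s p c)) ∈ LinearMap.range (dA p)
    change c ∈ cobdry dC p at h
    cases p with
    | zero =>
      rw [cobdry, Submodule.mem_bot] at h
      rw [h]; simp
    | succ p =>
      obtain ⟨c', rfl⟩ := h
      obtain ⟨a, ha⟩ := (hex (p + 1) (s (p + 1) (dC p c') - dB p (s p c'))).1 (by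
        rw [map_sub, hs', hg, hs', sub_self])
      refine ⟨a, ?_⟩
      apply hinj
      rw [hfδ _ _ hc, hf, ha, map_sub, hdB, sub_zero])
  have hδ : ∀ p (c : LinearMap.ker (dC p)), δ p (Submodule.Quotient.mk c) =
      Submodule.Quotient.mk ⟨r (p + 1) (dB p (s p c.1)), hdelta p c.1 c.2⟩ := fun p c => rfl
  have E1 : ∀ p, LinearMap.range (cohMap f hf p) = LinearMap.ker (cohMap g hg p) := by
    intro p
    ext x
    obtain ⟨⟨b, hb⟩, rfl⟩ := Submodule.Quotient.mk_surjective _ x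
    rw [LinearMap.mem_ker, LinearMap.mem_range,
      cohMap_mk g hg p _ (by rw [← hg, LinearMap.mem_ker.1 hb, map_zero]), Coh.mk_eq_zero]
    constructor
    · rintro ⟨y, hy⟩
      obtain ⟨⟨a, ha⟩, rfl⟩ := Submodule.Quotient.mk_surjective _ y
      have ha' : dB p (f p a) = 0 := by rw [← hf, LinearMap.mem_ker.1 ha, map_zero]
      rw [cohMap_mk f hf p _ ha', ← sub_eq_zero, ← Submodule.Quotient.mk_sub, Coh.mk_eq_zero] at hy
      change f p a - b ∈ _ at hy
      cases p with
      | zero =>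
        rw [cobdry, Submodule.mem_bot, sub_eq_zero] at hy
        rw [cobdry, Submodule.mem_bot]
        change g 0 b = 0
        rw [← hy, hgf]
      | succ p =>
        obtain ⟨b', hb'⟩ := hy
        refine ⟨- g p b', ?_⟩
        rw [map_neg, ← hg, hb', map_sub, hgf, zero_sub, neg_neg]
    · intro h
      have key : ∃ a, b - f p a ∈ cobdry dB p := by
        cases p with
        | zero =>
          rw [cobdry, Submodule.mem_bot] at h
          obtain ⟨a, ha⟩ := (hex 0 b).1 h
          exact ⟨a, by rw [ha, sub_self]; exact Submodule.zero_mem _⟩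
        | succ p =>
          obtain ⟨c', hc'⟩ := h
          obtain ⟨a, ha⟩ := (hex (p + 1) (b - dB p (s p c'))).1 (by
            rw [map_sub, hg, hs', hc', sub_self])
          exact ⟨a, s p c', by rw [ha, sub_sub_cancel]⟩
      obtain ⟨a, ha⟩ := key
      have h1 : dB p (b - f p a) = 0 := by
        cases p with
        | zero => rw [cobdry, Submodule.mem_bot] at ha; rw [ha, map_zero]
        | succ p => obtain ⟨b', hb'⟩ := ha; rw [← hb', hdB]
      have h2 : dA p a = 0 := by
        apply hinj
        rw [map_sub, LinearMap.mem_ker.1 hb, zero_sub, neg_eq_zero] at h1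
        rw [hf, h1, map_zero]
      refine ⟨Submodule.Quotient.mk ⟨a, h2⟩, ?_⟩
      rw [cohMap_mk f hf p _ (by rw [← hf, h2, map_zero]), eq_comm, ← sub_eq_zero,
        ← Submodule.Quotient.mk_sub, Coh.mk_eq_zero]
      exact ha
  have E2 : ∀ p, LinearMap.range (cohMap g hg p) = LinearMap.ker (δ p) := by
    intro p
    ext x
    obtain ⟨⟨c, hc⟩, rfl⟩ := Submodule.Quotient.mk_surjective _ x
    constructor
    · rintro ⟨y, hy⟩
      obtain ⟨⟨b, hb⟩, rfl⟩ := Submodule.Quotient.mk_surjective _ y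
      rw [← hy, LinearMap.mem_ker, cohMap_mk g hg p _ (by rw [← hg, LinearMap.mem_ker.1 hb, map_zero]),
        hδ, Coh.mk_eq_zero]
      obtain ⟨a, ha⟩ := (hex p (s p (g p b) - b)).1 (by rw [map_sub, hs', sub_self])
      refine ⟨a, hinj _ ?_⟩
      rw [hfδ p _ (by rw [← hg, LinearMap.mem_ker.1 hb, map_zero]), hf, ha, map_sub]
      change _ = dB p (s p (g p b))
      rw [LinearMap.mem_ker.1 hb, sub_zero]
    · intro h
      rw [LinearMap.mem_ker, hδ, Coh.mk_eq_zero] at h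
      obtain ⟨a, ha⟩ := h
      have h1 : dB p (s p c - f p a) = 0 := by
        rw [map_sub, ← hf, ha, hfδ p c hc, sub_self]
      refine ⟨Submodule.Quotient.mk ⟨_, h1⟩, ?_⟩
      rw [cohMap_mk g hg p _ (by rw [← hg, h1, map_zero])]
      congr 2
      rw [map_sub, hs', hgf, sub_zero]
  have E3 : ∀ p, LinearMap.range (δ p) = LinearMap.ker (cohMap f hf (p + 1)) := by
    intro p
    ext x
    obtain ⟨⟨a, ha⟩, rfl⟩ := Submodule.Quotient.mk_surjective _ x
    rw [LinearMap.mem_ker, cohMap_mk f hf (p + 1) _ (by rw [← hf, LinearMap.mem_ker.1 ha, map_zero]),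
      Coh.mk_eq_zero]
    constructor
    · rintro ⟨y, hy⟩
      obtain ⟨⟨c, hc⟩, rfl⟩ := Submodule.Quotient.mk_surjective _ y
      rw [hδ, ← sub_eq_zero, ← Submodule.Quotient.mk_sub, Coh.mk_eq_zero] at hy
      obtain ⟨a', ha'⟩ := hy
      refine ⟨s p c - f p a', ?_⟩
      rw [map_sub, ← hf, ha']
      change _ - f (p + 1) (r (p + 1) (dB p (s p c)) - a) = f (p + 1) a
      rw [map_sub, hfδ p c hc, sub_sub_cancel]
    · rintro ⟨b, hb⟩
      have hc : dC p (g p b) = 0 := by rw [← hg, hb, hgf]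
      refine ⟨Submodule.Quotient.mk ⟨g p b, hc⟩, ?_⟩
      rw [hδ, ← sub_eq_zero, ← Submodule.Quotient.mk_sub, Coh.mk_eq_zero]
      obtain ⟨a', ha'⟩ := (hex p (s p (g p b) - b)).1 (by rw [map_sub, hs', sub_self])
      refine ⟨a', hinj _ ?_⟩
      change _ = f (p + 1) (r (p + 1) (dB p (s p (g p b))) - a)
      rw [map_sub, hfδ p _ hc, hf, ha', map_sub, hb]
  have hC : ∀ p, Module.Finite K (Coh dC p) := by
    intro p
    have h1 : Module.Finite K (LinearMap.ker (δ p)) := by rw [← E2]; infer_instance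
    have h2 : Module.Finite K (Coh dC p ⧸ LinearMap.ker (δ p)) :=
      Module.Finite.equiv (δ p).quotKerEquivRange.symm
    exact Module.Finite.of_submodule_quotient (LinearMap.ker (δ p))
  refine ⟨hC, fun p => Module.finrank K (LinearMap.range (cohMap f hf p)), ?_, fun p => ?_,
    fun p => ?_⟩
  · apply LinearMap.finrank_range_of_inj
    rw [injective_iff_map_eq_zero]
    intro x hx
    obtain ⟨⟨a, ha⟩, rfl⟩ := Submodule.Quotient.mk_surjective _ x
    rw [cohMap_mk f hf 0 _ (by rw [← hf, LinearMap.mem_ker.1 ha, map_zero]), Coh.mk_eq_zero] at hx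
    rw [Coh.mk_eq_zero]
    exact (Submodule.mem_bot K).2 ((hinj 0).eq_iff.1 (((Submodule.mem_bot K).1 hx).trans (map_zero _).symm))
  · exact LinearMap.finrank_range_le _
  · have h1 := (cohMap g hg p).finrank_range_add_finrank_ker
    have h2 := (δ p).finrank_range_add_finrank_ker
    have h3 := (cohMap f hf (p + 1)).finrank_range_add_finrank_ker
    rw [← E1] at h1
    rw [← E2] at h2
    rw [← E3] at h3
    dsimp only
    omega

end LongExactSequence

end

section

open MvPolynomial

variable {N : ℕ}

/-! ### The cohomology of a hypersurface -/

lemma twistedSections_chart_eq_div {Q : MvPolynomial (Fin N) ℂ} {e : ℕ} (hQ : Q.IsHomogeneous e)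
    {p : ℕ} (σ : Fin (p + 1) ↪o Fin N) {k : ℤ} (s : twistedSections (chart (zeroLocus Q) σ) k) :
    ∃ (m a : ℕ) (P : MvPolynomial (Fin N) ℂ), P.IsHomogeneous a ∧
      (a : ℤ) = m * (p + 1 : ℕ) + k ∧ ∀ w, s.1 w = eval w.1 P / eval w.1 (chartPoly σ) ^ m := by
  have := @exists_eq_div_pow N Q (chartPoly σ) e (p + 1) hQ (chartPoly_isHomogeneous σ) p.succ_pos k
  rw [← chart_eq_basicOpen] at this
  obtain ⟨m, hm⟩ := this s.2
  exact ⟨m, hm m le_rfl⟩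

lemma twistedSections_chart_univ_eq_div {p : ℕ} (σ : Fin (p + 1) ↪o Fin N) {k : ℤ}
    (s : twistedSections (chart Set.univ σ) k) :
    ∃ (m a : ℕ) (P : MvPolynomial (Fin N) ℂ), P.IsHomogeneous a ∧
      (a : ℤ) = m * (p + 1 : ℕ) + k ∧ ∀ w, s.1 w = eval w.1 P / eval w.1 (chartPoly σ) ^ m := by
  revert s
  rw [← zeroLocus_zero]
  exact fun s => twistedSections_chart_eq_div (isHomogeneous_zero _ _ 0) σ s

lemma isLocallyFraction_chart {Q : MvPolynomial (Fin N) ℂ} {e : ℕ} (hQ : Q.IsHomogeneous e)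
    {p : ℕ} (σ : Fin (p + 1) ↪o Fin N) {k : ℤ} {P : MvPolynomial (Fin N) ℂ} {a m : ℕ}
    (hP : P.IsHomogeneous a) (ha : (a : ℤ) = m * (p + 1 : ℕ) + k) :
    IsLocallyFraction (chart (zeroLocus Q) σ) k
      (fun w => eval w.1 P / eval w.1 (chartPoly σ) ^ m) := by
  have := isLocallyFraction_div_pow hQ (chartPoly_isHomogeneous σ) hP ha
  rwa [← chart_eq_basicOpen] at this

/-- Multiplication of sections of `𝒪(k)` by a form of degree `e`. -/
def mulForm {U : Set (PSpace N)} {Q : MvPolynomial (Fin N) ℂ} {e : ℕ} (hQ : Q.IsHomogeneous e)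
    (k : ℤ) : twistedSections U (k - e) →ₗ[ℂ] twistedSections U k where
  toFun s := ⟨fun w => eval w.1 Q * s.1 w, by
    intro v
    obtain ⟨a, b, P, R, hP, hR, hab, hv, h⟩ := s.2 v
    refine ⟨e + a, b, Q * P, R, hQ.mul hP, hR, by push_cast; omega, hv, fun w hw => ?_⟩
    change eval w.1 Q * s.1 w = _
    rw [h w hw, map_mul, mul_div_assoc]⟩
  map_add' s t := by ext w; exact mul_add _ _ _
  map_smul' c s := by
    ext w
    exact mul_left_comm (eval w.1 Q) c (s.1 w)

lemma mulForm_apply {U : Set (PSpace N)} {Q : MvPolynomial (Fin N) ℂ} {e : ℕ}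
    (hQ : Q.IsHomogeneous e) (k : ℤ) (s : twistedSections U (k - e)) (w : cone U) :
    (mulForm hQ k s).1 w = eval w.1 Q * s.1 w := rfl

lemma chart_mono {X Y : Set (PSpace N)} (h : X ⊆ Y) {p : ℕ} (σ : Fin (p + 1) ↪o Fin N) :
    chart X σ ⊆ chart Y σ := fun _ hx => ⟨h hx.1, hx.2⟩

lemma mulForm_injective {Q : MvPolynomial (Fin N) ℂ} {e : ℕ} (hQ : Q.IsHomogeneous e)
    (hQ0 : Q ≠ 0) {p : ℕ} (σ : Fin (p + 1) ↪o Fin N) (k : ℤ) :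
    Function.Injective (mulForm (U := chart Set.univ σ) hQ k) := by
  rw [injective_iff_map_eq_zero]
  intro s hs
  obtain ⟨m, a, P, -, -, hP⟩ := twistedSections_chart_univ_eq_div σ s
  have hne : ∀ w : cone (chart (Set.univ : Set (PSpace N)) σ), eval w.1 (chartPoly σ) ≠ 0 :=
    fun w => by
      rw [eval_chartPoly]; exact Finset.prod_ne_zero_iff.2 (mem_cone_chart_univ.1 w.2)
  have hzero : Q * P * chartPoly σ = 0 := by
    refine MvPolynomial.funext fun w => ?_
    rw [map_mul, map_mul, map_zero]
    by_cases hw : eval w (chartPoly σ) = 0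
    · rw [hw, mul_zero]
    · have hw' : w ∈ cone (chart (Set.univ : Set (PSpace N)) σ) := by
        rw [mem_cone_chart_univ]
        rw [eval_chartPoly] at hw
        exact Finset.prod_ne_zero_iff.1 hw
      have h1 := congrFun (congrArg Subtype.val hs) ⟨w, hw'⟩
      rw [mulForm_apply, hP] at h1
      change eval w Q * (eval w P / eval w (chartPoly σ) ^ m) = 0 at h1
      rw [← mul_div_assoc, div_eq_zero_iff, or_iff_left (pow_ne_zero _ hw)] at h1
      rw [h1, zero_mul]
  have hc0 : chartPoly σ ≠ 0 := Finset.prod_ne_zero_iff.2 fun a _ => X_ne_zero _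
  have hP0 : P = 0 := by
    rcases mul_eq_zero.1 hzero with h | h
    · exact (mul_eq_zero.1 h).resolve_left hQ0
    · exact absurd h hc0
  ext w
  rw [hP, hP0]
  simp

lemma resTwisted_chart_surjective {Q : MvPolynomial (Fin N) ℂ} {e : ℕ} (hQ : Q.IsHomogeneous e)
    {p : ℕ} (σ : Fin (p + 1) ↪o Fin N) (k : ℤ) : Function.Surjective
      (resTwisted (chart_mono (Set.subset_univ (zeroLocus Q)) σ) k) := by
  intro s
  obtain ⟨m, a, P, hP, ha, hs⟩ := twistedSections_chart_eq_div hQ σ s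
  have hL := isLocallyFraction_chart (Q := (0 : MvPolynomial (Fin N) ℂ)) (isHomogeneous_zero _ _ 0)
    σ hP ha
  rw [zeroLocus_zero] at hL
  exact ⟨⟨_, hL⟩, Subtype.ext (funext fun w => (hs w).symm)⟩

lemma exists_mulForm_eq {Q : MvPolynomial (Fin N) ℂ} {e : ℕ} (hQ : Q.IsHomogeneous e)
    (hirr : Irreducible Q) {p : ℕ} (σ : Fin (p + 1) ↪o Fin N) (k : ℤ)
    (s : twistedSections (chart (Set.univ : Set (PSpace N)) σ) k)
    (hs : resTwisted (chart_mono (Set.subset_univ (zeroLocus Q)) σ) k s = 0) :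
    ∃ t, mulForm hQ k t = s := by
  obtain ⟨m, a, P, hPh, ha, hP⟩ := twistedSections_chart_univ_eq_div σ s
  have hne : ∀ w : cone (chart (Set.univ : Set (PSpace N)) σ), eval w.1 (chartPoly σ) ≠ 0 :=
    fun w => by
      rw [eval_chartPoly]; exact Finset.prod_ne_zero_iff.2 (mem_cone_chart_univ.1 w.2)
  obtain ⟨G, hG⟩ : Q ∣ chartPoly σ * P := by
    refine dvd_mul_of_forall_cone hQ hirr (chartPoly_isHomogeneous σ) p.succ_pos fun w hw => ?_
    rw [← chart_eq_basicOpen] at hw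
    have h1 := congrFun (congrArg Subtype.val hs) ⟨w, hw⟩
    change s.1 ⟨w, _⟩ = 0 at h1
    rw [hP, div_eq_zero_iff, or_iff_left (pow_ne_zero _ (hne _))] at h1
    exact h1
  -- `G` is homogeneous, because `Q` and `Q G` are: compare values at `c w` and `w` where `Q ≠ 0`
  by_cases hP0 : P = 0
  · refine ⟨0, ?_⟩
    rw [map_zero]
    ext w
    rw [hP w, hP0]; simp
  have hc0 : chartPoly σ ≠ 0 := Finset.prod_ne_zero_iff.2 fun a _ => X_ne_zero _
  have hhom := (chartPoly_isHomogeneous σ).mul hPh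
  have hG0 : G ≠ 0 := by
    rintro rfl
    rw [mul_zero] at hG
    exact mul_ne_zero hc0 hP0 hG
  have hdeg : e + G.totalDegree = p + 1 + a := by
    rw [← hQ.totalDegree hirr.ne_zero, ← totalDegree_mul_of_isDomain hirr.ne_zero hG0, ← hG,
      hhom.totalDegree (mul_ne_zero hc0 hP0)]
  have hGh : G.IsHomogeneous G.totalDegree := by
    have key : homogeneousComponent G.totalDegree G = G := by
      refine mul_left_cancel₀ hirr.ne_zero (MvPolynomial.funext fun w => ?_)
      rw [map_mul, map_mul]
      by_cases hw : eval w Q = 0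
      · rw [hw, zero_mul, zero_mul]
      · rw [eval_homogeneousComponent_of_forall_smul]
        intro c hc
        have h1 := eval_smul_of_isHomogeneous hhom c w
        rw [hG, map_mul, map_mul, eval_smul_of_isHomogeneous hQ, ← hdeg, pow_add] at h1
        have h2 : c ^ e * eval w Q ≠ 0 := mul_ne_zero (pow_ne_zero _ hc) hw
        exact mul_left_cancel₀ h2 (by linear_combination h1)
    have h := homogeneousComponent_isHomogeneous G.totalDegree G
    rwa [key] at h
  have hL := isLocallyFraction_chart (Q := (0 : MvPolynomial (Fin N) ℂ)) (isHomogeneous_zero _ _ 0)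
    σ (k := k - e) (m := m + 1) hGh (by push_cast at ha ⊢; zify at hdeg; linear_combination hdeg + ha)
  rw [zeroLocus_zero] at hL
  refine ⟨⟨_, hL⟩, ?_⟩
  ext w
  rw [mulForm_apply, hP]
  have h1 := congrArg (eval w.1) hG
  rw [map_mul, map_mul] at h1
  have := hne w
  change eval w.1 Q * (eval w.1 G / eval w.1 (chartPoly σ) ^ (m + 1)) = _
  rw [← mul_div_assoc, ← h1, pow_succ]
  field_simp

lemma cechD_map {X Y : Set (PSpace N)} {j k : ℤ}
    (φ : ∀ (p : ℕ) (σ : Fin (p + 1) ↪o Fin N),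
      twistedSections (chart X σ) j →ₗ[ℂ] twistedSections (chart Y σ) k)
    (hφ : ∀ (p : ℕ) (σ : Fin (p + 2) ↪o Fin N) (i : Fin (p + 2)) s,
      φ (p + 1) σ (resTwisted (chart_subset_face X σ i) j s) =
        resTwisted (chart_subset_face Y σ i) k (φ p (face σ i) s))
    (p : ℕ) (c : Cochain X j p) :
    (LinearMap.piMap (φ (p + 1))) (cechD X j p c) = cechD Y k p (LinearMap.piMap (φ p) c) := by
  funext σ
  rw [cechD_apply]
  change φ (p + 1) σ (cechD X j p c σ) = _
  rw [cechD_apply, map_sum]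
  refine Finset.sum_congr rfl fun i _ => ?_
  rw [map_smul, hφ]
  rfl

lemma finrank_cohomology_eq_coh (X : Set (PSpace N)) (k : ℤ) (p : ℕ) :
    Module.finrank ℂ (Cohomology X k p) = Module.finrank ℂ (Coh (cechD X k) p) := by
  cases p <;> rfl

lemma finite_cohomology_iff_coh (X : Set (PSpace N)) (k : ℤ) (p : ℕ) :
    Module.Finite ℂ (Cohomology X k p) ↔ Module.Finite ℂ (Coh (cechD X k) p) := by
  cases p <;> rfl

/-- The sequence `0 → 𝒪(k - e) → 𝒪(k) → 𝒪_X(k) → 0` of an irreducible hypersurface of degree `e` is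
exact on charts; its long exact sequence gives the cohomology of the hypersurface. -/
theorem eulerChar_hypersurface {n : ℕ} {Q : MvPolynomial (Fin (n + 2)) ℂ} {e : ℕ}
    (hQ : Q.IsHomogeneous e) (hirr : Irreducible Q) (k : ℤ) :
    (∀ p, Module.Finite ℂ (Cohomology (zeroLocus Q) k p)) ∧
      eulerChar (zeroLocus Q) k = eulerChar (Set.univ : Set (PSpace (n + 2))) k -
        eulerChar (Set.univ : Set (PSpace (n + 2))) (k - e) := by
  let f : ∀ p, Cochain (Set.univ : Set (PSpace (n + 2))) (k - e) p →ₗ[ℂ]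
      Cochain (Set.univ : Set (PSpace (n + 2))) k p :=
    fun p => LinearMap.piMap fun σ => mulForm hQ k
  let g : ∀ p, Cochain (Set.univ : Set (PSpace (n + 2))) k p →ₗ[ℂ] Cochain (zeroLocus Q) k p :=
    fun p => LinearMap.piMap fun σ => resTwisted (chart_mono (Set.subset_univ (zeroLocus Q)) σ) k
  obtain ⟨hfin, r, hr0, hrle, hr⟩ := finrank_coh_of_shortExact (f := f) (g := g)
    (dA := cechD Set.univ (k - e)) (dB := cechD Set.univ k) (dC := cechD (zeroLocus Q) k)
    (fun p c => cechD_map (fun p σ => mulForm hQ k) (fun _ _ _ _ => rfl) p c)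
    (fun p c => cechD_map (fun p σ => resTwisted (chart_mono (Set.subset_univ (zeroLocus Q)) σ) k)
      (fun _ _ _ _ => rfl) p c)
    (fun p a b h => funext fun σ => mulForm_injective hQ hirr.ne_zero σ k (congrFun h σ))
    (fun p c => by
      choose b hb using fun σ => resTwisted_chart_surjective hQ σ k (c σ)
      exact ⟨b, funext hb⟩)
    (fun p b => by
      constructor
      · intro h
        choose a ha using fun σ => exists_mulForm_eq hQ hirr σ k (b σ) (congrFun h σ)
        exact ⟨a, funext ha⟩
      · rintro ⟨a, rfl⟩
        funext σ
        ext w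
        change eval w.1 Q * _ = 0
        rw [((mem_cone_chart hQ).1 w.2).1, zero_mul])
    (fun p b => cechD_univ_cechD_univ b)
    (fun p => (finite_cohomology_iff_coh _ _ _).1 (finite_cohomology_univ _ _))
    (fun p => (finite_cohomology_iff_coh _ _ _).1 (finite_cohomology_univ _ _))
  refine ⟨fun p => (finite_cohomology_iff_coh _ _ _).2 (hfin p), ?_⟩
  simp only [eulerChar, finrank_cohomology_eq_coh]
  -- there are no cochains in degree `n + 2`
  have htop : r (n + 2) = 0 := by
    refine Nat.le_zero.1 ((hrle _).trans ?_)
    have : Subsingleton (Cohomology (Set.univ : Set (PSpace (n + 2))) (k - e) (n + 1 + 1)) :=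
      cohomology_univ_subsingleton (by omega)
    rw [← finrank_cohomology_eq_coh, Module.finrank_zero_of_subsingleton]
  have htopA : Module.finrank ℂ (Coh (cechD (Set.univ : Set (PSpace (n + 2))) (k - e)) (n + 2)) = 0 := by
    have : Subsingleton (Cohomology (Set.univ : Set (PSpace (n + 2))) (k - e) (n + 1 + 1)) :=
      cohomology_univ_subsingleton (by omega)
    rw [← finrank_cohomology_eq_coh, Module.finrank_zero_of_subsingleton]
  have key : ∀ m : ℕ, ∑ p ∈ Finset.range m, (-1 : ℤ) ^ p *
        (Module.finrank ℂ (Coh (cechD (zeroLocus Q) k) p) : ℤ) =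
      ∑ p ∈ Finset.range m, (-1 : ℤ) ^ p *
          (Module.finrank ℂ (Coh (cechD (Set.univ : Set (PSpace (n + 2))) k) p) : ℤ) -
        ∑ p ∈ Finset.range m, (-1 : ℤ) ^ p *
          (Module.finrank ℂ (Coh (cechD (Set.univ : Set (PSpace (n + 2))) (k - e)) p) : ℤ) +
        (-1) ^ m * ((r m : ℤ) -
          Module.finrank ℂ (Coh (cechD (Set.univ : Set (PSpace (n + 2))) (k - e)) m)) := by
    intro m
    induction m with
    | zero => rw [hr0]; simp
    | succ m ih =>
      rw [Finset.sum_range_succ, Finset.sum_range_succ, Finset.sum_range_succ, ih]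
      have h := hr m
      zify at h
      rw [pow_succ]
      linear_combination (-1 : ℤ) ^ m * h
  rw [key (n + 2), htop, htopA]
  simp

end

section

open MvPolynomial

variable {N : ℕ}

/-! ### Gradients of regular functions on a hypersurface -/

/-- The gradient of a polynomial at a point. -/
def gradAt (P : MvPolynomial (Fin N) ℂ) (v : Fin N → ℂ) : Fin N → ℂ := fun i => eval v (pderiv i P)

lemma gradAt_add (P R : MvPolynomial (Fin N) ℂ) (v : Fin N → ℂ) :
    gradAt (P + R) v = gradAt P v + gradAt R v := by
  funext i; simp [gradAt]

lemma gradAt_sub (P R : MvPolynomial (Fin N) ℂ) (v : Fin N → ℂ) :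
    gradAt (P - R) v = gradAt P v - gradAt R v := by
  funext i; simp [gradAt]

lemma gradAt_mul (P R : MvPolynomial (Fin N) ℂ) (v : Fin N → ℂ) :
    gradAt (P * R) v = eval v P • gradAt R v + eval v R • gradAt P v := by
  funext i
  simp [gradAt, Derivation.leibniz]

lemma gradAt_pow (P : MvPolynomial (Fin N) ℂ) (m : ℕ) (v : Fin N → ℂ) :
    gradAt (P ^ m) v = (m * eval v P ^ (m - 1)) • gradAt P v := by
  funext i
  simp [gradAt, Derivation.leibniz_pow, mul_assoc]

lemma gradAt_X (i : Fin N) (v : Fin N → ℂ) : gradAt (X i) v = Pi.single i 1 := by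
  funext j
  rw [gradAt, pderiv_X]
  by_cases h : j = i
  · subst h; simp
  · simp [Pi.single_eq_of_ne h, Pi.single_eq_of_ne (Ne.symm h)]

/-- Euler's identity. -/
lemma gradAt_dotProduct_self {P : MvPolynomial (Fin N) ℂ} {b : ℕ} (hP : P.IsHomogeneous b)
    (v : Fin N → ℂ) : gradAt P v ⬝ᵥ v = b * eval v P := by
  have h := congrArg (eval v) hP.sum_X_mul_pderiv
  rw [map_sum, nsmul_eq_mul, map_mul, map_natCast] at h
  rw [← h, dotProduct]
  refine Finset.sum_congr rfl fun i _ => ?_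
  rw [gradAt, map_mul, eval_X, mul_comm]

/-- `ξ` is the gradient at `v` of a homogeneous fraction that represents `a` near `v`. -/
def HasGrad {U : Set (PSpace N)} (a : cone U → ℂ) (v : cone U) (ξ : Fin N → ℂ) : Prop :=
  ∃ (b : ℕ) (P R : MvPolynomial (Fin N) ℂ), P.IsHomogeneous b ∧ R.IsHomogeneous b ∧
    eval v.1 R ≠ 0 ∧ (∀ w : cone U, eval w.1 R ≠ 0 → a w = eval w.1 P / eval w.1 R) ∧
    eval v.1 R • ξ = gradAt P v.1 - a v • gradAt R v.1

lemma exists_hasGrad {U : Set (PSpace N)} (a : regularFunctions U) (v : cone U) :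
    ∃ ξ, HasGrad a.1 v ξ := by
  obtain ⟨b, b', P, R, hP, hR, hb, hv, h⟩ := a.2 v
  obtain rfl : b = b' := by omega
  exact ⟨(eval v.1 R)⁻¹ • (gradAt P v.1 - a.1 v • gradAt R v.1), b, P, R, hP, hR, hv, h,
    smul_inv_smul₀ hv _⟩

namespace HasGrad

variable {U : Set (PSpace N)} {a a' : cone U → ℂ} {v : cone U} {ξ ξ' : Fin N → ℂ}

/-- Regular functions have degree zero, so their gradients are orthogonal to the Euler field. -/
lemma dotProduct_self (h : HasGrad a v ξ) : ξ ⬝ᵥ v.1 = 0 := by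
  obtain ⟨b, P, R, hP, hR, hv, h, hξ⟩ := h
  have h1 := congrArg (fun x => x ⬝ᵥ v.1) hξ
  simp only [smul_dotProduct, sub_dotProduct, gradAt_dotProduct_self hP, gradAt_dotProduct_self hR,
    smul_eq_mul] at h1
  rw [h v hv] at h1
  have h2 : eval v.1 R * ξ ⬝ᵥ v.1 = 0 := by rw [h1]; field_simp; ring
  exact (mul_eq_zero.1 h2).resolve_left hv

lemma add (h : HasGrad a v ξ) (h' : HasGrad a' v ξ') : HasGrad (a + a') v (ξ + ξ') := by
  obtain ⟨b, P, R, hP, hR, hv, h, hξ⟩ := h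
  obtain ⟨b', P', R', hP', hR', hv', h', hξ'⟩ := h'
  refine ⟨b + b', P * R' + R * P', R * R', (hP.mul hR').add (hR.mul hP'), hR.mul hR', ?_, ?_, ?_⟩
  · rw [map_mul]; exact mul_ne_zero hv hv'
  · intro w hw
    rw [map_mul] at hw
    have h1 := left_ne_zero_of_mul hw
    have h2 := right_ne_zero_of_mul hw
    rw [Pi.add_apply, h w h1, h' w h2, map_add, map_mul, map_mul, map_mul, div_add_div _ _ h1 h2]
  · rw [gradAt_add, gradAt_mul, gradAt_mul, gradAt_mul, map_mul, Pi.add_apply]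
    have e1 : eval v.1 P = a v * eval v.1 R := by rw [h v hv]; field_simp
    have e2 : eval v.1 P' = a' v * eval v.1 R' := by rw [h' v hv']; field_simp
    rw [e1, e2]
    funext i
    have h1 := congrFun hξ i
    have h2 := congrFun hξ' i
    simp only [Pi.smul_apply, Pi.sub_apply, Pi.add_apply, smul_eq_mul] at h1 h2 ⊢
    linear_combination eval v.1 R' * h1 + eval v.1 R * h2

lemma mul (h : HasGrad a v ξ) (h' : HasGrad a' v ξ') :
    HasGrad (a * a') v (a v • ξ' + a' v • ξ) := by
  obtain ⟨b, P, R, hP, hR, hv, h, hξ⟩ := h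
  obtain ⟨b', P', R', hP', hR', hv', h', hξ'⟩ := h'
  refine ⟨b + b', P * P', R * R', hP.mul hP', hR.mul hR', ?_, ?_, ?_⟩
  · rw [map_mul]; exact mul_ne_zero hv hv'
  · intro w hw
    rw [map_mul] at hw
    rw [Pi.mul_apply, h w (left_ne_zero_of_mul hw), h' w (right_ne_zero_of_mul hw), map_mul,
      map_mul, div_mul_div_comm]
  · rw [gradAt_mul, gradAt_mul, map_mul, Pi.mul_apply]
    have e1 : eval v.1 P = a v * eval v.1 R := by rw [h v hv]; field_simp
    have e2 : eval v.1 P' = a' v * eval v.1 R' := by rw [h' v hv']; field_simp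
    rw [e1, e2]
    funext i
    have h1 := congrFun hξ i
    have h2 := congrFun hξ' i
    simp only [Pi.smul_apply, Pi.sub_apply, Pi.add_apply, smul_eq_mul] at h1 h2 ⊢
    linear_combination eval v.1 R' * a' v * h1 + eval v.1 R * a v * h2

lemma restrict {U' : Set (PSpace N)} {a : cone U' → ℂ} (hU : U ⊆ U')
    (h : HasGrad a (Set.inclusion (cone_mono hU) v) ξ) :
    HasGrad (a ∘ Set.inclusion (cone_mono hU)) v ξ := by
  obtain ⟨b, P, R, hP, hR, hv, h, hξ⟩ := h
  exact ⟨b, P, R, hP, hR, hv, fun w hw => h (Set.inclusion (cone_mono hU) w) hw, hξ⟩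

end HasGrad

lemma hasGrad_const {U : Set (PSpace N)} (c : ℂ) (v : cone U) : HasGrad (fun _ => c) v 0 := by
  refine ⟨0, C c, 1, isHomogeneous_C _ _, isHomogeneous_one _ _, by simp, by simp, ?_⟩
  funext i
  simp [gradAt]

/-- The gradient of a regular function on a hypersurface is unique up to multiples of the gradient of
the equation. -/
lemma HasGrad.exists_sub_eq {Q F : MvPolynomial (Fin N) ℂ} {e d : ℕ} (hQ : Q.IsHomogeneous e)
    (hirr : Irreducible Q) (hF : F.IsHomogeneous d) (hd : 0 < d)
    {a : cone (basicOpen (zeroLocus Q) F) → ℂ} {v : cone (basicOpen (zeroLocus Q) F)}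
    {ξ ξ' : Fin N → ℂ} (h : HasGrad a v ξ) (h' : HasGrad a v ξ') :
    ∃ c : ℂ, ξ - ξ' = c • gradAt Q v.1 := by
  obtain ⟨b, P, R, hP, hR, hv, h, hξ⟩ := h
  obtain ⟨b', P', R', hP', hR', hv', h', hξ'⟩ := h'
  obtain ⟨-, hQv, hFv⟩ := (mem_cone_basicOpen hQ hF).1 v.2
  obtain ⟨G, hG⟩ : Q ∣ F * ((R * R') * (P * R' - R * P')) := by
    refine dvd_mul_of_forall_cone hQ hirr hF hd fun w hw => ?_
    rw [map_mul, map_mul, map_sub, map_mul, map_mul]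
    by_cases h1 : eval w R = 0
    · rw [h1]; ring
    by_cases h2 : eval w R' = 0
    · rw [h2]; ring
    have e1 := h ⟨w, hw⟩ h1
    rw [h' ⟨w, hw⟩ h2, div_eq_div_iff h2 h1] at e1
    change eval w P' * eval w R = eval w P * eval w R' at e1
    linear_combination (- eval w R * eval w R') * e1
  have e1 : eval v.1 P = a v * eval v.1 R := by rw [h v hv]; field_simp
  have e2 : eval v.1 P' = a v * eval v.1 R' := by rw [h' v hv']; field_simp
  have key := congrArg (fun p => gradAt p v.1) hG
  simp only [gradAt_mul, gradAt_sub, map_mul, map_sub, e1, e2, hQv] at key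
  set E := eval v.1 F * (eval v.1 R * eval v.1 R' * (eval v.1 R * eval v.1 R')) with hE
  have hE0 : E ≠ 0 := mul_ne_zero hFv (mul_ne_zero (mul_ne_zero hv hv') (mul_ne_zero hv hv'))
  refine ⟨E⁻¹ * eval v.1 G, ?_⟩
  rw [mul_smul, eq_inv_smul_iff₀ hE0]
  funext i
  have h1 := congrFun hξ i
  have h2 := congrFun hξ' i
  have h3 := congrFun key i
  simp only [Pi.smul_apply, Pi.sub_apply, Pi.add_apply, smul_eq_mul] at h1 h2 h3 ⊢
  rw [hE]
  linear_combination h3 + (eval v.1 F * eval v.1 R * eval v.1 R' * eval v.1 R') * h1 -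
    (eval v.1 F * eval v.1 R * eval v.1 R' * eval v.1 R) * h2

/-- A vector that pairs to one with a given nonzero vector. -/
def dualVec (x : Fin N → ℂ) : Fin N → ℂ := (x ⬝ᵥ star x)⁻¹ • star x

open scoped ComplexOrder in
lemma dotProduct_dualVec {x : Fin N → ℂ} (hx : x ≠ 0) : x ⬝ᵥ dualVec x = 1 := by
  rw [dualVec, dotProduct_smul, smul_eq_mul, inv_mul_cancel₀]
  rwa [Ne, dotProduct_comm, dotProduct_star_self_eq_zero]

/-- The projection of a covector along `x`, to the annihilator of `dualVec x`. -/
def projAlong (x : Fin N → ℂ) : (Fin N → ℂ) →ₗ[ℂ] (Fin N → ℂ) where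
  toFun ξ := ξ - (ξ ⬝ᵥ dualVec x) • x
  map_add' ξ η := by rw [add_dotProduct, add_smul]; abel
  map_smul' c ξ := by
    rw [smul_dotProduct, smul_eq_mul, mul_smul, RingHom.id_apply, smul_sub]

lemma projAlong_apply (x ξ : Fin N → ℂ) : projAlong x ξ = ξ - (ξ ⬝ᵥ dualVec x) • x := rfl

lemma projAlong_smul_self {x : Fin N → ℂ} (hx : x ≠ 0) (c : ℂ) : projAlong x (c • x) = 0 := by
  rw [map_smul, projAlong_apply, dotProduct_dualVec hx, one_smul, sub_self, smul_zero]

/-- The gradient of a regular function, normalized by a projection along the gradient of the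
equation of the hypersurface. -/
def normGrad (Q : MvPolynomial (Fin N) ℂ) {U : Set (PSpace N)} (a : regularFunctions U)
    (v : cone U) : Fin N → ℂ :=
  projAlong (gradAt Q v.1) (exists_hasGrad a v).choose

/-- An irreducible hypersurface `Q = 0` of degree `e + 1` whose affine cone is smooth away from the
origin. -/
structure IsSmoothHypersurface (Q : MvPolynomial (Fin N) ℂ) (e : ℕ) : Prop where
  homog : Q.IsHomogeneous (e + 1)
  irreducible : Irreducible Q
  gradAt_ne_zero : ∀ v, v ≠ 0 → eval v Q = 0 → gradAt Q v ≠ 0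

lemma normGrad_eq {Q F : MvPolynomial (Fin N) ℂ} {e d : ℕ} (hQ : IsSmoothHypersurface Q e)
    (hF : F.IsHomogeneous d) (hd : 0 < d) {a : regularFunctions (basicOpen (zeroLocus Q) F)}
    {v : cone (basicOpen (zeroLocus Q) F)} {ξ : Fin N → ℂ} (h : HasGrad a.1 v ξ) :
    normGrad Q a v = projAlong (gradAt Q v.1) ξ := by
  obtain ⟨c, hc⟩ :=
    (exists_hasGrad a v).choose_spec.exists_sub_eq hQ.homog hQ.irreducible hF hd h
  obtain ⟨hv, hQv, -⟩ := (mem_cone_basicOpen hQ.homog hF).1 v.2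
  rw [← sub_eq_zero, normGrad, ← map_sub, hc, projAlong_smul_self (hQ.gradAt_ne_zero _ hv hQv)]

end

section

open MvPolynomial

variable {N n : ℕ}

/-! ### The residue map from top forms to sections of a twisting sheaf -/

/-- The derivation that takes a regular function to the `i`-th component of its normalized
gradient. -/
def gradDerivation {Q F : MvPolynomial (Fin N) ℂ} {e d : ℕ} (hQ : IsSmoothHypersurface Q e)
    (hF : F.IsHomogeneous d) (hd : 0 < d) (i : Fin N) :
    Derivation ℂ (regularFunctions (basicOpen (zeroLocus Q) F))
      (cone (basicOpen (zeroLocus Q) F) → ℂ) :=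
  Derivation.mk'
    { toFun := fun a v => normGrad Q a v i
      map_add' := fun a b => by
        funext v
        obtain ⟨ξ, hξ⟩ := exists_hasGrad a v
        obtain ⟨η, hη⟩ := exists_hasGrad b v
        rw [Pi.add_apply, normGrad_eq hQ hF hd hξ, normGrad_eq hQ hF hd hη,
          normGrad_eq hQ hF hd (a := a + b) (hξ.add hη), map_add]
        rfl
      map_smul' := fun c a => by
        funext v
        obtain ⟨ξ, hξ⟩ := exists_hasGrad a v
        have h := (hasGrad_const c v).mul hξ
        rw [smul_zero, add_zero] at h
        rw [Pi.smul_apply, normGrad_eq hQ hF hd hξ, normGrad_eq hQ hF hd (a := c • a) h, map_smul]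
        rfl }
    (fun a b => by
      funext v
      obtain ⟨ξ, hξ⟩ := exists_hasGrad a v
      obtain ⟨η, hη⟩ := exists_hasGrad b v
      change normGrad Q (a * b) v i = a.1 v * normGrad Q b v i + b.1 v * normGrad Q a v i
      rw [normGrad_eq hQ hF hd hξ, normGrad_eq hQ hF hd hη,
        normGrad_eq hQ hF hd (a := a * b) (hξ.mul hη), map_add, map_smul, map_smul]
      rfl)

/-- The normalized gradient of a differential form at a point. -/
def formGrad {Q F : MvPolynomial (Fin N) ℂ} {e d : ℕ} (hQ : IsSmoothHypersurface Q e)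
    (hF : F.IsHomogeneous d) (hd : 0 < d) (v : cone (basicOpen (zeroLocus Q) F))
    (ω : Ω[regularFunctions (basicOpen (zeroLocus Q) F)⁄ℂ]) : Fin N → ℂ :=
  fun i => (gradDerivation hQ hF hd i).liftKaehlerDifferential ω v

section formGrad

variable {Q F : MvPolynomial (Fin N) ℂ} {e d : ℕ} (hQ : IsSmoothHypersurface Q e)
  (hF : F.IsHomogeneous d) (hd : 0 < d) (v : cone (basicOpen (zeroLocus Q) F))

lemma formGrad_add (ω η : Ω[regularFunctions (basicOpen (zeroLocus Q) F)⁄ℂ]) :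
    formGrad hQ hF hd v (ω + η) = formGrad hQ hF hd v ω + formGrad hQ hF hd v η := by
  funext i; simp [formGrad]

lemma formGrad_smul (a : regularFunctions (basicOpen (zeroLocus Q) F))
    (ω : Ω[regularFunctions (basicOpen (zeroLocus Q) F)⁄ℂ]) :
    formGrad hQ hF hd v (a • ω) = a.1 v • formGrad hQ hF hd v ω := by
  funext i
  change (gradDerivation hQ hF hd i).liftKaehlerDifferential (a • ω) v = _
  rw [map_smul]
  rfl

lemma formGrad_D (a : regularFunctions (basicOpen (zeroLocus Q) F)) :
    formGrad hQ hF hd v (KaehlerDifferential.D ℂ _ a) = normGrad Q a v := by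
  funext i
  rw [formGrad, Derivation.liftKaehlerDifferential_comp_D]
  rfl

end formGrad

/-- The determinant with first two rows `x` and `y`, as a form in the remaining rows. -/
def borderedDet (x y : Fin (n + 2) → ℂ) : (Fin (n + 2) → ℂ) [⋀^Fin n]→ₗ[ℂ] ℂ :=
  ((Matrix.detRowAlternating (R := ℂ) (n := Fin (n + 2))).curryLeft x).curryLeft y

lemma borderedDet_apply (x y : Fin (n + 2) → ℂ) (ξ : Fin n → Fin (n + 2) → ℂ) :
    borderedDet x y ξ = Matrix.det (Matrix.of (Matrix.vecCons x (Matrix.vecCons y ξ))) := rfl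

lemma borderedDet_add_smul (x y : Fin (n + 2) → ℂ) (ξ : Fin n → Fin (n + 2) → ℂ) (c : Fin n → ℂ) :
    borderedDet x y (fun j => ξ j + c j • x) = borderedDet x y ξ := by
  rw [borderedDet_apply, borderedDet_apply]
  refine Matrix.det_eq_of_forall_row_eq_smul_add_const
    (Matrix.vecCons 0 (Matrix.vecCons 0 c)) 0 rfl fun i j => ?_
  refine Fin.cases ?_ (fun i => Fin.cases ?_ (fun i => ?_) i) i
  · simp
  · simp
  · simp

lemma borderedDet_projAlong (x y : Fin (n + 2) → ℂ) (ξ : Fin n → Fin (n + 2) → ℂ) :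
    borderedDet x y (fun j => projAlong x (ξ j)) = borderedDet x y ξ := by
  rw [← borderedDet_add_smul x y ξ fun j => -(ξ j ⬝ᵥ dualVec x)]
  congr 1
  funext j
  rw [projAlong_apply, neg_smul, sub_eq_add_neg]

lemma borderedDet_eq_zero_iff (x y : Fin (n + 2) → ℂ) (ξ : Fin n → Fin (n + 2) → ℂ) :
    borderedDet x y ξ = 0 ↔ ∃ u ≠ 0, x ⬝ᵥ u = 0 ∧ y ⬝ᵥ u = 0 ∧ ∀ j, ξ j ⬝ᵥ u = 0 := by
  rw [borderedDet_apply, ← Matrix.exists_mulVec_eq_zero_iff]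
  refine exists_congr fun u => and_congr_right fun _ => ?_
  rw [funext_iff, Fin.forall_fin_succ, Fin.forall_fin_succ]
  rfl

/-- If `x` and all `ξ j` annihilate `v ≠ 0`, then the determinant with rows `x, y, ξ` depends only
on the value of `y` at `v`. -/
lemma borderedDet_eq_of_dotProduct_eq {x y z v : Fin (n + 2) → ℂ} {ξ : Fin n → Fin (n + 2) → ℂ}
    (hv : v ≠ 0) (hx : x ⬝ᵥ v = 0) (hξ : ∀ j, ξ j ⬝ᵥ v = 0) (hyz : y ⬝ᵥ v = z ⬝ᵥ v) :
    borderedDet x y ξ = borderedDet x z ξ := by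
  have h : borderedDet x (y - z) ξ = 0 :=
    (borderedDet_eq_zero_iff _ _ _).2 ⟨v, hv, hx, by rw [sub_dotProduct, hyz, sub_self], hξ⟩
  rw [← sub_eq_zero, ← h, borderedDet, borderedDet, borderedDet, map_sub]
  rfl

lemma borderedDet_smul (c : ℂ) (x y : Fin (n + 2) → ℂ) (ξ : Fin n → Fin (n + 2) → ℂ) :
    borderedDet x (c • y) ξ = c * borderedDet x y ξ := by
  rw [borderedDet, map_smul]
  rfl

section Residue

variable {Q F : MvPolynomial (Fin (n + 2)) ℂ} {e d : ℕ} (hQ : IsSmoothHypersurface Q e)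
  (hF : F.IsHomogeneous d) (hd : 0 < d)

/-- The alternating map underlying the residue map.  At a point `v` of the cone, the value `s` at
`da_1, …, da_n` is determined by
`dQ ∧ da_1 ∧ ⋯ ∧ da_n = s • (contraction of the volume form with the Euler field)`; it is computed
by wedging with a covector whose value at `v` is one. -/
def residueAlternating : Ω[regularFunctions (basicOpen (zeroLocus Q) F)⁄ℂ]
    [⋀^Fin n]→ₗ[regularFunctions (basicOpen (zeroLocus Q) F)]
      (cone (basicOpen (zeroLocus Q) F) → ℂ) where
  toFun ω v := borderedDet (gradAt Q v.1) (dualVec v.1) fun j => formGrad hQ hF hd v (ω j)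
  map_update_add' ω j x y := by
    funext v
    have h : ∀ z, (fun i => formGrad hQ hF hd v (Function.update ω j z i)) =
        Function.update (fun i => formGrad hQ hF hd v (ω i)) j (formGrad hQ hF hd v z) := by
      intro z
      funext i
      by_cases hi : i = j
      · subst hi; simp
      · simp [Function.update_of_ne hi]
    rw [Pi.add_apply, h, h, h, formGrad_add, AlternatingMap.map_update_add]
  map_update_smul' ω j a x := by
    funext v
    have h : ∀ z, (fun i => formGrad hQ hF hd v (Function.update ω j z i)) =
        Function.update (fun i => formGrad hQ hF hd v (ω i)) j (formGrad hQ hF hd v z) := by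
      intro z
      funext i
      by_cases hi : i = j
      · subst hi; simp
      · simp [Function.update_of_ne hi]
    change _ = a.1 v * _
    beta_reduce
    rw [h, h, formGrad_smul, AlternatingMap.map_update_smul, smul_eq_mul]
  map_eq_zero_of_eq' ω i j hij hne := by
    funext v
    exact AlternatingMap.map_eq_zero_of_eq _ _ (by rw [hij]) hne

/-- The residue map, with values in functions on the cone. -/
def residue : TopForms n (basicOpen (zeroLocus Q) F)
    →ₗ[regularFunctions (basicOpen (zeroLocus Q) F)] (cone (basicOpen (zeroLocus Q) F) → ℂ) :=
  exteriorPower.alternatingMapLinearEquiv (residueAlternating hQ hF hd)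

lemma residue_ιMulti (ω : Fin n → Ω[regularFunctions (basicOpen (zeroLocus Q) F)⁄ℂ])
    (v : cone (basicOpen (zeroLocus Q) F)) :
    residue hQ hF hd (exteriorPower.ιMulti _ n ω) v =
      borderedDet (gradAt Q v.1) (dualVec v.1) fun j => formGrad hQ hF hd v (ω j) := by
  rw [residue, exteriorPower.alternatingMapLinearEquiv_apply_ιMulti]
  rfl

/-- The value of the residue map in terms of arbitrary gradients and an arbitrary covector. -/
lemma residue_wedgeD {a : Fin n → regularFunctions (basicOpen (zeroLocus Q) F)}
    {v : cone (basicOpen (zeroLocus Q) F)} {ξ : Fin n → Fin (n + 2) → ℂ}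
    (hξ : ∀ j, HasGrad (a j).1 v (ξ j)) (y : Fin (n + 2) → ℂ) :
    (y ⬝ᵥ v.1) * residue hQ hF hd (wedgeD a) v = borderedDet (gradAt Q v.1) y ξ := by
  obtain ⟨hv, hQv, -⟩ := (mem_cone_basicOpen hQ.homog hF).1 v.2
  rw [wedgeD, residue_ιMulti]
  simp only [formGrad_D, normGrad_eq hQ hF hd (hξ _)]
  rw [borderedDet_projAlong, ← borderedDet_smul]
  refine borderedDet_eq_of_dotProduct_eq hv ?_ (fun j => (hξ j).dotProduct_self) ?_
  · rw [gradAt_dotProduct_self hQ.homog, hQv, mul_zero]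
  · rw [smul_dotProduct, dotProduct_comm (dualVec _), dotProduct_dualVec hv, smul_eq_mul, mul_one]

/-- The residue map commutes with restriction. -/
lemma residue_restrict {G : MvPolynomial (Fin (n + 2)) ℂ} {d' : ℕ} (hG : G.IsHomogeneous d')
    (hd' : 0 < d') (h : basicOpen (zeroLocus Q) G ⊆ basicOpen (zeroLocus Q) F)
    (a : Fin n → regularFunctions (basicOpen (zeroLocus Q) F))
    (v : cone (basicOpen (zeroLocus Q) G)) :
    residue hQ hF hd (wedgeD a) (Set.inclusion (cone_mono h) v) =
      residue hQ hG hd' (wedgeD fun i => resRegular h (a i)) v := by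
  obtain ⟨hv, hQv, -⟩ := (mem_cone_basicOpen hQ.homog hG).1 v.2
  choose ξ hξ using fun j => exists_hasGrad (a j) (Set.inclusion (cone_mono h) v)
  have h1 := residue_wedgeD hQ hF hd hξ (dualVec v.1)
  have h2 := residue_wedgeD hQ hG hd' (v := v) (a := fun i => resRegular h (a i))
    (fun j => (hξ j).restrict h) (dualVec v.1)
  rw [dotProduct_comm, show v.1 ⬝ᵥ dualVec v.1 = 1 from dotProduct_dualVec hv, one_mul] at h2
  rw [show (Set.inclusion (cone_mono h) v).1 = v.1 from rfl, dotProduct_comm,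
    dotProduct_dualVec hv, one_mul] at h1
  rw [h1, h2]

end Residue

end

section

open MvPolynomial

variable {N n : ℕ}

/-! ### Residues are sections of a twisting sheaf -/

lemma isHomogeneous_det {M : Matrix (Fin N) (Fin N) (MvPolynomial (Fin N) ℂ)} {g : Fin N → ℕ}
    (h : ∀ i j, (M i j).IsHomogeneous (g i)) : M.det.IsHomogeneous (∑ i, g i) := by
  rw [Matrix.det_apply]
  refine IsHomogeneous.sum _ _ _ fun σ _ => ?_
  have h1 := IsHomogeneous.prod Finset.univ (fun i => M (σ i) i) (fun i => g (σ i))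
    fun i _ => h _ _
  rw [Equiv.sum_comp σ g] at h1
  rcases Int.units_eq_one_or (Equiv.Perm.sign σ) with h2 | h2
  · rw [h2, one_smul]; exact h1
  · rw [h2, Units.neg_smul, one_smul]; exact h1.neg

section Residue

variable {Q F : MvPolynomial (Fin (n + 2)) ℂ} {e d : ℕ} (hQ : IsSmoothHypersurface Q e)
  (hF : F.IsHomogeneous d) (hd : 0 < d)

/-- The residue of `da_1 ∧ ⋯ ∧ da_n` is a section of `𝒪(e - n - 1)`: where `x_j ≠ 0` it is a
determinant of polynomials divided by `x_j` and by the squares of the denominators of the `a_i`. -/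
lemma isLocallyFraction_residue_wedgeD
    (a : Fin n → regularFunctions (basicOpen (zeroLocus Q) F)) :
    IsLocallyFraction (basicOpen (zeroLocus Q) F) (e - n - 1) (residue hQ hF hd (wedgeD a)) := by
  intro v
  obtain ⟨hv, -, -⟩ := (mem_cone_basicOpen hQ.homog hF).1 v.2
  obtain ⟨j, hj⟩ := Function.ne_iff.1 hv
  rw [Pi.zero_apply] at hj
  choose b b' P₀ R₀ hP₀ hR₀ hb hv₀ h₀ using fun i => (a i).2 v
  obtain rfl : b = b' := funext fun i => by have := hb i; omega
  -- extra factors `x_j` make all degrees positive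
  set P := fun i => P₀ i * X j with hPdef
  set R := fun i => R₀ i * X j with hRdef
  have hP : ∀ i, (P i).IsHomogeneous (b i + 1) := fun i => (hP₀ i).mul (isHomogeneous_X ℂ j)
  have hR : ∀ i, (R i).IsHomogeneous (b i + 1) := fun i => (hR₀ i).mul (isHomogeneous_X ℂ j)
  have h : ∀ i (w : cone (basicOpen (zeroLocus Q) F)), eval w.1 (R i) ≠ 0 →
      (a i).1 w = eval w.1 (P i) / eval w.1 (R i) := by
    intro i w hw
    simp only [hRdef, map_mul] at hw
    rw [h₀ i w (left_ne_zero_of_mul hw)]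
    simp only [hRdef, hPdef, map_mul]
    rw [mul_div_mul_right _ _ (right_ne_zero_of_mul hw)]
  let num : Fin n → Fin (n + 2) → MvPolynomial (Fin (n + 2)) ℂ := fun i l =>
    R i * pderiv l (P i) - P i * pderiv l (R i)
  let M : Matrix (Fin (n + 2)) (Fin (n + 2)) (MvPolynomial (Fin (n + 2)) ℂ) :=
    Matrix.of (Matrix.vecCons (fun l => pderiv l Q) (Matrix.vecCons (Pi.single j 1) num))
  refine ⟨e + (0 + ∑ i, (2 * b i + 1)), 1 + ∑ i, (b i + 1) * 2, M.det, X j * ∏ i, R i ^ 2,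
    ?_, ?_, ?_, ?_, ?_⟩
  · have := isHomogeneous_det (M := M)
      (g := Matrix.vecCons e (Matrix.vecCons 0 fun i => 2 * b i + 1)) (fun i l => by
        refine Fin.cases ?_ (fun i => Fin.cases ?_ (fun i => ?_) i) i
        · exact hQ.homog.pderiv
        · change IsHomogeneous (Pi.single (M := fun _ => MvPolynomial (Fin (n + 2)) ℂ) j 1 l) 0
          by_cases hl : l = j
          · subst hl; rw [Pi.single_eq_same]; exact isHomogeneous_one _ _
          · rw [Pi.single_eq_of_ne hl]; exact isHomogeneous_zero _ _ _
        · refine IsHomogeneous.sub ?_ ?_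
          · have := (hR i).mul ((hP i).pderiv (i := l))
            rw [show b i + 1 + (b i + 1 - 1) = 2 * b i + 1 by omega] at this
            exact this
          · have := (hP i).mul ((hR i).pderiv (i := l))
            rw [show b i + 1 + (b i + 1 - 1) = 2 * b i + 1 by omega] at this
            exact this)
    rw [Fin.sum_univ_succ, Fin.sum_univ_succ] at this
    exact this
  · exact (isHomogeneous_X ℂ j).mul (IsHomogeneous.prod _ _ _ fun i _ => (hR i).pow 2)
  · push_cast
    rw [Finset.sum_add_distrib, ← Finset.sum_mul, Finset.sum_add_distrib, ← Finset.mul_sum]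
    simp
    ring
  · rw [map_mul, map_prod, eval_X]
    refine mul_ne_zero hj (Finset.prod_ne_zero_iff.2 fun i _ => ?_)
    simp only [hRdef, map_pow, map_mul, eval_X]
    exact pow_ne_zero _ (mul_ne_zero (hv₀ i) hj)
  · intro w hw
    rw [map_mul, map_prod, eval_X] at hw
    have hwj := left_ne_zero_of_mul hw
    have hwR : ∀ i, eval w.1 (R i) ≠ 0 := fun i hi => by
      refine Finset.prod_ne_zero_iff.1 (right_ne_zero_of_mul hw) i (Finset.mem_univ i) ?_
      rw [map_pow, hi]; simp
    have hgrad : ∀ i, HasGrad (a i).1 w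
        ((eval w.1 (R i) ^ 2)⁻¹ • fun l => eval w.1 (num i l)) := by
      intro i
      refine ⟨b i + 1, P i, R i, hP i, hR i, hwR i, h i, ?_⟩
      rw [h i w (hwR i)]
      funext l
      have := hwR i
      simp only [Pi.smul_apply, Pi.sub_apply, smul_eq_mul, gradAt, num, map_sub, map_mul]
      field_simp
    have key := residue_wedgeD hQ hF hd hgrad (Pi.single j 1)
    rw [single_one_dotProduct] at key
    rw [map_mul, map_prod, eval_X, eq_div_iff hw, ← mul_assoc, mul_comm (residue _ _ _ _ _), key]
    have hsmul := (borderedDet (gradAt Q w.1) (Pi.single j 1)).toMultilinearMap.map_smul_univ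
      (fun i => (eval w.1 (R i) ^ 2)⁻¹) (fun i l => eval w.1 (num i l))
    change borderedDet _ _ (fun i => (eval w.1 (R i) ^ 2)⁻¹ • fun l => eval w.1 (num i l)) = _ at hsmul
    rw [hsmul, smul_eq_mul, mul_right_comm, ← Finset.prod_mul_distrib, Finset.prod_eq_one, one_mul]
    · rw [RingHom.map_det]
      change Matrix.det _ = _
      congr 1
      ext i l
      refine Fin.cases ?_ (fun i => Fin.cases ?_ (fun i => ?_) i) i
      · rfl
      · change Pi.single (M := fun _ => ℂ) j 1 l =
          eval w.1 (Pi.single (M := fun _ => MvPolynomial (Fin (n + 2)) ℂ) j 1 l)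
        by_cases hl : l = j
        · subst hl; simp
        · simp [Pi.single_eq_of_ne hl]
      · rfl
    · intro i _
      rw [map_pow]
      exact inv_mul_cancel₀ (pow_ne_zero _ (hwR i))

set_option synthInstance.maxHeartbeats 400000 in
instance (n : ℕ) (U : Set (PSpace N)) : Module (regularFunctions U) (TopForms n U) :=
  inferInstance

instance (n : ℕ) (U : Set (PSpace N)) : SMul (regularFunctions U) (TopForms n U) :=
  Module.toDistribMulAction.toSMul

lemma span_wedgeD (n : ℕ) (U : Set (PSpace N)) :
    Submodule.span (regularFunctions U) (Set.range (wedgeD (n := n) (U := U))) = ⊤ := by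
  rw [← exteriorPower.ιMulti_span_of_span (regularFunctions U) n _
    (KaehlerDifferential.span_range_derivation ℂ (regularFunctions U))]
  congr 1
  ext x
  constructor
  · rintro ⟨a, rfl⟩
    refine ⟨fun i => KaehlerDifferential.D ℂ (regularFunctions U) (a i), ?_, rfl⟩
    rintro _ ⟨i, rfl⟩
    exact ⟨a i, rfl⟩
  · rintro ⟨ω, hω, rfl⟩
    choose a ha using fun i => hω (Set.mem_range_self i)
    exact ⟨a, congrArg _ (funext ha)⟩

lemma isLocallyFraction_residue (x : TopForms n (basicOpen (zeroLocus Q) F)) :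
    IsLocallyFraction (basicOpen (zeroLocus Q) F) (e - n - 1) (residue hQ hF hd x) := by
  have hx : x ∈ Submodule.span (regularFunctions (basicOpen (zeroLocus Q) F))
      (Set.range wedgeD) := by rw [span_wedgeD]; trivial
  induction hx using Submodule.span_induction with
  | mem x hx =>
    obtain ⟨a, rfl⟩ := hx
    exact isLocallyFraction_residue_wedgeD hQ hF hd a
  | zero => rw [map_zero]; exact isLocallyFraction_zero _ _
  | add x y _ _ hx hy => rw [map_add]; exact hx.add hy
  | smul a x _ hx =>
    rw [map_smul]
    have := IsLocallyFraction.mul a.2 hx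
    rw [zero_add] at this
    exact this

/-- The residue map from top forms to sections of `𝒪(e - n - 1)`. -/
def residueSection : TopForms n (basicOpen (zeroLocus Q) F)
    →ₗ[regularFunctions (basicOpen (zeroLocus Q) F)]
      twistedSections (basicOpen (zeroLocus Q) F) (e - n - 1) where
  toFun x := ⟨residue hQ hF hd x, isLocallyFraction_residue hQ hF hd x⟩
  map_add' x y := Subtype.ext (map_add _ x y)
  map_smul' a x := Subtype.ext (map_smul (residue hQ hF hd) a x)

end Residue

end

section

open MvPolynomial

variable {N n : ℕ}

/-! ### Ideals of the ring of regular functions -/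

lemma homogeneousComponent_mul_of_isHomogeneous (L : MvPolynomial (Fin N) ℂ)
    {G : MvPolynomial (Fin N) ℂ} {m : ℕ} (hG : G.IsHomogeneous m) (k : ℕ) :
    homogeneousComponent k (L * G) = if m ≤ k then homogeneousComponent (k - m) L * G else 0 := by
  conv_lhs => rw [← sum_homogeneousComponent L, Finset.sum_mul, map_sum]
  have h : ∀ i, homogeneousComponent k (homogeneousComponent i L * G) =
      if i + m = k then homogeneousComponent i L * G else 0 := fun i =>
    (homogeneousComponent_of_mem ((homogeneousComponent_isHomogeneous i L).mul hG)).trans (by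
      simp only [eq_comm])
  simp only [h]
  split_ifs with hk
  · rw [Finset.sum_eq_single (k - m)]
    · rw [if_pos (by omega)]
    · intro i _ hi; rw [if_neg (by omega)]
    · intro hi
      rw [homogeneousComponent_eq_zero _ _ (by rw [Finset.mem_range] at hi; omega)]
      simp
  · exact Finset.sum_eq_zero fun i _ => if_neg (by omega)

/-- The regular function `P / F ^ m` on `F ≠ 0`. -/
def fracRegular {Q F P : MvPolynomial (Fin N) ℂ} {e d m : ℕ} (hQ : Q.IsHomogeneous e)
    (hF : F.IsHomogeneous d) (hP : P.IsHomogeneous (m * d)) :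
    regularFunctions (basicOpen (zeroLocus Q) F) :=
  ⟨fun w => eval w.1 P / eval w.1 F ^ m, isLocallyFraction_div_pow hQ hF hP (by push_cast; ring)⟩

lemma exists_eq_fracRegular {Q F : MvPolynomial (Fin N) ℂ} {e d : ℕ} (hQ : Q.IsHomogeneous e)
    (hF : F.IsHomogeneous d) (hd : 0 < d) (a : regularFunctions (basicOpen (zeroLocus Q) F)) :
    ∃ (m : ℕ) (P : MvPolynomial (Fin N) ℂ) (hP : P.IsHomogeneous (m * d)),
      a = fracRegular hQ hF hP := by
  obtain ⟨m, hm⟩ := exists_eq_div_pow hQ hF hd a.2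
  obtain ⟨b, P, hP, hb, h⟩ := hm m le_rfl
  obtain rfl : b = m * d := by zify; rw [hb, add_zero]
  exact ⟨m, P, hP, Subtype.ext (funext h)⟩

/-- The weak Nullstellensatz for the ring of regular functions on `F ≠ 0`. -/
lemma ideal_eq_top_of_forall_exists {Q F : MvPolynomial (Fin N) ℂ} {e d : ℕ}
    (hQ : Q.IsHomogeneous e) (hF : F.IsHomogeneous d) (hd : 0 < d)
    {I : Ideal (regularFunctions (basicOpen (zeroLocus Q) F))}
    (h : ∀ v, ∃ g ∈ I, g.1 v ≠ 0) : I = ⊤ := by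
  -- the part of `P` of degree `m d`, divided by `F ^ m`
  let fr : ℕ → MvPolynomial (Fin N) ℂ → regularFunctions (basicOpen (zeroLocus Q) F) := fun m P =>
    fracRegular hQ hF (homogeneousComponent_isHomogeneous (m * d) P)
  have fr_add : ∀ m P P', fr m (P + P') = fr m P + fr m P' := fun m P P' =>
    Subtype.ext (funext fun w => by
      change eval w.1 _ / _ = eval w.1 _ / _ + eval w.1 _ / _
      rw [map_add, map_add, add_div])
  have fr_zero : ∀ m, fr m 0 = 0 := fun m => Subtype.ext (funext fun w => by
    change eval w.1 _ / _ = 0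
    rw [map_zero, map_zero, zero_div])
  let J : Ideal (MvPolynomial (Fin N) ℂ) :=
    { carrier := {G | ∀ L m, fr m (L * G) ∈ I}
      add_mem' := fun {G G'} hG hG' L m => by
        rw [mul_add, fr_add]; exact I.add_mem (hG L m) (hG' L m)
      zero_mem' := fun L m => by rw [mul_zero, fr_zero]; exact I.zero_mem
      smul_mem' := fun K G hG L m => by
        rw [smul_eq_mul, ← mul_assoc]; exact hG _ m }
  have hQJ : Q ∈ J := fun L m => by
    have : fr m (L * Q) = 0 := Subtype.ext (funext fun w => by
      change eval w.1 (homogeneousComponent _ (L * Q)) / _ = 0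
      rw [homogeneousComponent_mul_of_isHomogeneous L hQ]
      split_ifs
      · rw [map_mul, ((mem_cone_basicOpen hQ hF).1 w.2).2.1, mul_zero, zero_div]
      · rw [map_zero, zero_div])
    rw [this]; exact I.zero_mem
  have hrad : F ∈ J.radical := by
    rw [← vanishingIdeal_zeroLocus_eq_radical (K := ℂ), mem_vanishingIdeal_iff]
    intro x hx
    rw [mem_zeroLocus_iff] at hx
    rw [aeval_eq_eval]
    by_contra hFx
    have hx0 : x ≠ 0 := by
      rintro rfl
      exact hFx (eval_zero_of_isHomogeneous hF hd)
    have hQx : eval x Q = 0 := by simpa [aeval_eq_eval] using hx Q hQJ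
    obtain ⟨g, hgI, hg⟩ := h ⟨x, (mem_cone_basicOpen hQ hF).2 ⟨hx0, hQx, hFx⟩⟩
    obtain ⟨m, G, hG, rfl⟩ := exists_eq_fracRegular hQ hF hd g
    have hGJ : G ∈ J := by
      intro L M
      by_cases hM : m * d ≤ M * d
      · have : fr M (L * G) = fr (M - m) L * fracRegular hQ hF hG :=
          Subtype.ext (funext fun w => by
            have hFw := ((mem_cone_basicOpen hQ hF).1 w.2).2.2
            change eval w.1 (homogeneousComponent _ (L * G)) / _ =
              eval w.1 (homogeneousComponent _ L) / _ * (eval w.1 G / _)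
            rw [homogeneousComponent_mul_of_isHomogeneous L hG, if_pos hM, map_mul,
              div_mul_div_comm, ← pow_add, ← Nat.sub_mul,
              Nat.sub_add_cancel (Nat.le_of_mul_le_mul_right hM hd)])
        rw [this]
        exact I.mul_mem_left _ hgI
      · have : fr M (L * G) = 0 := Subtype.ext (funext fun w => by
          change eval w.1 (homogeneousComponent _ (L * G)) / _ = 0
          rw [homogeneousComponent_mul_of_isHomogeneous L hG, if_neg hM, map_zero, zero_div])
        rw [this]; exact I.zero_mem
    refine hg ?_
    have h2 := hx G hGJ
    rw [aeval_eq_eval] at h2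
    change eval x G / _ = 0
    rw [h2, zero_div]
  obtain ⟨m, hm⟩ := hrad
  rw [Ideal.eq_top_iff_one]
  have : fr m (1 * F ^ m) = 1 := Subtype.ext (funext fun w => by
    have hFw := ((mem_cone_basicOpen hQ hF).1 w.2).2.2
    have hFm : (F ^ m).IsHomogeneous (m * d) := by
      rw [mul_comm]; exact hF.pow m
    change eval w.1 (homogeneousComponent _ (1 * F ^ m)) / _ = 1
    rw [one_mul, homogeneousComponent_eq_self hFm, map_pow, div_self (pow_ne_zero _ hFw)])
  rw [← this]
  exact hm 1 m

/-! ### Generators of modules after localization -/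

section Algebra

variable {A Ω' : Type*} [CommRing A] [AddCommGroup Ω'] [Module A Ω']

/-- If `n` elements span a module after inverting `g`, their exterior product spans the top exterior
power after inverting `g`. -/
lemma exists_pow_smul_eq_smul_ιMulti {g : A} {t : Fin n → Ω'}
    (h : ∀ ω, ∃ M : ℕ, g ^ M • ω ∈ Submodule.span A (Set.range t)) (x : ⋀[A]^n Ω') :
    ∃ (M : ℕ) (f : A), g ^ M • x = f • exteriorPower.ιMulti A n t := by
  have hx : x ∈ Submodule.span A (Set.range (exteriorPower.ιMulti A n (M := Ω'))) := by
    rw [exteriorPower.ιMulti_span]; trivial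
  induction hx using Submodule.span_induction with
  | mem x hx =>
    obtain ⟨ω, rfl⟩ := hx
    choose M hM using fun i => h (ω i)
    choose c hc using fun i => Submodule.mem_span_range_iff_exists_fun A |>.1 (hM i)
    let L : (Fin n → A) →ₗ[A] Ω' := Fintype.linearCombination A t
    let φ := (exteriorPower.ιMulti A n (M := Ω')).compLinearMap L
    let ψ : (Fin n → A) [⋀^Fin n]→ₗ[A] (⋀[A]^n Ω') :=
      (LinearMap.toSpanSingleton A _ (exteriorPower.ιMulti A n t)).compAlternatingMap
        Matrix.detRowAlternating
    have hφψ : φ = ψ := by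
      refine Module.Basis.ext_alternating (Pi.basisFun A (Fin n)) fun v hv => ?_
      let σ : Equiv.Perm (Fin n) := Equiv.ofBijective v (Finite.injective_iff_bijective.1 hv)
      have e : (fun i => Pi.basisFun A (Fin n) (v i)) = (Pi.basisFun A (Fin n)) ∘ σ := rfl
      rw [e, AlternatingMap.map_perm, AlternatingMap.map_perm]
      congr 1
      have h1 : φ (Pi.basisFun A (Fin n)) = exteriorPower.ιMulti A n t := by
        change exteriorPower.ιMulti A n (fun i => L (Pi.basisFun A (Fin n) i)) = _
        congr 1
        funext i
        simp [L, Fintype.linearCombination_apply_single]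
      have h2 : Matrix.detRowAlternating (Pi.basisFun A (Fin n)) = (1 : A) := by
        have h : Matrix.of (fun i => Pi.basisFun A (Fin n) i) = 1 := by
          ext i j
          simp [Matrix.one_apply, Pi.single_apply, eq_comm]
        change Matrix.det (Matrix.of fun i => Pi.basisFun A (Fin n) i) = _
        rw [h, Matrix.det_one]
      rw [h1]
      change _ = Matrix.detRowAlternating (Pi.basisFun A (Fin n)) • exteriorPower.ιMulti A n t
      rw [h2, one_smul]
    refine ⟨∑ i, M i, Matrix.det (Matrix.of c), ?_⟩
    have h3 := (exteriorPower.ιMulti A n (M := Ω')).toMultilinearMap.map_smul_univ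
      (fun i => g ^ M i) ω
    rw [Finset.prod_pow_eq_pow_sum] at h3
    refine Eq.trans h3.symm ?_
    have h4 : (fun i => g ^ M i • ω i) = fun i => L (c i) := by
      funext i
      rw [← hc i, Fintype.linearCombination_apply]
    rw [h4]
    exact DFunLike.congr_fun hφψ c
  | zero => exact ⟨0, 0, by simp⟩
  | add x y _ _ hx hy =>
    obtain ⟨M, f, hf⟩ := hx
    obtain ⟨M', f', hf'⟩ := hy
    refine ⟨M + M', g ^ M' * f + g ^ M * f', ?_⟩
    rw [smul_add, pow_add, mul_comm (g ^ M), mul_smul, hf, mul_comm, mul_smul, hf', add_smul,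
      mul_smul, mul_smul]
  | smul a x _ hx =>
    obtain ⟨M, f, hf⟩ := hx
    exact ⟨M, a * f, by rw [smul_comm, hf, mul_smul]⟩

/-- Two linear relations among generators allow to eliminate two of them, after multiplication by
a minor. -/
lemma minor_smul_mem_span {ι : Type*} [Fintype ι] {ω : ι → Ω'} {r s : ι → A}
    (hr : ∑ i, r i • ω i = 0) (hs : ∑ i, s i • ω i = 0) {a b : ι} (hab : a ≠ b) {x : Ω'}
    (hx : x ∈ Submodule.span A (Set.range ω)) :
    (r a * s b - r b * s a) • x ∈ Submodule.span A (ω '' {i | i ≠ a ∧ i ≠ b}) := by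
  classical
  set S := Submodule.span A (ω '' {i | i ≠ a ∧ i ≠ b}) with hS
  have key : ∀ r : ι → A, ∑ i, r i • ω i = 0 → r a • ω a + r b • ω b ∈ S := by
    intro r hr
    rw [← Finset.sum_add_sum_compl {a, b}, Finset.sum_pair hab] at hr
    rw [eq_neg_of_add_eq_zero_left hr]
    refine S.neg_mem (S.sum_mem fun i hi => S.smul_mem _ (Submodule.subset_span ⟨i, ?_, rfl⟩))
    simpa using hi
  have h1 := key r hr
  have h2 := key s hs
  induction hx using Submodule.span_induction with
  | mem x hx =>
    obtain ⟨i, rfl⟩ := hx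
    by_cases hia : i = a
    · subst hia
      have := S.sub_mem (S.smul_mem (s b) h1) (S.smul_mem (r b) h2)
      convert this using 1
      module
    · by_cases hib : i = b
      · subst hib
        have := S.sub_mem (S.smul_mem (r a) h2) (S.smul_mem (s a) h1)
        convert this using 1
        module
      · exact S.smul_mem _ (Submodule.subset_span ⟨i, ⟨hia, hib⟩, rfl⟩)
  | zero => rw [smul_zero]; exact S.zero_mem
  | add x y _ _ hx hy => rw [smul_add]; exact S.add_mem hx hy
  | smul c x _ hx => rw [smul_comm]; exact S.smul_mem _ hx

/-- The chain rule for polynomials in elements of an algebra. -/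
lemma derivation_aeval [Algebra ℂ A] [Module ℂ Ω'] [IsScalarTower ℂ A Ω'] (D : Derivation ℂ A Ω')
    (y : Fin N → A) (P : MvPolynomial (Fin N) ℂ) :
    D (aeval y P) = ∑ i, aeval y (pderiv i P) • D (y i) := by
  induction P using MvPolynomial.induction_on with
  | C c =>
    rw [← algebraMap_eq, AlgHom.commutes, Derivation.map_algebraMap]
    simp
  | add P P' hP hP' =>
    rw [map_add, map_add, hP, hP', ← Finset.sum_add_distrib]
    simp only [map_add, add_smul]
  | mul_X P j hP =>
    rw [map_mul, aeval_X, Derivation.leibniz, hP]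
    simp only [Derivation.leibniz, map_add, smul_eq_mul, map_mul, aeval_X, add_smul,
      Finset.sum_add_distrib, pderiv_X, mul_smul]
    congr 1
    · rw [Finset.sum_eq_single j]
      · simp
      · intro i _ hi
        simp [Pi.single_eq_of_ne (Ne.symm hi)]
      · simp
    · rw [Finset.smul_sum]

end Algebra

end

section

open MvPolynomial

variable {N n : ℕ}

/-! ### Local coordinates on a smooth hypersurface -/

lemma eval_coe_aeval {U : Set (PSpace N)} (y : Fin N → regularFunctions U)
    (P : MvPolynomial (Fin N) ℂ) (w : cone U) :
    (aeval y P : regularFunctions U).1 w = eval (fun i => (y i).1 w) P := by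
  have h := map_aeval y (((Pi.evalAlgHom ℂ (fun _ : cone U => ℂ) w).comp
    (regularFunctions U).val : regularFunctions U →ₐ[ℂ] ℂ) : regularFunctions U →+* ℂ) P
  refine h.trans ?_
  rw [coe_eval₂Hom]
  rfl

lemma exists_minor_ne_zero {ι : Type*} [Fintype ι] {r s y : ι → ℂ} (hr : r ≠ 0)
    (hry : r ⬝ᵥ y = 0) (hsy : s ⬝ᵥ y ≠ 0) : ∃ a b, r a * s b - r b * s a ≠ 0 := by
  by_contra! h
  refine hr (funext fun a => ?_)
  have : r a * (s ⬝ᵥ y) = s a * (r ⬝ᵥ y) := by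
    simp only [dotProduct, Finset.mul_sum]
    refine Finset.sum_congr rfl fun b _ => ?_
    linear_combination y b * h a b
  rw [hry, mul_zero] at this
  exact (mul_eq_zero.1 this).resolve_right hsy

lemma div_pow_mul_self {d : ℕ} (hd : 0 < d) (x : ℂ) {E : ℂ} (hE : E ≠ 0) :
    (x ^ (d - 1) / E) ^ d * E = (x ^ (d - 1) / E * x) ^ (d - 1) := by
  obtain ⟨d, rfl⟩ := Nat.exists_eq_succ_of_ne_zero hd.ne'
  rw [Nat.succ_eq_add_one, Nat.add_sub_cancel, div_mul_eq_mul_div, ← pow_succ, div_pow, div_pow,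
    ← pow_mul, ← pow_mul, pow_succ E, mul_comm (d + 1)]
  field_simp

section Algebra

variable {A Ω' : Type*} [CommRing A] [AddCommGroup Ω'] [Module A Ω']

lemma sum_sub_single_smul {ι : Type*} [Fintype ι] [DecidableEq ι] (f : ι → A) (j : ι) (c : A)
    (ω : ι → Ω') : ∑ i, (f i - Pi.single (M := fun _ => A) j c i) • ω i =
      ∑ i, f i • ω i - c • ω j := by
  simp only [sub_smul, Finset.sum_sub_distrib]
  congr 1
  rw [Finset.sum_eq_single j]
  · rw [Pi.single_eq_same]
  · intro i _ hi
    rw [Pi.single_eq_of_ne hi, zero_smul]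
  · simp

lemma exists_pow_smul_mem_of_span_eq_top {T : Submodule A Ω'} {g : A} {s : Set Ω'}
    (hs : Submodule.span A s = ⊤) (h : ∀ x ∈ s, ∃ M : ℕ, g ^ M • x ∈ T) (x : Ω') :
    ∃ M : ℕ, g ^ M • x ∈ T := by
  have hx : x ∈ Submodule.span A s := by rw [hs]; trivial
  induction hx using Submodule.span_induction with
  | mem x hx => exact h x hx
  | zero => exact ⟨0, by rw [smul_zero]; exact T.zero_mem⟩
  | add x y _ _ hx hy =>
    obtain ⟨M, hM⟩ := hx
    obtain ⟨M', hM'⟩ := hy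
    refine ⟨M + M', ?_⟩
    rw [smul_add]
    refine T.add_mem ?_ ?_
    · rw [pow_add, mul_comm, mul_smul]; exact T.smul_mem _ hM
    · rw [pow_add, mul_smul]; exact T.smul_mem _ hM'
  | smul a x _ hx =>
    obtain ⟨M, hM⟩ := hx
    exact ⟨M, by rw [smul_comm]; exact T.smul_mem _ hM⟩

/-- If `n + 2` elements generate a module after inverting `g`, two relations between them allow to
eliminate two of the generators after inverting a minor. -/
lemma exists_pow_smul_mem_span_minor {ω : Fin (n + 2) → Ω'} {r s : Fin (n + 2) → A} {g : A}
    (hω : ∀ x, ∃ M : ℕ, g ^ M • x ∈ Submodule.span A (Set.range ω))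
    (hr : ∑ i, r i • ω i = 0) (hs : ∑ i, s i • ω i = 0) {a b : Fin (n + 2)} (hab : a ≠ b) :
    ∃ τ : Fin n → Fin (n + 2), ∀ x, ∃ M : ℕ,
      (g * (r a * s b - r b * s a)) ^ M • x ∈ Submodule.span A (Set.range fun j => ω (τ j)) := by
  have hcard : Fintype.card {i // i ≠ a ∧ i ≠ b} = n := by
    rw [Fintype.card_subtype]
    have : (Finset.univ.filter fun i => i ≠ a ∧ i ≠ b) = ({a, b} : Finset (Fin (n + 2)))ᶜ := by
      ext i; simp
    rw [this, Finset.card_compl, Finset.card_pair hab]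
    simp
  let σ := Fintype.equivFinOfCardEq hcard
  have hrange : (Set.range fun j => ω (σ.symm j).1) = ω '' {i | i ≠ a ∧ i ≠ b} := by
    ext x
    constructor
    · rintro ⟨j, rfl⟩
      exact ⟨_, (σ.symm j).2, rfl⟩
    · rintro ⟨i, hi, rfl⟩
      exact ⟨σ ⟨i, hi⟩, by simp⟩
  refine ⟨fun j => (σ.symm j).1, fun x => ?_⟩
  obtain ⟨M, hM⟩ := hω x
  refine ⟨M + 1, ?_⟩
  have h := minor_smul_mem_span hr hs hab hM
  rw [hrange]
  have := Submodule.smul_mem _ (g * (r a * s b - r b * s a) ^ M) h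
  rw [smul_smul, smul_smul] at this
  convert this using 2
  rw [mul_pow]
  ring

end Algebra

section Coordinates

variable {Q F : MvPolynomial (Fin N) ℂ} {e d : ℕ} (hQ : Q.IsHomogeneous e)
  (hF : F.IsHomogeneous d) (hd : 0 < d)

/-- The regular functions `x_i x_j ^ (d - 1) / F` on `F ≠ 0`.  At points where `x_j ≠ 0` they are
multiples of the homogeneous coordinates. -/
def coordRegular (j i : Fin N) : regularFunctions (basicOpen (zeroLocus Q) F) :=
  fracRegular (P := X i * X j ^ (d - 1)) (m := 1) hQ hF (by
    have := (isHomogeneous_X ℂ i).mul ((isHomogeneous_X ℂ j).pow (d - 1))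
    rwa [show 1 + 1 * (d - 1) = 1 * d by omega] at this)

lemma coordRegular_apply (j i : Fin N) (w : cone (basicOpen (zeroLocus Q) F)) :
    (coordRegular hQ hF hd j i).1 w = w.1 j ^ (d - 1) / eval w.1 F * w.1 i := by
  change eval w.1 (X i * X j ^ (d - 1)) / eval w.1 F ^ 1 = _
  rw [map_mul, map_pow, eval_X, eval_X, pow_one]
  ring

lemma aeval_coordRegular (j : Fin N) {P : MvPolynomial (Fin N) ℂ} {b : ℕ} (hP : P.IsHomogeneous b)
    (w : cone (basicOpen (zeroLocus Q) F)) :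
    (aeval (coordRegular hQ hF hd j) P : regularFunctions _).1 w =
      (w.1 j ^ (d - 1) / eval w.1 F) ^ b * eval w.1 P := by
  rw [eval_coe_aeval, ← eval_smul_of_isHomogeneous hP]
  congr 1
  simp only [coordRegular_apply]
  rfl

/-- The differentials of the functions `x_i x_j ^ (d - 1) / F` span the differentials where
`x_j ≠ 0`. -/
lemma exists_pow_smul_mem_span_coordRegular (j : Fin N)
    (ω : Ω[regularFunctions (basicOpen (zeroLocus Q) F)⁄ℂ]) :
    ∃ M : ℕ, coordRegular hQ hF hd j j ^ M • ω ∈ Submodule.span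
      (regularFunctions (basicOpen (zeroLocus Q) F))
      (Set.range fun i => KaehlerDifferential.D ℂ (regularFunctions (basicOpen (zeroLocus Q) F))
        (coordRegular hQ hF hd j i)) := by
  set S := Submodule.span (regularFunctions (basicOpen (zeroLocus Q) F))
    (Set.range fun i => KaehlerDifferential.D ℂ (regularFunctions (basicOpen (zeroLocus Q) F))
        (coordRegular hQ hF hd j i)) with hS
  set g := coordRegular hQ hF hd j j with hg
  have hD : ∀ i, KaehlerDifferential.D ℂ (regularFunctions (basicOpen (zeroLocus Q) F))
      (coordRegular hQ hF hd j i) ∈ S := fun i => Submodule.subset_span ⟨i, rfl⟩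
  refine exists_pow_smul_mem_of_span_eq_top (T := S)
    (KaehlerDifferential.span_range_derivation ℂ (regularFunctions (basicOpen (zeroLocus Q) F)))
    ?_ ω
  rintro _ ⟨a, rfl⟩
  obtain ⟨m, P, hP, rfl⟩ := exists_eq_fracRegular hQ hF hd a
  refine ⟨(d - 1) * m, ?_⟩
  have h1 : fracRegular hQ hF hP * g ^ ((d - 1) * m) = aeval (coordRegular hQ hF hd j) P := by
    refine Subtype.ext (funext fun w => ?_)
    have hFw := ((mem_cone_basicOpen hQ hF).1 w.2).2.2
    rw [aeval_coordRegular hQ hF hd j hP]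
    change eval w.1 P / eval w.1 F ^ m * g.1 w ^ ((d - 1) * m) = _
    rw [hg, coordRegular_apply, div_mul_eq_mul_div (w.1 j ^ (d - 1)), ← pow_succ,
      Nat.sub_add_cancel hd, div_pow, div_pow, ← pow_mul, ← pow_mul, div_mul_div_comm,
      div_mul_eq_mul_div, ← pow_add, mul_comm (eval w.1 P)]
    congr 2
    · congr 1; ring
    · obtain ⟨d, rfl⟩ := Nat.exists_eq_succ_of_ne_zero hd.ne'
      simp; ring
  have h2 := congrArg (KaehlerDifferential.D ℂ (regularFunctions (basicOpen (zeroLocus Q) F))) h1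
  rw [Derivation.leibniz, derivation_aeval, Derivation.leibniz_pow] at h2
  rw [eq_sub_of_add_eq' h2]
  refine S.sub_mem (S.sum_mem fun i _ => S.smul_mem _ (hD i)) (S.smul_mem _ ?_)
  exact S.smul_of_tower_mem _ (S.smul_mem _ (hD j))

/-- The relations between the differentials of the functions `x_i x_j ^ (d - 1) / F` that come from
the equations `Q = 0` and `F = 1`. -/
lemma sum_smul_D_coordRegular_eq_zero (j : Fin N) :
    ∑ i, (aeval (coordRegular hQ hF hd j) (pderiv i Q) : regularFunctions (basicOpen (zeroLocus Q) F)) •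
      KaehlerDifferential.D ℂ (regularFunctions (basicOpen (zeroLocus Q) F))
        (coordRegular hQ hF hd j i) = 0 := by
  rw [← derivation_aeval]
  have : (aeval (coordRegular hQ hF hd j) Q : regularFunctions (basicOpen (zeroLocus Q) F)) = 0 :=
    Subtype.ext (funext fun w => by
      rw [aeval_coordRegular hQ hF hd j hQ, ((mem_cone_basicOpen hQ hF).1 w.2).2.1, mul_zero]
      rfl)
  rw [this, map_zero]

lemma sum_sub_smul_D_coordRegular_eq_zero (j : Fin N) :
    ∑ i, ((aeval (coordRegular hQ hF hd j) (pderiv i F) -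
        Pi.single (M := fun _ => regularFunctions (basicOpen (zeroLocus Q) F)) j
          (((d - 1 : ℕ) : regularFunctions (basicOpen (zeroLocus Q) F)) *
            coordRegular hQ hF hd j j ^ (d - 1 - 1)) i :
          regularFunctions (basicOpen (zeroLocus Q) F))) •
      KaehlerDifferential.D ℂ (regularFunctions (basicOpen (zeroLocus Q) F))
        (coordRegular hQ hF hd j i) = 0 := by
  have h : (aeval (coordRegular hQ hF hd j) F : regularFunctions (basicOpen (zeroLocus Q) F)) =
      coordRegular hQ hF hd j j ^ (d - 1) :=
    Subtype.ext (funext fun w => by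
      have hFw := ((mem_cone_basicOpen hQ hF).1 w.2).2.2
      rw [aeval_coordRegular hQ hF hd j hF]
      change _ = (coordRegular hQ hF hd j j).1 w ^ (d - 1)
      rw [coordRegular_apply]
      exact div_pow_mul_self hd _ hFw)
  have h1 := congrArg (KaehlerDifferential.D ℂ (regularFunctions (basicOpen (zeroLocus Q) F))) h
  rw [derivation_aeval, Derivation.leibniz_pow] at h1
  rw [sum_sub_single_smul, h1, mul_smul, Nat.cast_smul_eq_nsmul, sub_self]

end Coordinates

section LocalCoordinates

variable {Q F : MvPolynomial (Fin (n + 2)) ℂ} {e d : ℕ}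

/-- Local coordinates: near every point there are `n` regular functions whose differentials span
the module of differentials, after inverting a regular function that does not vanish at the
point. -/
lemma exists_localCoordinates (hQ : IsSmoothHypersurface Q e)
    (hF : F.IsHomogeneous d) (hd : 0 < d)
    (v : cone (basicOpen (zeroLocus Q) F)) :
    ∃ (g : regularFunctions (basicOpen (zeroLocus Q) F))
      (t : Fin n → regularFunctions (basicOpen (zeroLocus Q) F)), g.1 v ≠ 0 ∧
      ∀ ω : Ω[regularFunctions (basicOpen (zeroLocus Q) F)⁄ℂ], ∃ M : ℕ, g ^ M • ω ∈
        Submodule.span (regularFunctions (basicOpen (zeroLocus Q) F)) (Set.range fun i =>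
          KaehlerDifferential.D ℂ (regularFunctions (basicOpen (zeroLocus Q) F)) (t i)) := by
  obtain ⟨hv, hQv, hFv⟩ := (mem_cone_basicOpen hQ.homog hF).1 v.2
  obtain ⟨j, hj⟩ := Function.ne_iff.1 hv
  rw [Pi.zero_apply] at hj
  set c : ℂ := v.1 j ^ (d - 1) / eval v.1 F with hc
  have hc0 : c ≠ 0 := div_ne_zero (pow_ne_zero _ hj) hFv
  set y := coordRegular hQ.homog hF hd j with hy
  have hyv : ∀ i, (y i).1 v = (c • v.1) i := fun i => coordRegular_apply _ _ _ _ _ _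
  let r : Fin (n + 2) → regularFunctions (basicOpen (zeroLocus Q) F) := fun i =>
    aeval y (pderiv i Q)
  let s : Fin (n + 2) → regularFunctions (basicOpen (zeroLocus Q) F) := fun i =>
    aeval y (pderiv i F) -
        Pi.single (M := fun _ => regularFunctions (basicOpen (zeroLocus Q) F)) j
          (((d - 1 : ℕ) : regularFunctions (basicOpen (zeroLocus Q) F)) * y j ^ (d - 1 - 1)) i
  have hrv : (fun i => (r i).1 v) = gradAt Q (c • v.1) := funext fun i => by
    rw [eval_coe_aeval, funext hyv]; rfl
  have hsv : (fun i => (s i).1 v) =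
      gradAt F (c • v.1) - Pi.single j (((d - 1 : ℕ) : ℂ) * (c * v.1 j) ^ (d - 1 - 1)) := by
    funext i
    change (aeval y (pderiv i F) : regularFunctions (basicOpen (zeroLocus Q) F)).1 v - _ = _
    rw [eval_coe_aeval, funext hyv]
    change _ = gradAt F (c • v.1) i - _
    congr 1
    by_cases hi : i = j
    · subst hi
      rw [Pi.single_eq_same, Pi.single_eq_same]
      change _ * (y i).1 v ^ _ = _
      rw [hyv]
      rfl
    · rw [Pi.single_eq_of_ne hi, Pi.single_eq_of_ne hi]
      rfl
  have hFc : eval (c • v.1) F = (c * v.1 j) ^ (d - 1) := by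
    rw [eval_smul_of_isHomogeneous hF, hc, div_pow_mul_self hd _ hFv]
  have hQc : eval (c • v.1) Q = 0 := by rw [eval_smul_of_isHomogeneous hQ.homog, hQv, mul_zero]
  obtain ⟨a, b, hab⟩ := exists_minor_ne_zero (r := fun i => (r i).1 v) (s := fun i => (s i).1 v)
    (y := c • v.1) (by
      rw [hrv]
      exact hQ.gradAt_ne_zero _ (smul_ne_zero hc0 hv) hQc) (by
      rw [hrv, gradAt_dotProduct_self hQ.homog, hQc, mul_zero]) (by
      -- Euler's identity leaves `d - (d - 1)` times a power of `x_j`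
      rw [hsv, sub_dotProduct, gradAt_dotProduct_self hF, hFc, single_dotProduct, Pi.smul_apply,
        smul_eq_mul]
      have h0 : (c * v.1 j) ^ (d - 1) ≠ 0 := pow_ne_zero _ (mul_ne_zero hc0 hj)
      convert h0 using 1
      obtain ⟨d, rfl⟩ := Nat.exists_eq_succ_of_ne_zero hd.ne'
      rcases d with _ | d
      · simp
      · simp only [Nat.succ_eq_add_one, Nat.add_sub_cancel]
        push_cast
        ring)
  have hne : a ≠ b := by
    rintro rfl
    exact hab (by ring)
  obtain ⟨τ, hτ⟩ := exists_pow_smul_mem_span_minor (r := r) (s := s)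
    (exists_pow_smul_mem_span_coordRegular hQ.homog hF hd j)
    (sum_smul_D_coordRegular_eq_zero hQ.homog hF hd j)
    (sum_sub_smul_D_coordRegular_eq_zero hQ.homog hF hd j) hne
  refine ⟨_, fun i => y (τ i), ?_, hτ⟩
  change (y j).1 v * _ ≠ 0
  refine mul_ne_zero ?_ hab
  rw [hyv]
  exact mul_ne_zero hc0 hj

/-- The residue of the wedge product of local coordinates has no zeros. -/
lemma residue_wedgeD_ne_zero (hQ : IsSmoothHypersurface Q e)
    (hF : F.IsHomogeneous d) (hd : 0 < d)
    {g : regularFunctions (basicOpen (zeroLocus Q) F)}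
    {t : Fin n → regularFunctions (basicOpen (zeroLocus Q) F)}
    (ht : ∀ ω : Ω[regularFunctions (basicOpen (zeroLocus Q) F)⁄ℂ], ∃ M : ℕ, g ^ M • ω ∈
        Submodule.span (regularFunctions (basicOpen (zeroLocus Q) F)) (Set.range fun i =>
          KaehlerDifferential.D ℂ (regularFunctions (basicOpen (zeroLocus Q) F)) (t i)))
    {v : cone (basicOpen (zeroLocus Q) F)} (hg : g.1 v ≠ 0) :
    residue hQ hF hd (wedgeD t) v ≠ 0 := by
  obtain ⟨hv, hQv, hFv⟩ := (mem_cone_basicOpen hQ.homog hF).1 v.2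
  obtain ⟨j, hj⟩ := Function.ne_iff.1 hv
  rw [Pi.zero_apply] at hj
  intro h0
  rw [wedgeD, residue_ιMulti, borderedDet_eq_zero_iff] at h0
  obtain ⟨u, hu, hQu, hvu, htu⟩ := h0
  -- all gradients annihilate `u`
  have hω : ∀ ω, formGrad hQ hF hd v ω ⬝ᵥ u = 0 := by
    intro ω
    obtain ⟨M, hM⟩ := ht ω
    have h1 : formGrad hQ hF hd v (g ^ M • ω) ⬝ᵥ u = 0 := by
      generalize g ^ M • ω = ω' at hM
      induction hM using Submodule.span_induction with
      | mem x hx => obtain ⟨i, rfl⟩ := hx; exact htu i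
      | zero =>
        have h0 : formGrad hQ hF hd v 0 = 0 := by funext i; simp [formGrad]
        rw [h0, zero_dotProduct]
      | add x y _ _ hx hy => rw [formGrad_add, add_dotProduct, hx, hy, add_zero]
      | smul a x _ hx => rw [formGrad_smul, smul_dotProduct, hx, smul_zero]
    rw [formGrad_smul, smul_dotProduct] at h1
    exact (mul_eq_zero.1 h1).resolve_left (pow_ne_zero M hg)
  have hgrad : ∀ (a : regularFunctions (basicOpen (zeroLocus Q) F)) ξ, HasGrad a.1 v ξ →
      ξ ⬝ᵥ u = 0 := by
    intro a ξ h
    have h1 := hω (KaehlerDifferential.D ℂ _ a)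
    rwa [formGrad_D, normGrad_eq hQ hF hd h, projAlong_apply, sub_dotProduct, smul_dotProduct, hQu,
      smul_zero, sub_zero] at h1
  have hprop : ∃ κ : ℂ, u = κ • v.1 := by
    have h1 : ∀ i, gradAt (X i * X j ^ (d - 1)) v.1 ⬝ᵥ u =
        (coordRegular hQ.homog hF hd j i).1 v * gradAt F v.1 ⬝ᵥ u := by
      intro i
      have h2 : HasGrad (coordRegular hQ.homog hF hd j i).1 v
          ((eval v.1 F)⁻¹ • (gradAt (X i * X j ^ (d - 1)) v.1 -
            (coordRegular hQ.homog hF hd j i).1 v • gradAt F v.1)) := by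
        refine ⟨d, X i * X j ^ (d - 1), F, ?_, hF, hFv, fun w _ => ?_, smul_inv_smul₀ hFv _⟩
        · have := (isHomogeneous_X ℂ i).mul ((isHomogeneous_X ℂ j).pow (d - 1))
          rwa [show 1 + 1 * (d - 1) = d by omega] at this
        · rw [coordRegular_apply, map_mul, map_pow, eval_X, eval_X]
          ring
      have h3 := hgrad _ _ h2
      rw [smul_dotProduct, sub_dotProduct, smul_dotProduct, smul_eq_mul, smul_eq_mul] at h3
      exact sub_eq_zero.1 ((mul_eq_zero.1 h3).resolve_left (inv_ne_zero hFv))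
    refine ⟨(v.1 j ^ (d - 1))⁻¹ * (v.1 j ^ (d - 1) / eval v.1 F * gradAt F v.1 ⬝ᵥ u -
      ((d - 1 : ℕ) * v.1 j ^ (d - 1 - 1)) * u j), funext fun i => ?_⟩
    have h2 := h1 i
    rw [gradAt_mul, gradAt_pow, gradAt_X, gradAt_X, coordRegular_apply, add_dotProduct,
      smul_dotProduct, smul_dotProduct, smul_dotProduct, single_one_dotProduct,
      single_one_dotProduct, map_pow, eval_X, eval_X] at h2
    simp only [smul_eq_mul] at h2
    have h3 : v.1 j ^ (d - 1) ≠ 0 := pow_ne_zero _ hj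
    rw [Pi.smul_apply, smul_eq_mul, mul_assoc, eq_inv_mul_iff_mul_eq₀ h3]
    linear_combination h2
  obtain ⟨κ, rfl⟩ := hprop
  rw [dotProduct_smul, dotProduct_comm, dotProduct_dualVec hv, smul_eq_mul, mul_one] at hvu
  exact hu (by rw [hvu, zero_smul])

end LocalCoordinates

end

section

open MvPolynomial

variable {N n : ℕ}

/-! ### The canonical bundle of a smooth hypersurface -/

lemma IsLocallyFraction.div {U U' : Set (PSpace N)} (h : U ⊆ U') {j k : ℤ} {s t : cone U' → ℂ}
    (hs : IsLocallyFraction U' j s) (ht : IsLocallyFraction U' k t)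
    (h0 : ∀ w : cone U, t (Set.inclusion (cone_mono h) w) ≠ 0) :
    IsLocallyFraction U (j - k) ((s / t) ∘ Set.inclusion (cone_mono h)) := by
  intro v
  set ι := Set.inclusion (cone_mono h) with hι
  obtain ⟨a, b, P, R, hP, hR, hab, hv, H⟩ := hs (ι v)
  obtain ⟨a', b', P', R', hP', hR', hab', hv', H'⟩ := ht (ι v)
  refine ⟨a + (b' + b'), b + (b' + a'), P * (R' * R'), R * (R' * P'), hP.mul (hR'.mul hR'),
    hR.mul (hR'.mul hP'), by push_cast; omega, ?_, ?_⟩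
  · have h1 : eval v.1 P' ≠ 0 := by
      intro h1
      have h2 := H' (ι v) hv'
      rw [show (ι v).1 = v.1 from rfl, h1, zero_div] at h2
      exact h0 v h2
    rw [map_mul, map_mul]
    exact mul_ne_zero hv (mul_ne_zero hv' h1)
  · intro w hw
    rw [map_mul, map_mul] at hw
    have h1 := left_ne_zero_of_mul hw
    have h2 := left_ne_zero_of_mul (right_ne_zero_of_mul hw)
    have h3 := right_ne_zero_of_mul (right_ne_zero_of_mul hw)
    change s (ι w) / t (ι w) = _
    rw [H (ι w) h1, H' (ι w) h2, map_mul, map_mul, map_mul, map_mul]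
    change eval w.1 P / eval w.1 R / (eval w.1 P' / eval w.1 R') = _
    field_simp

lemma pow_succ_smul_eq_zero {A Ω' : Type*} [CommRing A] [AddCommGroup Ω'] [Module A Ω'] {g f : A}
    {M : ℕ} {x y : Ω'} (h : g ^ M • x = f • y) (h0 : g * f = 0) : g ^ (M + 1) • x = 0 := by
  rw [pow_succ', mul_smul, h, smul_smul, h0, zero_smul]

section

variable {Q F : MvPolynomial (Fin (n + 2)) ℂ} {e d : ℕ}

lemma residueSection_injective (hQ : IsSmoothHypersurface Q e) (hF : F.IsHomogeneous d)
    (hd : 0 < d) : Function.Injective (residueSection hQ hF hd) := by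
  rw [injective_iff_map_eq_zero]
  intro m hm
  have hres : residue hQ hF hd m = 0 := congrArg Subtype.val hm
  have htop : Ideal.torsionOf (regularFunctions (basicOpen (zeroLocus Q) F)) _ m = ⊤ := by
    refine ideal_eq_top_of_forall_exists hQ.homog hF hd fun v => ?_
    obtain ⟨g, t, hgv, ht⟩ := exists_localCoordinates hQ hF hd v
    obtain ⟨M, f, hM⟩ := exists_pow_smul_eq_smul_ιMulti ht m
    have hgf : g * f = 0 := Subtype.ext (funext fun w => by
      change g.1 w * f.1 w = 0
      by_cases hw : g.1 w = 0
      · rw [hw, zero_mul]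
      · have h1 := congrFun (congrArg (residue hQ hF hd) hM) w
        rw [map_smul, map_smul, hres, smul_zero] at h1
        have h2 : f.1 w * residue hQ hF hd (wedgeD t) w = 0 := h1.symm
        rw [(mul_eq_zero.1 h2).resolve_right (residue_wedgeD_ne_zero hQ hF hd ht hw), mul_zero])
    refine ⟨g ^ (M + 1), ?_, pow_ne_zero (M + 1) hgv⟩
    rw [Ideal.mem_torsionOf_iff]
    exact pow_succ_smul_eq_zero hM hgf
  exact (Ideal.torsionOf_eq_top_iff _ m).1 htop

lemma residueSection_surjective (hQ : IsSmoothHypersurface Q e) (hF : F.IsHomogeneous d)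
    (hd : 0 < d) : Function.Surjective (residueSection hQ hF hd) := by
  intro l
  have htop : (LinearMap.range (residueSection hQ hF hd)).comap
      (LinearMap.toSpanSingleton (regularFunctions (basicOpen (zeroLocus Q) F)) _ l) = ⊤ := by
    refine ideal_eq_top_of_forall_exists hQ.homog hF hd fun v => ?_
    obtain ⟨g, t, hgv, ht⟩ := exists_localCoordinates hQ hF hd v
    obtain ⟨m, G, hG, rfl⟩ := exists_eq_fracRegular hQ.homog hF hd g
    have hFG : (F * G).IsHomogeneous (d + m * d) := hF.mul hG
    have hsub : basicOpen (zeroLocus Q) (F * G) ⊆ basicOpen (zeroLocus Q) F := fun x hx =>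
      ⟨hx.1, fun h => hx.2 (by rw [map_mul, h, zero_mul])⟩
    set s := residue hQ hF hd (wedgeD t) with hs
    have hs0 : ∀ w : cone (basicOpen (zeroLocus Q) (F * G)),
        s (Set.inclusion (cone_mono hsub) w) ≠ 0 := by
      intro w
      refine residue_wedgeD_ne_zero hQ hF hd ht ?_
      have h1 := ((mem_cone_basicOpen hQ.homog hFG).1 w.2).2.2
      rw [map_mul] at h1
      exact div_ne_zero (right_ne_zero_of_mul h1) (pow_ne_zero _ (left_ne_zero_of_mul h1))
    have hdiv := IsLocallyFraction.div hsub l.2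
      (isLocallyFraction_residue hQ hF hd (wedgeD t)) hs0
    rw [sub_self] at hdiv
    obtain ⟨M, hM⟩ := exists_eq_div_pow hQ.homog hFG (by omega) hdiv
    obtain ⟨a, P, hP, ha, h⟩ := hM M le_rfl
    obtain rfl : a = M * (d + m * d) := by zify; rw [ha, add_zero]; push_cast; ring
    have hP' : P.IsHomogeneous (M * (1 + m) * d) := by
      rwa [show M * (1 + m) * d = M * (d + m * d) by ring]
    set g := fracRegular hQ.homog hF hG with hg
    refine ⟨g ^ (M + 1), ?_, pow_ne_zero (M + 1) hgv⟩
    refine ⟨(g * fracRegular hQ.homog hF hP') • wedgeD t, ?_⟩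
    rw [map_smul]
    refine Subtype.ext (funext fun w => ?_)
    change g.1 w * (eval w.1 P / eval w.1 F ^ (M * (1 + m))) * s w = g.1 w ^ (M + 1) * l.1 w
    by_cases hw : g.1 w = 0
    · rw [hw]; simp
    obtain ⟨hw0, hQw, hFw⟩ := (mem_cone_basicOpen hQ.homog hF).1 w.2
    have hgw : g.1 w = eval w.1 G / eval w.1 F ^ m := rfl
    have hGw : eval w.1 G ≠ 0 := fun h => hw (by rw [hgw, h, zero_div])
    have hFGw : eval w.1 (F * G) ≠ 0 := by rw [map_mul]; exact mul_ne_zero hFw hGw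
    have h1 : l.1 w / s w = eval w.1 P / eval w.1 (F * G) ^ M :=
      h ⟨w.1, (mem_cone_basicOpen hQ.homog hFG).2 ⟨hw0, hQw, hFGw⟩⟩
    have h2 : s w ≠ 0 := hs0 ⟨w.1, (mem_cone_basicOpen hQ.homog hFG).2 ⟨hw0, hQw, hFGw⟩⟩
    rw [div_eq_iff h2] at h1
    rw [h1, hgw, map_mul, show eval w.1 F ^ (M * (1 + m)) = eval w.1 F ^ M * (eval w.1 F ^ m) ^ M by
      ring]
    have hE : eval w.1 F ^ m ≠ 0 := pow_ne_zero m hFw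
    generalize eval w.1 F ^ m = E at hE
    rw [div_pow, mul_pow]
    field_simp
    ring
  rw [Ideal.eq_top_iff_one, Submodule.mem_comap, LinearMap.toSpanSingleton_apply, one_smul] at htop
  exact htop

/-- The adjunction formula `ω_X = 𝒪_X(deg X - n - 2)` for a smooth hypersurface `X` in
`ℙ^(n + 1)`. -/
theorem canonicalBundleIs_hypersurface (hQ : IsSmoothHypersurface Q e) :
    CanonicalBundleIs n (zeroLocus Q) (e - n - 1) := by
  refine ⟨fun F => LinearEquiv.ofBijective
    (residueSection hQ F.2.choose_spec.2 F.2.choose_spec.1)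
    ⟨residueSection_injective hQ _ _, residueSection_surjective hQ _ _⟩, ?_⟩
  intro F G h a
  exact Subtype.ext (funext fun v => residue_restrict hQ _ _ _ _ h a v)

end

end

section

variable {N n : ℕ}

/-! ### The bilinear form and the signature -/

/-- The real bilinear form with Gram matrix `S`. -/
def bilR (S : Matrix (Fin N) (Fin N) ℝ) : LinearMap.BilinForm ℝ (Fin N → ℝ) := Matrix.toBilin' S

lemma bilR_apply (S : Matrix (Fin N) (Fin N) ℝ) (x y : Fin N → ℝ) :
    bilR S x y = ∑ i, ∑ j, S i j * x i * y j := by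
  rw [bilR, Matrix.toBilin'_apply]
  exact Finset.sum_congr rfl fun i _ => Finset.sum_congr rfl fun j _ => by ring

lemma bilC_eq_toBilin' (S : Matrix (Fin N) (Fin N) ℝ) (v w : Fin N → ℂ) :
    bilC S v w = Matrix.toBilin' (S.map fun x : ℝ => (x : ℂ)) v w := by
  rw [bilC, Matrix.toBilin'_apply]
  exact Finset.sum_congr rfl fun i _ => Finset.sum_congr rfl fun j _ => by
    rw [Matrix.map_apply]; ring

section bilC

variable (S : Matrix (Fin N) (Fin N) ℝ) (v v' w w' : Fin N → ℂ) (c : ℂ)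

lemma bilC_add_left : bilC S (v + v') w = bilC S v w + bilC S v' w := by
  simp only [bilC_eq_toBilin', map_add, LinearMap.add_apply]

lemma bilC_add_right : bilC S v (w + w') = bilC S v w + bilC S v w' := by
  simp only [bilC_eq_toBilin', map_add]

lemma bilC_sub_left : bilC S (v - v') w = bilC S v w - bilC S v' w := by
  simp only [bilC_eq_toBilin', map_sub, LinearMap.sub_apply]

lemma bilC_sub_right : bilC S v (w - w') = bilC S v w - bilC S v w' := by
  simp only [bilC_eq_toBilin', map_sub]

lemma bilC_smul_left : bilC S (c • v) w = c * bilC S v w := by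
  simp only [bilC_eq_toBilin', map_smul, LinearMap.smul_apply, smul_eq_mul]

lemma bilC_smul_right : bilC S v (c • w) = c * bilC S v w := by
  simp only [bilC_eq_toBilin', map_smul, smul_eq_mul]

lemma bilC_star_star : bilC S (star v) (star w) = star (bilC S v w) := by
  simp [bilC, star_sum]

lemma re_bilC : (bilC S v w).re =
    bilR S (fun i => (v i).re) (fun i => (w i).re) -
      bilR S (fun i => (v i).im) (fun i => (w i).im) := by
  simp only [bilC, bilR_apply, Complex.re_sum, ← Finset.sum_sub_distrib]
  refine Finset.sum_congr rfl fun i _ => Finset.sum_congr rfl fun j _ => ?_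
  simp

lemma im_bilC : (bilC S v w).im =
    bilR S (fun i => (v i).re) (fun i => (w i).im) +
      bilR S (fun i => (v i).im) (fun i => (w i).re) := by
  simp only [bilC, bilR_apply, Complex.im_sum, ← Finset.sum_add_distrib]
  refine Finset.sum_congr rfl fun i _ => Finset.sum_congr rfl fun j _ => ?_
  simp

variable {S}

lemma bilC_comm (hS : S.IsSymm) : bilC S v w = bilC S w v := by
  rw [bilC, bilC, Finset.sum_comm]
  refine Finset.sum_congr rfl fun i _ => Finset.sum_congr rfl fun j _ => ?_
  rw [hS.apply]
  ring

lemma bilR_comm (hS : S.IsSymm) (x y : Fin N → ℝ) : bilR S x y = bilR S y x := by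
  rw [bilR_apply, bilR_apply, Finset.sum_comm]
  refine Finset.sum_congr rfl fun i _ => Finset.sum_congr rfl fun j _ => ?_
  rw [hS.apply]
  ring

end bilC

/-- The data at a vector `ω = x + i y` that represents a point of the symmetric space: the plane
spanned by `x` and `y` is positive definite, and its orthogonal complement is negative definite. -/
structure IsBaseVector (S : Matrix (Fin N) (Fin N) ℝ) (ω : Fin N → ℂ) : Prop where
  symm : S.IsSymm
  isotropic : bilC S ω ω = 0
  pos : 0 < (bilC S ω (star ω)).re
  neg : ∀ u, u ≠ 0 → bilC S u ω = 0 → bilC S u (star ω) = 0 → (bilC S u (star u)).re < 0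

section Signature

variable {V : Type*} [AddCommGroup V] [Module ℝ V] (q : QuadraticForm ℝ V)
  (e : Module.Basis (Fin N) ℝ V)

lemma gram_isSymm : (gram q e).IsSymm := by
  ext i j
  rw [Matrix.transpose_apply, gram, Matrix.of_apply, Matrix.of_apply, QuadraticMap.polar_comm]

lemma bilR_gram (z : Fin N → ℝ) : bilR (gram q e) z z = q (e.equivFun.symm z) := by
  have h : ∀ x y : V, QuadraticMap.polar q x y = QuadraticMap.polarBilin q x y := fun _ _ => rfl
  have h1 : QuadraticMap.polar q (e.equivFun.symm z) (e.equivFun.symm z) =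
      2 * q (e.equivFun.symm z) := by
    rw [QuadraticMap.polar_self, two_smul, two_mul]
  rw [h, Module.Basis.equivFun_symm_apply] at h1
  simp only [map_sum, map_smul, LinearMap.sum_apply, LinearMap.smul_apply, smul_eq_mul] at h1
  rw [Module.Basis.equivFun_symm_apply]
  have h2 : bilR (gram q e) z z = (∑ i, z i * ∑ j, z j * QuadraticMap.polarBilin q (e i) (e j)) / 2 := by
    rw [bilR_apply, Finset.sum_div]
    refine Finset.sum_congr rfl fun i _ => ?_
    rw [Finset.mul_sum, Finset.sum_div]
    refine Finset.sum_congr rfl fun j _ => ?_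
    rw [gram, Matrix.of_apply, h]
    ring
  rw [h2, div_eq_iff two_ne_zero, mul_comm _ (2 : ℝ), ← h1]
  refine Finset.sum_congr rfl fun i _ => congrArg (z i * ·) (Finset.sum_congr rfl fun j _ => ?_)
  rw [← h, ← h, QuadraticMap.polar_comm]

/-- In signature `(2, n)` the orthogonal complement of a positive definite plane is negative
definite. -/
lemma bilR_neg_of_orthogonal {q : QuadraticForm ℝ V} {e : Module.Basis (Fin (n + 2)) ℝ V}
    (hneg : sigNeg q = n) {x y u : Fin (n + 2) → ℝ} (hx : 0 < bilR (gram q e) x x)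
    (hy : 0 < bilR (gram q e) y y) (hxy : bilR (gram q e) x y = 0)
    (hux : bilR (gram q e) u x = 0) (huy : bilR (gram q e) u y = 0) (hu : u ≠ 0) :
    bilR (gram q e) u u < 0 := by
  by_contra! h0
  have hS := gram_isSymm q e
  have hyx := (bilR_comm hS y x).trans hxy
  have hxu := (bilR_comm hS x u).trans hux
  have hyu := (bilR_comm hS y u).trans huy
  have hli : LinearIndependent ℝ ![x, y, u] := by
    rw [Fintype.linearIndependent_iff]
    intro g hg
    simp only [Fin.sum_univ_three, Matrix.cons_val] at hg
    have h1 := congrArg (bilR (gram q e) x) hg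
    have h2 := congrArg (bilR (gram q e) y) hg
    simp only [map_add, map_smul, smul_eq_mul, hxy, hyx, hxu, hyu, map_zero, mul_zero, add_zero,
      zero_add] at h1 h2
    have g0 := (mul_eq_zero.1 h1).resolve_right hx.ne'
    have g1 := (mul_eq_zero.1 h2).resolve_right hy.ne'
    rw [g0, g1, zero_smul, zero_smul, zero_add, zero_add] at hg
    have g2 := (smul_eq_zero.1 hg).resolve_right hu
    intro i
    fin_cases i
    · exact g0
    · exact g1
    · exact g2
  have hli' := hli.map' e.equivFun.symm.toLinearMap e.equivFun.symm.ker
  have hfin : FiniteDimensional ℝ V := Module.Finite.of_basis e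
  have hrank := finrank_span_eq_card hli'
  have h1 := QuadraticForm.sigPos_add_finrank_le_of_nonpos (Q := -q)
    (V := Submodule.span ℝ (Set.range (e.equivFun.symm.toLinearMap ∘ ![x, y, u]))) (by
      intro z hz
      obtain ⟨g, rfl⟩ := (Submodule.mem_span_range_iff_exists_fun ℝ).1 hz
      have h2 : ∑ i, g i • (e.equivFun.symm.toLinearMap ∘ ![x, y, u]) i =
          e.equivFun.symm (g 0 • x + g 1 • y + g 2 • u) := by
        rw [Fin.sum_univ_three, map_add, map_add, map_smul, map_smul, map_smul]
        rfl
      rw [h2, neg_apply, ← bilR_gram, neg_nonpos]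
      simp only [map_add, map_smul, LinearMap.add_apply, LinearMap.smul_apply, smul_eq_mul, hxy,
        hyx, hux, huy, hxu, hyu, mul_zero, add_zero, zero_add]
      have := mul_self_nonneg (g 0)
      have := mul_self_nonneg (g 1)
      have := mul_self_nonneg (g 2)
      simp only [← mul_assoc]
      positivity)
  rw [hrank, Module.finrank_eq_card_basis e, sigPos_neg, hneg] at h1
  simp at h1

lemma isBaseVector_rep {q : QuadraticForm ℝ V} {e : Module.Basis (Fin (n + 2)) ℝ V}
    (hneg : sigNeg q = n) {o : PSpace (n + 2)} (ho : o ∈ symmetricSpace (gram q e)) :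
    IsBaseVector (gram q e) o.rep := by
  obtain ⟨h0, hpos⟩ := ho
  have hS := gram_isSymm q e
  refine ⟨hS, h0, hpos, fun u hu h1 h2 => ?_⟩
  set ω := o.rep
  have a1 := congrArg Complex.re h0
  have a2 := congrArg Complex.im h0
  have b1 := congrArg Complex.re h1
  have b2 := congrArg Complex.im h1
  have c1 := congrArg Complex.re h2
  have c2 := congrArg Complex.im h2
  rw [re_bilC] at a1 b1 c1 hpos
  rw [im_bilC] at a2 b2 c2
  rw [re_bilC]
  have hre : ∀ v : Fin (n + 2) → ℂ, (fun i => (star v i).re) = fun i => (v i).re := fun v => by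
    funext i; simp
  have him : ∀ v : Fin (n + 2) → ℂ, (fun i => (star v i).im) = -fun i => (v i).im := fun v => by
    funext i; simp
  simp only [hre, him, map_neg, Complex.zero_re, Complex.zero_im] at *
  set x : Fin (n + 2) → ℝ := fun i => (ω i).re
  set y : Fin (n + 2) → ℝ := fun i => (ω i).im
  set u₁ : Fin (n + 2) → ℝ := fun i => (u i).re with hu₁
  set u₂ : Fin (n + 2) → ℝ := fun i => (u i).im with hu₂
  have hxy := bilR_comm hS x y
  have key : ∀ z, bilR (gram q e) z x = 0 → bilR (gram q e) z y = 0 → z ≠ 0 →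
      bilR (gram q e) z z < 0 := fun z hzx hzy hz =>
    bilR_neg_of_orthogonal hneg (x := x) (y := y) (by linarith) (by linarith) (by linarith)
      hzx hzy hz
  have k1 := key u₁ (by linarith) (by linarith)
  have k2 := key u₂ (by linarith) (by linarith)
  by_cases z1 : u₁ = 0
  · by_cases z2 : u₂ = 0
    · refine absurd (funext fun i => Complex.ext ?_ ?_) hu
      · exact congrFun z1 i
      · exact congrFun z2 i
    · have := k2 z2
      rw [z1]
      rw [map_zero]
      linarith
  · have := k1 z1
    by_cases z2 : u₂ = 0
    · rw [z2]
      rw [map_zero]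
      linarith
    · have := k2 z2
      linarith

end Signature

end

section

variable {N n : ℕ}

/-! ### The compact real structure -/

/-- The conjugation `v ↦ θ (v̄)` of the complexification, whose fixed points form a positive definite
real structure. -/
def compactConj (S : Matrix (Fin N) (Fin N) ℝ) (o : PSpace N) (v : Fin N → ℂ) : Fin N → ℂ :=
  cartanInvolution S o (star v)

section Conjugation

variable {S : Matrix (Fin N) (Fin N) ℝ} {o : PSpace N}

lemma IsBaseVector.ne_zero {ω : Fin N → ℂ} (h : IsBaseVector S ω) : bilC S ω (star ω) ≠ 0 :=
  fun h0 => by simpa [h0] using h.pos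

lemma IsBaseVector.star_bilC {ω : Fin N → ℂ} (h : IsBaseVector S ω) :
    star (bilC S ω (star ω)) = bilC S ω (star ω) := by
  rw [← bilC_star_star, star_star, bilC_comm _ _ h.symm]

lemma IsBaseVector.star_isotropic {ω : Fin N → ℂ} (h : IsBaseVector S ω) :
    bilC S (star ω) (star ω) = 0 := by
  rw [bilC_star_star, h.isotropic, star_zero]

lemma cartanInvolution_add (v w : Fin N → ℂ) :
    cartanInvolution S o (v + w) = cartanInvolution S o v + cartanInvolution S o w := by
  simp only [cartanInvolution, bilC_add_left, mul_add, add_div]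
  module

lemma cartanInvolution_smul (c : ℂ) (v : Fin N → ℂ) :
    cartanInvolution S o (c • v) = c • cartanInvolution S o v := by
  simp only [cartanInvolution, bilC_smul_left, mul_div_assoc, mul_left_comm _ c]
  module

lemma cartanInvolution_star (h : IsBaseVector S o.rep) (v : Fin N → ℂ) :
    cartanInvolution S o (star v) = star (cartanInvolution S o v) := by
  have h1 : bilC S (star v) (star o.rep) = star (bilC S v o.rep) := bilC_star_star _ _ _
  have h2 : bilC S (star v) o.rep = star (bilC S v (star o.rep)) := by
    rw [← bilC_star_star, star_star]
  simp only [cartanInvolution, h1, h2, star_sub, star_add, star_smul, star_div₀, star_mul,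
    star_star, h.star_bilC, star_ofNat]
  simp only [mul_comm (star _) (2 : ℂ)]
  rw [add_comm (_ • o.rep)]

lemma cartanInvolution_cartanInvolution (h : IsBaseVector S o.rep) (v : Fin N → ℂ) :
    cartanInvolution S o (cartanInvolution S o v) = v := by
  have hβ := h.ne_zero
  have h1 := h.isotropic
  have h2 := h.star_isotropic
  have h3 := bilC_comm (star o.rep) o.rep h.symm
  rw [cartanInvolution, cartanInvolution]
  simp only [bilC_sub_left, bilC_add_left, bilC_smul_left, h1, h2, h3]
  generalize bilC S o.rep (star o.rep) = β at hβ
  have e1 : 2 * (2 * bilC S v (star o.rep) / β * β + 2 * bilC S v o.rep / β * 0 -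
      bilC S v (star o.rep)) / β = 2 * bilC S v (star o.rep) / β := by field_simp; ring
  have e2 : 2 * (2 * bilC S v (star o.rep) / β * 0 + 2 * bilC S v o.rep / β * β -
      bilC S v o.rep) / β = 2 * bilC S v o.rep / β := by field_simp; ring
  rw [e1, e2]
  abel

lemma bilC_cartanInvolution (h : IsBaseVector S o.rep) (v w : Fin N → ℂ) :
    bilC S (cartanInvolution S o v) (cartanInvolution S o w) = bilC S v w := by
  have hβ := h.ne_zero
  have h1 := h.isotropic
  have h2 := h.star_isotropic
  have h3 := bilC_comm (star o.rep) o.rep h.symm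
  have h4 := bilC_comm o.rep w h.symm
  have h5 := bilC_comm (star o.rep) w h.symm
  rw [cartanInvolution, cartanInvolution]
  simp only [bilC_sub_left, bilC_add_left, bilC_smul_left, bilC_sub_right, bilC_add_right,
    bilC_smul_right, h1, h2, h3, h4, h5]
  field_simp
  ring

lemma compactConj_add (v w : Fin N → ℂ) :
    compactConj S o (v + w) = compactConj S o v + compactConj S o w := by
  rw [compactConj, star_add, cartanInvolution_add]; rfl

lemma compactConj_smul (c : ℂ) (v : Fin N → ℂ) :
    compactConj S o (c • v) = star c • compactConj S o v := by
  rw [compactConj, star_smul, cartanInvolution_smul]; rfl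

lemma compactConj_sub (v w : Fin N → ℂ) :
    compactConj S o (v - w) = compactConj S o v - compactConj S o w := by
  rw [sub_eq_add_neg, compactConj_add, ← neg_one_smul ℂ w, compactConj_smul]
  simp [sub_eq_add_neg]

lemma compactConj_compactConj (h : IsBaseVector S o.rep) (v : Fin N → ℂ) :
    compactConj S o (compactConj S o v) = v := by
  rw [compactConj, compactConj, ← cartanInvolution_star h, star_star,
    cartanInvolution_cartanInvolution h]

lemma bilC_compactConj (h : IsBaseVector S o.rep) (v w : Fin N → ℂ) :
    bilC S (compactConj S o v) (compactConj S o w) = star (bilC S v w) := by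
  rw [compactConj, compactConj, bilC_cartanInvolution h, bilC_star_star]

lemma compactConj_rep (h : IsBaseVector S o.rep) : compactConj S o o.rep = star o.rep := by
  have h3 := bilC_comm (star o.rep) o.rep h.symm
  rw [compactConj, cartanInvolution, h.star_isotropic, h3, mul_zero, zero_div,
    mul_div_cancel_right₀ _ h.ne_zero]
  module

/-- The Hermitian form `b (v, θ (v̄))` is positive definite. -/
lemma bilC_compactConj_pos (h : IsBaseVector S o.rep) {v : Fin N → ℂ} (hv : v ≠ 0) :
    0 < (bilC S v (compactConj S o v)).re := by
  have hβ := h.ne_zero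
  have h1 := h.isotropic
  have h2 := h.star_isotropic
  have h3 := bilC_comm (star o.rep) o.rep h.symm
  have hβs := h.star_bilC
  have hpos := h.pos
  set ω := o.rep with hω
  set β := bilC S ω (star ω) with hβdef
  set a := bilC S v (star ω) / β with ha
  set c := bilC S v ω / β with hc
  set u := v - a • ω - c • star ω with hu
  have hu1 : bilC S u ω = 0 := by
    rw [hu, bilC_sub_left, bilC_sub_left, bilC_smul_left, bilC_smul_left, h1, h3, hc]
    field_simp
    ring
  have hu2 : bilC S u (star ω) = 0 := by
    rw [hu, bilC_sub_left, bilC_sub_left, bilC_smul_left, bilC_smul_left, h2, ← hβdef, ha]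
    field_simp
    ring
  have hv' : v = a • ω + c • star ω + u := by rw [hu]; abel
  have hτ : compactConj S o v = star c • ω + star a • star ω - star u := by
    have e1 : bilC S (star v) (star ω) = star (c * β) := by
      rw [bilC_star_star, hc, div_mul_cancel₀ _ hβ]
    have e2 : bilC S (star v) ω = star (a * β) := by
      rw [ha, div_mul_cancel₀ _ hβ, ← bilC_star_star, star_star]
    have e3 : star v = star a • star ω + star c • ω + star u := by
      conv_lhs => rw [hv']
      simp only [star_add, star_smul, star_star]
    rw [compactConj, cartanInvolution, ← hω, ← hβdef, e1, e2, star_mul, star_mul, hβs, e3]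
    have e4 : ∀ x : ℂ, 2 * (β * x) / β = 2 * x := fun x => by field_simp
    rw [e4, e4]
    module
  have hval : bilC S v (compactConj S o v) =
      (a * star a + c * star c) * β - bilC S u (star u) := by
    have e1 : bilC S (star ω) (star u) = 0 := by rw [bilC_star_star, bilC_comm _ _ h.symm, hu1, star_zero]
    have e2 : bilC S ω (star u) = 0 := by
      rw [← star_star ω, bilC_star_star, bilC_comm _ _ h.symm, hu2, star_zero]
    rw [hτ, hv']
    simp only [bilC_add_left, bilC_smul_left, bilC_sub_right, bilC_add_right, bilC_smul_right,
      h1, h2, h3, hu1, hu2, e1, e2, ← hβdef]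
    ring
  have hre : ((a * star a + c * star c) * β).re = (Complex.normSq a + Complex.normSq c) * β.re := by
    rw [Complex.star_def, Complex.mul_conj, Complex.mul_conj,
      ← Complex.ofReal_add, Complex.re_ofReal_mul]
  rw [hval, Complex.sub_re, hre]
  have ha0 := Complex.normSq_nonneg a
  have hc0 := Complex.normSq_nonneg c
  by_cases hu0 : u = 0
  · have hne : a ≠ 0 ∨ c ≠ 0 := by
      by_contra! hac
      exact hv (by rw [hv', hac.1, hac.2, hu0]; simp)
    have h4 : bilC S u (star u) = 0 := by rw [hu0]; simp [bilC]
    rw [h4, Complex.zero_re, sub_zero]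
    refine mul_pos ?_ hpos
    rcases hne with hne | hne
    · have := Complex.normSq_pos.2 hne
      linarith
    · have := Complex.normSq_pos.2 hne
      linarith
  · have h4 := h.neg u hu0 hu1 hu2
    have h5 := mul_nonneg (add_nonneg ha0 hc0) hpos.le
    linarith

end Conjugation

/-! ### The isotropy group -/

section Isotropy

variable {S : Matrix (Fin N) (Fin N) ℝ} {o : PSpace N}

lemma mem_stabilizer_iff {g : Matrix.SpecialLinearGroup (Fin N) ℂ} :
    g ∈ MulAction.stabilizer (Matrix.SpecialLinearGroup (Fin N) ℂ) o ↔
      ∃ c : ℂ, g.1.mulVec o.rep = c • o.rep := by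
  have h0 : g.1.mulVec o.rep ≠ 0 := fun h => o.rep_nonzero (by
    have := congrArg (g⁻¹).1.mulVec h
    rwa [Matrix.mulVec_mulVec, ← Matrix.SpecialLinearGroup.coe_mul, inv_mul_cancel,
      Matrix.SpecialLinearGroup.coe_one, Matrix.one_mulVec, Matrix.mulVec_zero] at this)
  rw [MulAction.mem_stabilizer_iff]
  have h1 : g • o = Projectivization.mk ℂ (g.1.mulVec o.rep) h0 := by
    conv_lhs => rw [← o.mk_rep]
    rfl
  rw [h1]
  conv_lhs => rhs; rw [← o.mk_rep]
  rw [Projectivization.mk_eq_mk_iff']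
  exact exists_congr fun c => eq_comm

/-- An isometry that preserves both lines of the positive definite plane at `o` commutes with the
Cartan involution. -/
lemma mulVec_cartanInvolution (h : IsBaseVector S o.rep) {M : Matrix (Fin N) (Fin N) ℂ}
    (hM : ∀ v w, bilC S (M.mulVec v) (M.mulVec w) = bilC S v w) {c : ℂ}
    (hc : M.mulVec o.rep = c • o.rep) (hc' : M.mulVec (star o.rep) = star c • star o.rep)
    (v : Fin N → ℂ) :
    M.mulVec (cartanInvolution S o v) = cartanInvolution S o (M.mulVec v) := by
  have hβ := h.ne_zero
  have hcc : c * star c = 1 := by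
    have h1 := hM o.rep (star o.rep)
    rw [hc, hc', bilC_smul_left, bilC_smul_right, ← mul_assoc] at h1
    exact mul_right_cancel₀ hβ (h1.trans (one_mul _).symm)
  have e1 : bilC S (M.mulVec v) (star o.rep) = c * bilC S v (star o.rep) := by
    rw [← hM v (star o.rep), hc', bilC_smul_right, ← mul_assoc, hcc, one_mul]
  have e2 : bilC S (M.mulVec v) o.rep = star c * bilC S v o.rep := by
    rw [← hM v o.rep, hc, bilC_smul_right, ← mul_assoc, mul_comm (star c), hcc, one_mul]
  rw [cartanInvolution, cartanInvolution, Matrix.mulVec_sub, Matrix.mulVec_add,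
    Matrix.mulVec_smul, Matrix.mulVec_smul, hc, hc', e1, e2, smul_smul, smul_smul]
  congr 3 <;> ring

lemma mulVec_star_eq {M : Matrix (Fin N) (Fin N) ℂ} {c : ℂ} {x y : Fin N → ℂ}
    {τ : (Fin N → ℂ) → (Fin N → ℂ)} (hτ : ∀ v, M.mulVec (τ v) = τ (M.mulVec v)) (hxy : τ x = y)
    (hsmul : τ (c • x) = star c • τ x) (hc : M.mulVec x = c • x) : M.mulVec y = star c • y := by
  rw [← hxy, hτ, hc, hsmul]

theorem compactForm_inf_stabilizer (h : IsBaseVector S o.rep) :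
    compactForm S o ⊓ MulAction.stabilizer (Matrix.SpecialLinearGroup (Fin N) ℂ) o =
      isotropyGroup S o := by
  ext g
  rw [isotropyGroup, Subgroup.mem_inf, Subgroup.mem_inf]
  refine and_congr_left fun hg => ?_
  obtain ⟨c, hc⟩ := mem_stabilizer_iff.1 hg
  refine and_congr_right fun hM => ⟨fun hτ v => ?_, fun hτ v => ?_⟩
  · change ∀ v, g.1.mulVec (compactConj S o v) = compactConj S o (g.1.mulVec v) at hτ
    have hc' := mulVec_star_eq hτ (compactConj_rep h) (compactConj_smul _ _) hc
    have e : ∀ v, star v = cartanInvolution S o (compactConj S o v) := fun v =>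
      (cartanInvolution_cartanInvolution h _).symm
    rw [e v, mulVec_cartanInvolution h hM hc hc', hτ, ← e]
  · have hc' := mulVec_star_eq hτ rfl (star_smul _ _) hc
    rw [mulVec_cartanInvolution h hM hc hc', hτ]

end Isotropy

end

section

open MvPolynomial

variable {N n : ℕ}

/-! ### The quadric -/

lemma eval_quadricPoly (S : Matrix (Fin N) (Fin N) ℝ) (v : Fin N → ℂ) :
    eval v (quadricPoly S) = bilC S v v := by
  simp [quadricPoly, bilC]

lemma isHomogeneous_quadricPoly (S : Matrix (Fin N) (Fin N) ℝ) :
    (quadricPoly S).IsHomogeneous 2 := by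
  refine IsHomogeneous.sum _ _ _ fun i _ => IsHomogeneous.sum _ _ _ fun j _ => ?_
  have := ((isHomogeneous_C (Fin N) (S i j : ℂ)).mul (isHomogeneous_X ℂ i)).mul
    (isHomogeneous_X ℂ j)
  simpa using this

lemma gradAt_quadricPoly {S : Matrix (Fin N) (Fin N) ℝ} (hS : S.IsSymm) (v : Fin N → ℂ)
    (k : Fin N) : gradAt (quadricPoly S) v k = 2 * bilC S v (Pi.single k 1) := by
  have h : gradAt (quadricPoly S) v k = bilC S v (Pi.single k 1) + bilC S (Pi.single k 1) v := by
    rw [gradAt, quadricPoly, bilC, bilC, ← Finset.sum_add_distrib]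
    simp only [map_sum, ← Finset.sum_add_distrib]
    refine Finset.sum_congr rfl fun i _ => Finset.sum_congr rfl fun j _ => ?_
    have hs : ∀ l, eval v (Pi.single (M := fun _ => MvPolynomial (Fin N) ℂ) k 1 l) =
        Pi.single (M := fun _ => ℂ) k 1 l := by
      intro l
      by_cases hl : l = k
      · subst hl; simp
      · simp [Pi.single_eq_of_ne hl]
    simp only [Derivation.leibniz, pderiv_C, pderiv_X, smul_eq_mul, map_add, map_mul, eval_X,
      eval_C, hs]
    simp
    ring
  rw [h, bilC_comm _ v hS, two_mul]

lemma gradAt_quadricPoly_ne_zero {S : Matrix (Fin N) (Fin N) ℝ} {o : PSpace N}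
    (h : IsBaseVector S o.rep) {v : Fin N → ℂ} (hv : v ≠ 0) : gradAt (quadricPoly S) v ≠ 0 := by
  intro h0
  have h1 : Matrix.toBilin' (S.map fun x : ℝ => (x : ℂ)) v = 0 := by
    refine LinearMap.pi_ext' fun k => LinearMap.ext_ring ?_
    have h2 := congrFun h0 k
    rw [gradAt_quadricPoly h.symm, Pi.zero_apply, bilC_eq_toBilin'] at h2
    exact (mul_eq_zero.1 h2).resolve_left two_ne_zero
  have h2 := bilC_compactConj_pos h hv
  rw [bilC_eq_toBilin', h1] at h2
  simp at h2

/-- Two linear equations in at least three unknowns have a nonzero solution. -/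
lemma exists_ne_zero_dotProduct_eq_zero (hn : 1 ≤ n) (x y : Fin (n + 2) → ℂ) :
    ∃ u ≠ 0, x ⬝ᵥ u = 0 ∧ y ⬝ᵥ u = 0 := by
  have : Nonempty (Fin n) := ⟨⟨0, hn⟩⟩
  obtain ⟨u, hu, hx, hy, -⟩ := (borderedDet_eq_zero_iff x y 0).1 (AlternatingMap.map_zero _)
  exact ⟨u, hu, hx, hy⟩

lemma exists_eval_eq_const_add {a : MvPolynomial (Fin N) ℂ} (ha : a.totalDegree ≤ 1) :
    ∃ (c : ℂ) (A : Fin N → ℂ), ∀ v, eval v a = c + A ⬝ᵥ v ∧ gradAt a v = A := by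
  have h1 := homogeneousComponent_isHomogeneous 1 a
  have hsum : a = C (coeff 0 a) + homogeneousComponent 1 a := by
    conv_lhs => rw [← sum_homogeneousComponent a]
    rw [Finset.sum_subset (s₂ := Finset.range 2), Finset.sum_range_succ, Finset.sum_range_one,
      homogeneousComponent_zero]
    · intro i hi
      rw [Finset.mem_range] at hi ⊢
      omega
    · intro i _ hi
      rw [Finset.mem_range] at hi
      exact homogeneousComponent_eq_zero _ _ (by omega)
  have hconst : ∀ v, gradAt (homogeneousComponent 1 a) v = gradAt (homogeneousComponent 1 a) 0 := by
    intro v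
    funext i
    have h2 := (totalDegree_zero_iff_isHomogeneous _).2 (h1.pderiv (i := i))
    rw [gradAt, gradAt, totalDegree_eq_zero_iff_eq_C.1 h2, eval_C, eval_C]
  refine ⟨coeff 0 a, gradAt (homogeneousComponent 1 a) 0, fun v => ⟨?_, ?_⟩⟩
  · rw [← hconst v, gradAt_dotProduct_self h1, Nat.cast_one, one_mul]
    conv_lhs => rw [hsum]
    rw [map_add, eval_C]
  · conv_lhs => rw [hsum]
    rw [gradAt_add, hconst v]
    have : gradAt (C (coeff 0 a)) v = 0 := by funext i; simp [gradAt]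
    rw [this, zero_add]

/-- A form of degree two in at least three variables whose gradient vanishes only at the origin is
irreducible: on the common kernel of the linear parts of two factors of degree one the gradient
would be constant, hence equal to its value at the origin. -/
lemma irreducible_of_gradAt_ne_zero (hn : 1 ≤ n) {Q : MvPolynomial (Fin (n + 2)) ℂ}
    (hQ : Q.IsHomogeneous 2) (hgrad : ∀ v, v ≠ 0 → gradAt Q v ≠ 0) : Irreducible Q := by
  have hQ0 : Q ≠ 0 := by
    rintro rfl
    refine hgrad (Pi.single 0 1) (by simp) ?_
    funext i
    simp [gradAt]
  have hdeg := hQ.totalDegree hQ0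
  have hunit : ∀ a : MvPolynomial (Fin (n + 2)) ℂ, a ≠ 0 → a.totalDegree = 0 → IsUnit a := by
    intro a ha h
    have h1 := totalDegree_eq_zero_iff_eq_C.1 h
    have h2 : coeff 0 a ≠ 0 := fun h2 => ha (by rw [h1, h2, C_0])
    rw [h1]
    exact (IsUnit.mk0 _ h2).map C
  refine ⟨fun hu => ?_, fun a b hab => ?_⟩
  · obtain ⟨R, hR⟩ := hu.exists_right_inv
    have hR0 : R ≠ 0 := by rintro rfl; simp at hR
    have := totalDegree_mul_of_isDomain hQ0 hR0
    rw [hR, totalDegree_one] at this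
    omega
  · have ha0 : a ≠ 0 := by rintro rfl; exact hQ0 (by rw [hab, zero_mul])
    have hb0 : b ≠ 0 := by rintro rfl; exact hQ0 (by rw [hab, mul_zero])
    have hsum := totalDegree_mul_of_isDomain ha0 hb0
    rw [← hab, hdeg] at hsum
    by_contra! hnot
    have ha1 : a.totalDegree ≠ 0 := fun h => hnot.1 (hunit a ha0 h)
    have hb1 : b.totalDegree ≠ 0 := fun h => hnot.2 (hunit b hb0 h)
    obtain ⟨c, A, hA⟩ := exists_eval_eq_const_add (a := a) (by omega)
    obtain ⟨c', B, hB⟩ := exists_eval_eq_const_add (a := b) (by omega)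
    obtain ⟨u, hu, hAu, hBu⟩ := exists_ne_zero_dotProduct_eq_zero hn A B
    have h1 : ∀ v, gradAt Q v = eval v a • B + eval v b • A := fun v => by
      rw [hab, gradAt_mul, (hA v).2, (hB v).2]
    have h2 : gradAt Q 0 = 0 := by
      funext i
      exact eval_zero_of_isHomogeneous hQ.pderiv (by norm_num)
    refine hgrad u hu ?_
    rw [← h2, h1, h1, (hA u).1, (hB u).1, (hA 0).1, (hB 0).1, hAu, hBu, dotProduct_zero,
      dotProduct_zero]

lemma isSmoothHypersurface_quadricPoly (hn : 1 ≤ n)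
    {S : Matrix (Fin (n + 2)) (Fin (n + 2)) ℝ} {o : PSpace (n + 2)}
    (h : IsBaseVector S o.rep) : IsSmoothHypersurface (quadricPoly S) 1 where
  homog := isHomogeneous_quadricPoly S
  irreducible := irreducible_of_gradAt_ne_zero hn (isHomogeneous_quadricPoly S) fun _ hv =>
    gradAt_quadricPoly_ne_zero h hv
  gradAt_ne_zero _ hv _ := gradAt_quadricPoly_ne_zero h hv

end

section

open MvPolynomial

variable {N n : ℕ}

/-! ### The compact real form acts transitively on the quadric -/

/-- The orthogonal reflection in a vector `c` with `b(c, c) ≠ 0`. -/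
def reflMatrix (S : Matrix (Fin N) (Fin N) ℝ) (c : Fin N → ℂ) : Matrix (Fin N) (Fin N) ℂ :=
  1 + Matrix.vecMulVec ((-2 / bilC S c c) • c) ((S.map fun x : ℝ => (x : ℂ)).mulVec c)

/-- A complex linear isometry of determinant `± 1` that commutes with the conjugation `τ`. -/
structure IsIsometry (S : Matrix (Fin N) (Fin N) ℝ) (τ : (Fin N → ℂ) → (Fin N → ℂ))
    (M : Matrix (Fin N) (Fin N) ℂ) : Prop where
  bil : ∀ v w, bilC S (M.mulVec v) (M.mulVec w) = bilC S v w
  conj : ∀ v, M.mulVec (τ v) = τ (M.mulVec v)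
  det : M.det = 1 ∨ M.det = -1

section

variable {S : Matrix (Fin N) (Fin N) ℝ}

lemma isIsometry_one (τ : (Fin N → ℂ) → (Fin N → ℂ)) : IsIsometry S τ 1 :=
  ⟨by simp, by simp, by simp⟩

lemma IsIsometry.mul {τ : (Fin N → ℂ) → (Fin N → ℂ)} {M M' : Matrix (Fin N) (Fin N) ℂ}
    (h : IsIsometry S τ M) (h' : IsIsometry S τ M') : IsIsometry S τ (M * M') where
  bil v w := by rw [← Matrix.mulVec_mulVec, ← Matrix.mulVec_mulVec, h.bil, h'.bil]
  conj v := by rw [← Matrix.mulVec_mulVec, ← Matrix.mulVec_mulVec, h'.conj, h.conj]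
  det := by
    rw [Matrix.det_mul]
    rcases h.det with h1 | h1 <;> rcases h'.det with h2 | h2 <;> simp [h1, h2]

lemma reflMatrix_mulVec (S : Matrix (Fin N) (Fin N) ℝ) (c v : Fin N → ℂ) :
    (reflMatrix S c).mulVec v = v - (2 * bilC S v c / bilC S c c) • c := by
  rw [reflMatrix, Matrix.add_mulVec, Matrix.one_mulVec, Matrix.vecMulVec_mulVec, op_smul_eq_smul,
    smul_smul, dotProduct_comm, ← Matrix.toBilin'_apply', ← bilC_eq_toBilin', sub_eq_add_neg,
    ← neg_smul]
  congr 2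
  ring

lemma det_reflMatrix {c : Fin N → ℂ} (hc : bilC S c c ≠ 0) : (reflMatrix S c).det = -1 := by
  rw [reflMatrix, Matrix.vecMulVec_eq Unit, Matrix.det_one_add_replicateCol_mul_replicateRow,
    dotProduct_comm, smul_dotProduct, ← Matrix.toBilin'_apply', ← bilC_eq_toBilin', smul_eq_mul,
    div_mul_cancel₀ _ hc]
  norm_num

variable {o : PSpace N}

lemma bilC_self_ne_zero (h : IsBaseVector S o.rep) {c : Fin N → ℂ} (hc : compactConj S o c = c)
    (hc0 : c ≠ 0) : bilC S c c ≠ 0 := by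
  intro h0
  have := bilC_compactConj_pos h hc0
  rw [hc, h0] at this
  simp at this

lemma isIsometry_reflMatrix (h : IsBaseVector S o.rep) {c : Fin N → ℂ}
    (hc : compactConj S o c = c) (hc0 : c ≠ 0) :
    IsIsometry S (compactConj S o) (reflMatrix S c) where
  bil v w := by
    have h0 := bilC_self_ne_zero h hc hc0
    have h1 := bilC_comm c w h.symm
    simp only [reflMatrix_mulVec, bilC_sub_left, bilC_sub_right, bilC_smul_left, bilC_smul_right,
      h1]
    field_simp
    ring
  conj v := by
    have h1 : bilC S (compactConj S o v) c = star (bilC S v c) := by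
      rw [← bilC_compactConj h, hc]
    have h2 : bilC S c c = star (bilC S c c) := by
      conv_rhs => rw [← bilC_compactConj h, hc]
    rw [reflMatrix_mulVec, reflMatrix_mulVec, compactConj_sub, compactConj_smul, hc, h1, star_div₀,
      star_mul, ← h2, star_ofNat, mul_comm (2 : ℂ)]
  det := Or.inr (det_reflMatrix (bilC_self_ne_zero h hc hc0))

/-- A reflection maps a real vector to another one of the same length, fixing all vectors orthogonal
to both. -/
lemma exists_isIsometry_mulVec_eq (h : IsBaseVector S o.rep) {a a' : Fin N → ℂ}
    (ha : compactConj S o a = a) (ha' : compactConj S o a' = a')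
    (haa : bilC S a a = bilC S a' a') :
    ∃ M, IsIsometry S (compactConj S o) M ∧ M.mulVec a = a' ∧
      ∀ z, bilC S z a = 0 → bilC S z a' = 0 → M.mulVec z = z := by
  by_cases h0 : a - a' = 0
  · exact ⟨1, isIsometry_one _, by rw [Matrix.one_mulVec, sub_eq_zero.1 h0], by simp⟩
  have hc : compactConj S o (a - a') = a - a' := by rw [compactConj_sub, ha, ha']
  have h1 := bilC_self_ne_zero h hc h0
  refine ⟨reflMatrix S (a - a'), isIsometry_reflMatrix h hc h0, ?_, fun z hz hz' => ?_⟩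
  · have h2 : bilC S (a - a') (a - a') = 2 * bilC S a (a - a') := by
      simp only [bilC_sub_left, bilC_sub_right, bilC_comm a' a h.symm, ← haa]
      ring
    rw [reflMatrix_mulVec, ← h2, div_self h1, one_smul]
    abel
  · rw [reflMatrix_mulVec, bilC_sub_right, hz, hz']
    simp

/-- An isotropic vector is `x + i y` with `x` and `y` orthogonal vectors of the same length in the
compact real structure. -/
lemma exists_eq_add_I_smul (h : IsBaseVector S o.rep) {v : Fin N → ℂ} (hv : bilC S v v = 0) :
    ∃ x y, compactConj S o x = x ∧ compactConj S o y = y ∧ v = x + Complex.I • y ∧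
      bilC S x y = 0 ∧ bilC S x x = bilC S v (compactConj S o v) / 2 ∧
      bilC S y y = bilC S v (compactConj S o v) / 2 := by
  have h1 := compactConj_compactConj h v
  have h2 : bilC S (compactConj S o v) (compactConj S o v) = 0 := by
    rw [bilC_compactConj h, hv, star_zero]
  have h3 := bilC_comm (compactConj S o v) v h.symm
  have hI : star (-Complex.I / 2) = Complex.I / 2 := by
    simp
  have hI2 : star (1 / 2 : ℂ) = 1 / 2 := by simp
  refine ⟨(1 / 2 : ℂ) • (v + compactConj S o v), (-Complex.I / 2) • (v - compactConj S o v),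
    ?_, ?_, ?_, ?_, ?_, ?_⟩
  · rw [compactConj_smul, compactConj_add, h1, hI2, add_comm]
  · rw [compactConj_smul, compactConj_sub, h1, hI]
    module
  · rw [smul_smul, show Complex.I * (-Complex.I / 2) = 1 / 2 by
      linear_combination (-1 / 2 : ℂ) * Complex.I_mul_I]
    module
  · simp only [bilC_smul_left, bilC_smul_right, bilC_add_left, bilC_sub_right, hv, h2, h3]
    ring
  · simp only [bilC_smul_left, bilC_smul_right, bilC_add_left, bilC_add_right, hv, h2, h3]
    ring
  · simp only [bilC_smul_left, bilC_smul_right, bilC_sub_left, bilC_sub_right, hv, h2, h3]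
    linear_combination (-bilC S v (compactConj S o v) / 2) * Complex.I_mul_I

/-- Two reflections map a given isotropic vector to a multiple of the base vector. -/
lemma exists_isIsometry_mulVec_eq_smul_rep (h : IsBaseVector S o.rep) {v : Fin N → ℂ} (hv0 : v ≠ 0)
    (hv : bilC S v v = 0) :
    ∃ (M : Matrix (Fin N) (Fin N) ℂ) (t : ℂ), IsIsometry S (compactConj S o) M ∧
      M.mulVec v = t • o.rep := by
  have hpos := bilC_compactConj_pos h hv0
  have hpos' := bilC_compactConj_pos h o.rep_nonzero
  have hreal : ∀ v, bilC S v (compactConj S o v) = ((bilC S v (compactConj S o v)).re : ℂ) := by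
    intro v
    refine (Complex.conj_eq_iff_re.1 ?_).symm
    rw [← Complex.star_def, ← bilC_compactConj h, compactConj_compactConj h, bilC_comm _ _ h.symm]
  obtain ⟨x', y', hx', hy', hv', hxy', hxx', hyy'⟩ := exists_eq_add_I_smul h hv
  obtain ⟨x, y, hx, hy, ho, hxy, hxx, hyy⟩ := exists_eq_add_I_smul h h.isotropic
  set r := (bilC S v (compactConj S o v)).re with hr
  set r' := (bilC S o.rep (compactConj S o o.rep)).re with hr'
  -- the real factor that makes the lengths equal
  set t := Real.sqrt (r' / r) with ht
  have ht0 : (t : ℂ) ≠ 0 := by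
    rw [Complex.ofReal_ne_zero]
    exact (Real.sqrt_pos.2 (div_pos hpos' hpos)).ne'
  have htt : (t : ℂ) * t * r = r' := by
    rw [← Complex.ofReal_mul, Real.mul_self_sqrt (div_pos hpos' hpos).le, ← Complex.ofReal_mul,
      div_mul_cancel₀ _ hpos.ne']
  rw [hreal v, ← hr] at hxx' hyy'
  rw [hreal o.rep, ← hr'] at hxx hyy
  have hsmul : ∀ z, compactConj S o z = z → compactConj S o ((t : ℂ) • z) = (t : ℂ) • z := by
    intro z hz
    rw [compactConj_smul, hz, Complex.star_def, Complex.conj_ofReal]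
  obtain ⟨M₁, hM₁, hM₁x, -⟩ := exists_isIsometry_mulVec_eq h (hsmul x' hx') hx (by
    rw [bilC_smul_left, bilC_smul_right, hxx', hxx]
    linear_combination htt / 2)
  obtain ⟨M₂, hM₂, hM₂y, hM₂x⟩ := exists_isIsometry_mulVec_eq (a := M₁.mulVec ((t : ℂ) • y')) h
    (by rw [← hM₁.conj, hsmul y' hy']) hy (by
      rw [hM₁.bil, bilC_smul_left, bilC_smul_right, hyy', hyy]
      linear_combination htt / 2)
  have hfix : M₂.mulVec x = x := hM₂x x (by
    rw [← hM₁x, hM₁.bil, bilC_smul_left, bilC_smul_right, hxy', mul_zero, mul_zero]) hxy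
  refine ⟨M₂ * M₁, (t : ℂ)⁻¹, hM₂.mul hM₁, ?_⟩
  rw [eq_inv_smul_iff₀ ht0, ← Matrix.mulVec_smul, ← Matrix.mulVec_mulVec]
  have e1 : (t : ℂ) • v = (t : ℂ) • x' + Complex.I • ((t : ℂ) • y') := by
    rw [hv', smul_add, smul_comm]
  rw [e1, Matrix.mulVec_add, Matrix.mulVec_add, hM₁x, hfix, Matrix.mulVec_smul,
    Matrix.mulVec_smul, hM₂y, ho]

end

section

variable {S : Matrix (Fin (n + 2)) (Fin (n + 2)) ℝ} {o : PSpace (n + 2)}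

/-- There is a real vector orthogonal to the plane of the base vector. -/
lemma exists_compactConj_eq_orthogonal (hn : 1 ≤ n) (h : IsBaseVector S o.rep) :
    ∃ c, c ≠ 0 ∧ compactConj S o c = c ∧ bilC S o.rep c = 0 := by
  obtain ⟨w, hw, h1, h2⟩ := exists_ne_zero_dotProduct_eq_zero hn
    (Matrix.vecMul o.rep (S.map fun x : ℝ => (x : ℂ)))
    (Matrix.vecMul (star o.rep) (S.map fun x : ℝ => (x : ℂ)))
  rw [← Matrix.dotProduct_mulVec, ← Matrix.toBilin'_apply', ← bilC_eq_toBilin'] at h1 h2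
  have h3 : bilC S o.rep (compactConj S o w) = 0 := by
    rw [← compactConj_compactConj h o.rep, bilC_compactConj h, compactConj_rep h, h2, star_zero]
  by_cases h0 : w + compactConj S o w = 0
  · refine ⟨Complex.I • (w - compactConj S o w), ?_, ?_, ?_⟩
    · refine smul_ne_zero Complex.I_ne_zero fun h4 => hw ?_
      have : (2 : ℂ) • w = 0 := by
        rw [two_smul]
        calc w + w = (w + compactConj S o w) + (w - compactConj S o w) := by abel
          _ = 0 := by rw [h0, h4, add_zero]
      exact (smul_eq_zero.1 this).resolve_left two_ne_zero
    · rw [compactConj_smul, compactConj_sub, compactConj_compactConj h, Complex.star_def,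
        Complex.conj_I]
      module
    · rw [bilC_smul_right, bilC_sub_right, h1, h3, sub_zero, mul_zero]
  · refine ⟨w + compactConj S o w, h0, ?_, ?_⟩
    · rw [compactConj_add, compactConj_compactConj h, add_comm _ w]
    · rw [bilC_add_right, h1, h3, add_zero]

lemma exists_mem_compactForm (hn : 1 ≤ n) (h : IsBaseVector S o.rep) {v : Fin (n + 2) → ℂ}
    (hv0 : v ≠ 0) (hv : bilC S v v = 0) :
    ∃ g ∈ compactForm S o, ∃ t : ℂ, g.1.mulVec v = t • o.rep := by
  obtain ⟨M, t, hM, hMv⟩ := exists_isIsometry_mulVec_eq_smul_rep h hv0 hv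
  rcases hM.det with hdet | hdet
  · exact ⟨⟨M, hdet⟩, ⟨hM.bil, hM.conj⟩, t, hMv⟩
  · -- correct the determinant by a reflection that fixes the base vector
    obtain ⟨c, hc0, hc, hco⟩ := exists_compactConj_eq_orthogonal hn h
    have hR := (isIsometry_reflMatrix h hc hc0).mul hM
    refine ⟨⟨reflMatrix S c * M, ?_⟩, ⟨hR.bil, hR.conj⟩, t, ?_⟩
    · rw [Matrix.det_mul, hdet, det_reflMatrix (bilC_self_ne_zero h hc hc0)]
      norm_num
    · change (reflMatrix S c * M).mulVec v = _
      rw [← Matrix.mulVec_mulVec, hMv, reflMatrix_mulVec, bilC_smul_left, hco]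
      simp

lemma smul_mk_eq (g : Matrix.SpecialLinearGroup (Fin N) ℂ) {v : Fin N → ℂ} (hv : v ≠ 0) :
    ∃ h : g.1.mulVec v ≠ 0,
      g • Projectivization.mk ℂ v hv = Projectivization.mk ℂ (g.1.mulVec v) h := by
  refine ⟨fun h => hv ?_, rfl⟩
  have := congrArg (g⁻¹).1.mulVec h
  rwa [Matrix.mulVec_mulVec, ← Matrix.SpecialLinearGroup.coe_mul, inv_mul_cancel,
    Matrix.SpecialLinearGroup.coe_one, Matrix.one_mulVec, Matrix.mulVec_zero] at this

theorem compactDual_eq_zeroLocus (hn : 1 ≤ n) (h : IsBaseVector S o.rep) :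
    compactDual S o = zeroLocus (quadricPoly S) := by
  ext x
  constructor
  · rintro ⟨g, rfl⟩
    change eval (g.1 • o).rep (quadricPoly S) = 0
    obtain ⟨h0, h1⟩ := smul_mk_eq g.1 o.rep_nonzero
    rw [o.mk_rep] at h1
    rw [h1, eval_rep_mk_eq_zero_iff (isHomogeneous_quadricPoly S), eval_quadricPoly, g.2.1,
      h.isotropic]
  · intro hx
    change eval x.rep (quadricPoly S) = 0 at hx
    rw [eval_quadricPoly] at hx
    obtain ⟨g, hg, t, ht⟩ := exists_mem_compactForm hn h x.rep_nonzero hx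
    have hgx : g • x = o := by
      obtain ⟨h0, h1⟩ := smul_mk_eq g x.rep_nonzero
      rw [x.mk_rep] at h1
      rw [h1]
      conv_rhs => rw [← o.mk_rep]
      exact (Projectivization.mk_eq_mk_iff' ..).2 ⟨t, ht.symm⟩
    exact ⟨⟨g⁻¹, inv_mem hg⟩, by
      change g⁻¹ • o = x
      rw [← hgx, inv_smul_smul]⟩

end

end

end OrthogonalDual

end

open OrthogonalDual in
theorem mainTheorem6 {V : Type*} [AddCommGroup V] [Module ℝ V] (n : ℕ) (hn : 1 ≤ n)
    (q : QuadraticForm ℝ V) (hpos : sigPos q = 2) (hneg : sigNeg q = n)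
    (e : Module.Basis (Fin (n + 2)) ℝ V)
    (o : PSpace (n + 2)) (ho : o ∈ symmetricSpace (gram q e)) :
    -- the orbit is the homogeneous space of the compact real form by the isotropy group `K`
    compactForm (gram q e) o ⊓
        MulAction.stabilizer (Matrix.SpecialLinearGroup (Fin (n + 2)) ℂ) o =
      isotropyGroup (gram q e) o ∧
    -- the compact dual is a quadric hypersurface
    (quadricPoly (gram q e)).IsHomogeneous 2 ∧ Irreducible (quadricPoly (gram q e)) ∧
    compactDual (gram q e) o = zeroLocus (quadricPoly (gram q e)) ∧
    -- its canonical bundle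
    CanonicalBundleIs n (compactDual (gram q e) o) (-n) ∧
    -- finite dimensionality of the cohomology, and the Euler characteristics
    (∀ (k : ℤ) (p : ℕ),
      Module.Finite ℂ (Cohomology (compactDual (gram q e) o) k p) ∧
      Module.Finite ℂ (Cohomology (Set.univ : Set (PSpace (n + 2))) k p)) ∧
    ∀ ℓ : ℤ,
      eulerChar (compactDual (gram q e) o) (-n * ℓ) =
        eulerChar (Set.univ : Set (PSpace (n + 2))) (-n * ℓ) -
          eulerChar (Set.univ : Set (PSpace (n + 2))) (-n * ℓ - 2) ∧
      eulerChar (Set.univ : Set (PSpace (n + 2))) (-n * ℓ) -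
          eulerChar (Set.univ : Set (PSpace (n + 2))) (-n * ℓ - 2) =
        Ring.choose ((n : ℤ) + 1 - n * ℓ) (n + 1) - Ring.choose ((n : ℤ) - 1 - n * ℓ) (n + 1) := by
  have h := isBaseVector_rep hneg ho
  have hQ := isSmoothHypersurface_quadricPoly hn h
  have hX := compactDual_eq_zeroLocus hn h
  have hχ := eulerChar_hypersurface hQ.homog hQ.irreducible
  refine ⟨compactForm_inf_stabilizer h, hQ.homog, hQ.irreducible, hX, ?_, fun k p => ⟨?_, ?_⟩,
    fun ℓ => ⟨?_, ?_⟩⟩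
  · rw [hX]
    have hω := canonicalBundleIs_hypersurface hQ
    rwa [show ((1 : ℕ) : ℤ) - n - 1 = -n by push_cast; ring] at hω
  · rw [hX]
    exact (hχ k).1 p
  · exact finite_cohomology_univ k p
  · rw [hX]
    exact (hχ _).2
  · rw [eulerChar_univ, eulerChar_univ, show -(n : ℤ) * ℓ + n + 1 = n + 1 - n * ℓ by ring,
      show -(n : ℤ) * ℓ - 2 + n + 1 = n - 1 - n * ℓ by ring]
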